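/- Let $n\ge 1$ and let $d_1\ge d_2\ge\dots\ge d_m\ge 1$ be integers with $d_1+\dots+d_m=n$. Manifolds are smooth, connected, Hausdorff, second countable and without boundary. A smooth $(1,1)$ tensor $\Theta$ on an $n$-manifold $M$ (a smooth field of endomorphisms $\Theta_x$ of $T_xM$) is called \emph{algebraically constant} if for all $x,y\in M$ some linear isomorphism $T_xM\to T_yM$ conjugates $\Theta_x$ to $\Theta_y$; it is \emph{nilpotent of algebraic type} $d_1\dots d_m$ if it is algebraically constant and each $\Theta_x$ is nilpotent with Jordan blocks of lengths $d_1,\dots,d_m$. It is \emph{locally constant} if around each point there are local coordinates in which its components are constant. Its Nijenhuis tensor is $$N(v,w)=\Theta[\Theta v,w]+\Theta[v,\Theta w]-[\Theta v,\Theta w]-\Theta^2[v,w].$$ The algebraic type $d_1\dots d_m$ is \emph{controlled by the Nijenhuis tensor} if, on every $n$-manifold, each smooth nilpotent $(1,1)$ tensor of this type with $N=0$ is locally constant. Then the type $d_1\dots d_m$ is controlled by the Nijenhuis tensor if and only if (*) either all $d_i$ are equal, or exactly two different lengths occur among $d_1,\dots,d_m$ and the shorter one occurs just once. Moreover, if (*)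 fails, then there are an $n$-dimensional connected nilpotent Lie group $G$ of nilpotency step exactly $2$ and a left-invariant smooth $(1,1)$ tensor $\Theta$ on $G$, nilpotent of algebraic type $d_1\dots d_m$, such that $N=0$ but the distribution $\operatorname{Ker}\Theta^p$ is not integrable for some integer $p\ge1$; one may take $p$ to be the smallest of the lengths $d_1,\dots,d_m$. Here a distribution is integrable if around each point there are local coordinates in which it is a constant subspace. -/

import Mathlib

open Set
open scoped Manifold ContDiff

universe u

namespace NilpotentTensor

/-! ### Linear algebra: Jordan normal forms of nilpotent endomorphisms -/

/-- The endomorphism `T` is nilpotent, with Jordan blocks of lengths `d 0, …, d (m - 1)`: in some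
basis `e i k` (block `i`, position `k` in the block) one has `T (e i 0) = 0` and
`T (e i (k + 1)) = e i k`. -/
def HasJordanForm {V : Type*} [AddCommGroup V] [Module ℝ V] {m : ℕ} (d : Fin m → ℕ)
    (T : V →ₗ[ℝ] V) : Prop :=
  ∃ e : Module.Basis (Σ i : Fin m, Fin (d i)) ℝ V,
    (∀ (i : Fin m) (k : Fin (d i)), (k : ℕ) = 0 → T (e ⟨i, k⟩) = 0) ∧
    (∀ (i : Fin m) (k l : Fin (d i)), (l : ℕ) = k + 1 → T (e ⟨i, l⟩) = e ⟨i, k⟩)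

/-- Either all blocks have the same length, or exactly two different lengths `b < a` occur, the
shorter one just once. -/
def BlockCondition {m : ℕ} (d : Fin m → ℕ) : Prop :=
  (∃ a, ∀ i, d i = a) ∨
  (∃ a b, b < a ∧ (∀ i, d i = a ∨ d i = b) ∧ (∃ i, d i = a) ∧ (∃! i, d i = b))

/-! ### (1,1) tensors on a smooth `n`-manifold -/

section Manifold

variable {n : ℕ} {M : Type*} [TopologicalSpace M] [ChartedSpace (EuclideanSpace ℝ (Fin n)) M]

/-- The field of endomorphisms `Θ` of the tangent spaces is smooth, as a section of the bundle
`Hom(TM, TM)`. -/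
def IsSmoothTensor [IsManifold (𝓡 n) ∞ M]
    (Θ : ∀ x : M, TangentSpace (𝓡 n) x →L[ℝ] TangentSpace (𝓡 n) x) : Prop :=
  ContMDiff (𝓡 n)
    ((𝓡 n).prod 𝓘(ℝ, EuclideanSpace ℝ (Fin n) →L[ℝ] EuclideanSpace ℝ (Fin n))) ∞
    (fun x : M => (⟨x, Θ x⟩ : Bundle.TotalSpace
      (EuclideanSpace ℝ (Fin n) →L[ℝ] EuclideanSpace ℝ (Fin n))
      (fun x : M => TangentSpace (𝓡 n) x →L[ℝ] TangentSpace (𝓡 n) x)))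

/-- Any two values of `Θ` are conjugate under some linear isomorphism of tangent spaces. -/
def IsAlgebraicallyConstant
    (Θ : ∀ x : M, TangentSpace (𝓡 n) x →L[ℝ] TangentSpace (𝓡 n) x) : Prop :=
  ∀ x y : M, ∃ F : TangentSpace (𝓡 n) x ≃ₗ[ℝ] TangentSpace (𝓡 n) y,
    ∀ v : TangentSpace (𝓡 n) x, F (Θ x v) = Θ y (F v)

/-- `Θ` is an algebraically constant (nilpotent) tensor whose Jordan normal form has the block
lengths `d`. -/
def HasAlgebraicType {m : ℕ} (d : Fin m → ℕ)
    (Θ : ∀ x : M, TangentSpace (𝓡 n) x →L[ℝ] TangentSpace (𝓡 n) x) : Prop :=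
  IsAlgebraicallyConstant Θ ∧
    ∀ x : M, HasJordanForm d (Θ x : TangentSpace (𝓡 n) x →ₗ[ℝ] TangentSpace (𝓡 n) x)

/-- Smoothness of a vector field on a set. -/
def IsSmoothFieldOn [IsManifold (𝓡 n) ∞ M] (v : ∀ x : M, TangentSpace (𝓡 n) x) (U : Set M) :
    Prop :=
  ContMDiffOn (𝓡 n) (𝓡 n).tangent ∞ (fun x : M => (⟨x, v x⟩ : TangentBundle (𝓡 n) M)) U

/-- The Nijenhuis expression
`N(v, w) = Θ[Θv, w] + Θ[v, Θw] - [Θv, Θw] - Θ²[v, w]`. -/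
noncomputable def nijenhuis (Θ : ∀ x : M, TangentSpace (𝓡 n) x →L[ℝ] TangentSpace (𝓡 n) x)
    (v w : ∀ x : M, TangentSpace (𝓡 n) x) (x : M) : TangentSpace (𝓡 n) x :=
  Θ x (VectorField.mlieBracket (𝓡 n) (fun y => Θ y (v y)) w x)
    + Θ x (VectorField.mlieBracket (𝓡 n) v (fun y => Θ y (w y)) x)
    - VectorField.mlieBracket (𝓡 n) (fun y => Θ y (v y)) (fun y => Θ y (w y)) x
    - Θ x (Θ x (VectorField.mlieBracket (𝓡 n) v w x))

/-- The Nijenhuis tensor vanishes: `N(v, w) = 0` for all local smooth vector fields. -/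
def NijenhuisVanishes [IsManifold (𝓡 n) ∞ M]
    (Θ : ∀ x : M, TangentSpace (𝓡 n) x →L[ℝ] TangentSpace (𝓡 n) x) : Prop :=
  ∀ (U : Set M), IsOpen U → ∀ v w : ∀ x : M, TangentSpace (𝓡 n) x,
    IsSmoothFieldOn v U → IsSmoothFieldOn w U → ∀ x ∈ U, nijenhuis Θ v w x = 0

/-- `Θ` has constant components in suitable smooth local coordinates `φ` around each point. -/
def IsLocallyConstantTensor
    (Θ : ∀ x : M, TangentSpace (𝓡 n) x →L[ℝ] TangentSpace (𝓡 n) x) : Prop :=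
  ∀ x : M, ∃ φ ∈ IsManifold.maximalAtlas (𝓡 n) ∞ M, x ∈ φ.source ∧
    ∃ A : EuclideanSpace ℝ (Fin n) →L[ℝ] EuclideanSpace ℝ (Fin n),
      ∀ y ∈ φ.source, ∀ v : TangentSpace (𝓡 n) y,
        mfderiv (𝓡 n) (𝓡 n) φ y (Θ y v) = A (mfderiv (𝓡 n) (𝓡 n) φ y v)

/-- Integrability of a distribution: around each point there are smooth local coordinates `φ`
in which the distribution is a constant subspace `W`, so that the preimages under `φ` of the
translates of `W` are integral manifolds. -/
def IsIntegrableDistribution (D : ∀ x : M, Submodule ℝ (TangentSpace (𝓡 n) x)) : Prop :=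
  ∀ x : M, ∃ φ ∈ IsManifold.maximalAtlas (𝓡 n) ∞ M, x ∈ φ.source ∧
    ∃ W : Submodule ℝ (EuclideanSpace ℝ (Fin n)),
      ∀ y ∈ φ.source, ∀ v : TangentSpace (𝓡 n) y,
        v ∈ D y ↔ (mfderiv (𝓡 n) (𝓡 n) φ y v : EuclideanSpace ℝ (Fin n)) ∈ W

/-- The distribution `Ker Θ ^ p`. -/
noncomputable def kerPow (Θ : ∀ x : M, TangentSpace (𝓡 n) x →L[ℝ] TangentSpace (𝓡 n) x) (p : ℕ) (x : M) :
    Submodule ℝ (TangentSpace (𝓡 n) x) :=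
  LinearMap.ker ((Θ x : TangentSpace (𝓡 n) x →ₗ[ℝ] TangentSpace (𝓡 n) x) ^ p)

/-- Invariance of `Θ` under the left translations of a group. -/
def IsLeftInvariant [Group M]
    (Θ : ∀ x : M, TangentSpace (𝓡 n) x →L[ℝ] TangentSpace (𝓡 n) x) : Prop :=
  ∀ (g x : M) (v : TangentSpace (𝓡 n) x),
    mfderiv (𝓡 n) (𝓡 n) (fun y : M => g * y) x (Θ x v)
      = Θ (g * x) (mfderiv (𝓡 n) (𝓡 n) (fun y : M => g * y) x v)

end Manifold

/-- The algebraic type of nilpotent (1,1) tensors in dimension `n` with Jordan block lengths `d`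
is controlled by the Nijenhuis tensor: on every (connected, Hausdorff, second countable, smooth)
`n`-manifold, `N = 0` implies local constancy for all tensors of this type. -/
def ControlledByNijenhuis (n : ℕ) {m : ℕ} (d : Fin m → ℕ) : Prop :=
  ∀ (M : Type u) [TopologicalSpace M] [T2Space M] [SecondCountableTopology M] [ConnectedSpace M]
    [ChartedSpace (EuclideanSpace ℝ (Fin n)) M] [IsManifold (𝓡 n) ∞ M]
    (Θ : ∀ x : M, TangentSpace (𝓡 n) x →L[ℝ] TangentSpace (𝓡 n) x),
    IsSmoothTensor Θ → HasAlgebraicType d Θ → NijenhuisVanishes Θ → IsLocallyConstantTensor Θ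

end NilpotentTensor

/-! Sufficiency of (*). In a chart, all values of Θ are conjugate, so kernels of powers have
constant dimension and a Jordan basis at one point extends to a smooth frame of Jordan bases
(`exists_smooth_jordanBasis`). The equation N = 0 says that the defect w ↦ [Θv, w] - Θ[v, w]
commutes with Θ, and the same then holds for every power of Θ (`powDefect_apply_right`). Hence the
bracket of two frame fields in Ker Θ^j stays in Ker Θ^j if one of them belongs to a block of maximal
length, or if both belong to the same block. Under (*) there is no other case
(`BlockCondition.exists_max`), so all the kernels are involutive (`AdaptedFrame.of_blockCondition`).

Involutive kernels give flat coordinates. For each block one needs functions f_k with df_k ∘ Θ =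
df_{k+1} and df_k = 0 on Ker Θ^k, and they are found by descending k (`AdaptedFrame.exists_step`,
`AdaptedFrame.exists_chain`). Given f_{k+1}, the values of df_k on Im Θ + Ker Θ^k are forced; N = 0
and involutivity are exactly what makes this prescription integrable. Integration is Frobenius'
theorem (`exists_first_integrals`, `exists_primitive`): the equation dw = F(x, w) dx is solved along
rays by the implicit function theorem in a Banach space of curves, which gives smooth dependence on
the initial point at once.

Necessity of (*). If (*) fails, there are a shortest block k, another block j and a block i longer
than j (`exists_indices_of_not_blockCondition`). Let T be the Jordan operator, with positions
counted from 0. Let ψ send e_{j,s} to e_{i,s+1} and the other blocks to 0, and let γ be the top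
coordinate of block k. On the two-step group x * y = x + y + γ(y) ψ(x), the left-invariant tensor
extending T has N = 0, because γT = 0 and TψT = T²ψ. With p = d k, the vectors e_{j,p-1} and
e_{k,p-1} lie in Ker T^p, while their bracket e_{i,p} does not. An integrable distribution is
involutive (`IsIntegrableDistribution.lieBracket_mem`), so Ker Θ^p is not integrable. A locally
constant tensor has integrable kernels, so the type is not controlled. -/

namespace NilpotentTensor
open Filter Topology

universe w

/-! ### Composition with a smooth map, as a map between spaces of continuous functions -/

section Composition

variable {K : Type*} [TopologicalSpace K] [CompactSpace K]
  {E : Type w} [NormedAddCommGroup E] [NormedSpace ℝ E]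
  {F : Type w} [NormedAddCommGroup F] [NormedSpace ℝ F]

/-- Pointwise application of a family of continuous linear maps to a continuous function. -/
noncomputable def pointwiseApply : C(K, E →L[ℝ] F) →L[ℝ] C(K, E) →L[ℝ] C(K, F) :=
  LinearMap.mkContinuous₂
    (LinearMap.mk₂ ℝ
      (fun (A : C(K, E →L[ℝ] F)) (h : C(K, E)) =>
        (⟨fun t => A t (h t), A.continuous.clm_apply h.continuous⟩ : C(K, F)))
      (by intros; ext; simp) (by intros; ext; simp) (by intros; ext; simp) (by intros; ext; simp))
    1 (by
      intro A h
      rw [one_mul]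
      refine (ContinuousMap.norm_le _ (by positivity)).2 fun t => ?_
      refine ((A t).le_opNorm (h t)).trans ?_
      gcongr
      exacts [A.norm_coe_le_norm t, h.norm_coe_le_norm t])

@[simp] theorem pointwiseApply_apply (A : C(K, E →L[ℝ] F)) (h : C(K, E)) (t : K) :
    pointwiseApply A h t = A t (h t) := rfl

/-- Apply the mean value inequality on each segment from `g t` to `g t + h t`. The oscillation of
`H'` there is small uniformly in `t`, because postcomposition with `H'` is continuous for the sup
norm. -/
theorem hasFDerivAt_comp_continuousMap {H : E → F} {H' : E → E →L[ℝ] F} (hH : Continuous H)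
    (hH' : Continuous H') (hd : ∀ x, HasFDerivAt H (H' x) x) (g : C(K, E)) :
    HasFDerivAt (fun g : C(K, E) => (ContinuousMap.mk H hH).comp g)
      (pointwiseApply ((ContinuousMap.mk H' hH').comp g)) g := by
  rw [hasFDerivAt_iff_isLittleO_nhds_zero, Asymptotics.isLittleO_iff]
  intro ε hε
  have hcont := (ContinuousMap.continuous_postcomp (X := K) (ContinuousMap.mk H' hH')).continuousAt
    (x := g)
  obtain ⟨δ, hδ, hball⟩ := Metric.mem_nhds_iff.1 (hcont (Metric.ball_mem_nhds ((ContinuousMap.mk H' hH').comp g) hε))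
  filter_upwards [Metric.ball_mem_nhds (0 : C(K, E)) hδ] with h hh
  rw [mem_ball_zero_iff] at hh
  refine (ContinuousMap.norm_le _ (by positivity)).2 fun t => ?_
  have key : ∀ y ∈ segment ℝ (g t) (g t + h t), ‖H' y - H' (g t)‖ ≤ ε := by
    intro y hy
    rw [segment_eq_image'] at hy
    obtain ⟨s, hs, rfl⟩ := hy
    have hd1 : dist (g + s • h) g < δ := by
      rw [dist_eq_norm, add_sub_cancel_left, norm_smul, Real.norm_eq_abs, abs_of_nonneg hs.1]
      exact (mul_le_of_le_one_left (norm_nonneg _) hs.2).trans_lt hh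
    have h2 : dist _ _ < ε := hball (Metric.mem_ball.2 hd1)
    have h3 := (ContinuousMap.dist_apply_le_dist (f := (ContinuousMap.mk H' hH').comp (g + s • h))
      (g := (ContinuousMap.mk H' hH').comp g) t).trans h2.le
    simpa [dist_eq_norm] using h3
  have := (convex_segment (𝕜 := ℝ) (g t) (g t + h t)).norm_image_sub_le_of_norm_hasFDerivWithin_le'
    (f := H) (f' := H') (φ := H' (g t)) (C := ε) (fun x _ => (hd x).hasFDerivWithinAt) key
    (left_mem_segment ℝ _ _) (right_mem_segment ℝ _ _)
  simp only [add_sub_cancel_left] at this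
  exact this.trans (mul_le_mul_of_nonneg_left (h.norm_coe_le_norm t) hε.le)

/-- The derivative is again a postcomposition, with `H'`, followed by the bounded bilinear
`pointwiseApply`. The induction therefore changes the target from `F` to `E →L[ℝ] F`, which is why
`F` is quantified inside and shares the universe of `E`. -/
theorem contDiff_comp_continuousMap_nat (n : ℕ) : ∀ {F : Type w} [NormedAddCommGroup F]
    [NormedSpace ℝ F] {H : E → F} (hH : Continuous H), ContDiff ℝ n H →
      ContDiff ℝ n (fun g : C(K, E) => (ContinuousMap.mk H hH).comp g) := by
  induction n with
  | zero =>
    intro F _ _ H hH _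
    exact contDiff_zero.2 (ContinuousMap.continuous_postcomp _)
  | succ n ih =>
    intro F _ _ H hH hn
    rw [Nat.cast_succ] at hn ⊢
    obtain ⟨H', hH', hd⟩ := contDiff_succ_iff_hasFDerivAt.1 hn
    exact contDiff_succ_iff_hasFDerivAt.2
      ⟨_, pointwiseApply.contDiff.comp (ih hH'.continuous hH'),
        hasFDerivAt_comp_continuousMap hH hH'.continuous hd⟩

theorem contDiff_comp_continuousMap {H : E → F} (hH : ContDiff ℝ ∞ H) :
    ContDiff ℝ ∞ (fun g : C(K, E) => (ContinuousMap.mk H hH.continuous).comp g) :=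
  contDiff_infty.2 fun n => contDiff_comp_continuousMap_nat n _ (hH.of_le (by exact_mod_cast le_top))

end Composition

/-! ### Integration of curves -/

section Integration

variable {W : Type*} [NormedAddCommGroup W] [NormedSpace ℝ W]

/-- The primitive vanishing at `0` of a continuous curve on the unit interval. -/
noncomputable def primitive : C(Icc (0 : ℝ) 1, W) →L[ℝ] C(Icc (0 : ℝ) 1, W) :=
  LinearMap.mkContinuous
    { toFun := fun h => ⟨fun t => ∫ s in (0 : ℝ)..t, IccExtend zero_le_one h s,
        (intervalIntegral.continuous_primitive
          (fun a b => (h.continuous.Icc_extend' (h := zero_le_one)).intervalIntegrable a b) 0).comp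
            continuous_subtype_val⟩
      map_add' := by
        intro g h
        ext t
        exact intervalIntegral.integral_add
          ((g.continuous.Icc_extend' (h := zero_le_one)).intervalIntegrable _ _)
          ((h.continuous.Icc_extend' (h := zero_le_one)).intervalIntegrable _ _)
      map_smul' := by
        intro c h
        ext t
        exact intervalIntegral.integral_smul c _ }
    1 (by
      intro h
      rw [one_mul]
      refine (ContinuousMap.norm_le _ (by positivity)).2 fun t => ?_
      have := intervalIntegral.norm_integral_le_of_norm_le_const (a := (0 : ℝ)) (b := t)
        (f := IccExtend zero_le_one h) (C := ‖h‖) (fun s _ => h.norm_coe_le_norm _)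
      refine this.trans (mul_le_of_le_one_right (norm_nonneg _) ?_)
      rw [sub_zero, abs_of_nonneg t.2.1]
      exact t.2.2)

theorem primitive_apply (h : C(Icc (0 : ℝ) 1, W)) (t : Icc (0 : ℝ) 1) :
    primitive h t = ∫ s in (0 : ℝ)..t, IccExtend zero_le_one h s := rfl

theorem norm_primitive_le (h : C(Icc (0 : ℝ) 1, W)) : ‖primitive h‖ ≤ ‖h‖ := by
  have := (primitive (W := W)).le_of_opNorm_le (LinearMap.mkContinuous_norm_le _ zero_le_one _) h
  simpa using this

variable [CompleteSpace W]

/-- A curve is the primitive of its derivative. -/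
theorem primitive_eq_of_hasDerivAt {f f' : ℝ → W} (h : C(Icc (0 : ℝ) 1, W))
    (hf : ContinuousOn f (Icc 0 1)) (hd : ∀ s ∈ Ioo (0 : ℝ) 1, HasDerivAt f (f' s) s)
    (hh : ∀ s : Icc (0 : ℝ) 1, h s = f' s)
    (t : Icc (0 : ℝ) 1) : primitive h t = f t - f 0 := by
  rw [primitive_apply]
  have hsub : Icc (0 : ℝ) t ⊆ Icc 0 1 := Icc_subset_Icc_right t.2.2
  refine intervalIntegral.integral_eq_sub_of_hasDerivAt_of_le t.2.1 (hf.mono hsub) ?_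
    ((h.continuous.Icc_extend' (h := zero_le_one)).intervalIntegrable _ _)
  intro s hs
  have hs' : s ∈ Ioo (0 : ℝ) 1 := ⟨hs.1, hs.2.trans_le t.2.2⟩
  rw [IccExtend_of_mem _ _ (Ioo_subset_Icc_self hs'), hh]
  exact hd s hs'

theorem hasDerivAt_primitive (h : C(Icc (0 : ℝ) 1, W)) (s : ℝ) (hs : s ∈ Ioo (0 : ℝ) 1) :
    HasDerivAt (fun t => ∫ s in (0 : ℝ)..t, IccExtend zero_le_one h s)
      (h ⟨s, Ioo_subset_Icc_self hs⟩) s := by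
  have hc := h.continuous.Icc_extend' (h := zero_le_one)
  have := intervalIntegral.integral_hasDerivAt_right (hc.intervalIntegrable 0 s)
    hc.stronglyMeasurable.stronglyMeasurableAtFilter hc.continuousAt
  rwa [IccExtend_of_mem _ _ (Ioo_subset_Icc_self hs)] at this

end Integration
end NilpotentTensor

namespace NilpotentTensor
open Filter Topology
universe w

/-! ### Total differential equations -/

/-- The smooth implicit function theorem, with smoothness in a whole neighbourhood. -/
theorem exists_smooth_implicit {E₁ E₂ F : Type*}
    [NormedAddCommGroup E₁] [NormedSpace ℝ E₁] [CompleteSpace E₁]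
    [NormedAddCommGroup E₂] [NormedSpace ℝ E₂] [CompleteSpace E₂]
    [NormedAddCommGroup F] [NormedSpace ℝ F] [CompleteSpace F]
    {f : E₁ × E₂ → F} (hf : ContDiff ℝ ∞ f) (u : E₁ × E₂)
    (hinv : (fderiv ℝ f u ∘L .inr ℝ E₁ E₂).IsInvertible) :
    ∃ g : E₁ → E₂, g u.1 = u.2 ∧ (∀ᶠ q in 𝓝 u.1, ContDiffAt ℝ ∞ g q) ∧
      ∀ᶠ q in 𝓝 u.1, f (q, g q) = f u := by
  have hne : (∞ : WithTop ℕ∞) ≠ 0 := by simp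
  have hfu := hf.contDiffAt (x := u)
  set g := hfu.implicitFunction hne hinv with hg
  have hgu : g u.1 = u.2 := hfu.implicitFunction_apply_self hne hinv
  have hgs : ContDiffAt ℝ ∞ g u.1 := hfu.contDiffAt_implicitFunction hne hinv
  have hge : ∀ᶠ q in 𝓝 u.1, f (q, g q) = f u := hfu.eventually_apply_implicitFunction hne hinv
  have hcont : ∀ᶠ q in 𝓝 u.1, ContinuousAt g q := by
    have h1 : ContDiffAt ℝ 1 g u.1 := hgs.of_le (by exact_mod_cast le_top)
    filter_upwards [h1.eventually (by simp)] with q hq using hq.continuousAt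
  have hinv' : ∀ᶠ q in 𝓝 u.1, (fderiv ℝ f (q, g q) ∘L .inr ℝ E₁ E₂).IsInvertible := by
    have hc : ContinuousAt (fun q => fderiv ℝ f (q, g q) ∘L .inr ℝ E₁ E₂) u.1 := by
      have h1 : Continuous (fderiv ℝ f) := hf.continuous_fderiv hne
      have h2 : ContinuousAt (fun q => (q, g q)) u.1 := continuousAt_id.prodMk hgs.continuousAt
      exact (h1.continuousAt.comp h2).clm_comp continuousAt_const
    refine hc (ContinuousLinearEquiv.isOpen.mem_nhds ?_)
    simp only [hgu]
    exact hinv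
  refine ⟨g, hgu, ?_, hge⟩
  -- Smoothness at `u.1` alone allows neighbourhoods that shrink with the order. At each nearby `q`
  -- the implicit function theorem is applied afresh at `(q, g q)`; by local uniqueness the new
  -- implicit function agrees with `g` near `q`.
  filter_upwards [hcont, hinv', hge.eventually_nhds, hge] with q hq1 hq2 hq3 hq4
  have hfq := hf.contDiffAt (x := (q, g q))
  have h1 := hfq.eventually_apply_eq_iff_implicitFunction hne hq2
  have h2 : ContinuousAt (fun q' => (q', g q')) q := continuousAt_id.prodMk hq1
  refine (hfq.contDiffAt_implicitFunction hne hq2).congr_of_eventuallyEq ?_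
  filter_upwards [h2.eventually h1, hq3] with q' h3 h4
  exact (h3.1 (h4.trans hq4.symm)).symm

section TotalDifferential

variable {X W : Type w} [NormedAddCommGroup X] [NormedSpace ℝ X]
  [NormedAddCommGroup W] [NormedSpace ℝ W]

/-- Constant curves. -/
noncomputable def constCurve (X : Type*) [NormedAddCommGroup X] [NormedSpace ℝ X] :
    X →L[ℝ] C(Icc (0 : ℝ) 1, X) :=
  LinearMap.mkContinuous
    { toFun := fun x => ContinuousMap.const _ x
      map_add' := fun _ _ => rfl
      map_smul' := fun _ _ => rfl } 1 (fun x => by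
        rw [one_mul]
        exact (ContinuousMap.norm_le _ (norm_nonneg _)).2 fun t => le_rfl)

@[simp] theorem constCurve_apply (x : X) (t : Icc (0 : ℝ) 1) : constCurve X x t = x := rfl

/-- A curve in the second factor, together with the ray from `x` to `0` in the first one. -/
noncomputable def rayCurve (X W : Type w) [NormedAddCommGroup X] [NormedSpace ℝ X]
    [NormedAddCommGroup W] [NormedSpace ℝ W] :
    X × C(Icc (0 : ℝ) 1, W) →L[ℝ] C(Icc (0 : ℝ) 1, X × W) :=
  LinearMap.mkContinuous
    { toFun := fun p => ⟨fun s => ((1 - (s : ℝ)) • p.1, p.2 s), by fun_prop⟩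
      map_add' := fun p q => by ext s <;> simp
      map_smul' := fun c p => by ext s <;> simp [smul_smul, mul_comm] } 1 (fun p => by
        rw [one_mul]
        refine (ContinuousMap.norm_le _ (norm_nonneg _)).2 fun t => ?_
        refine max_le_max ?_ (p.2.norm_coe_le_norm t)
        change ‖(1 - (t : ℝ)) • p.1‖ ≤ ‖p.1‖
        rw [norm_smul, Real.norm_eq_abs]
        refine mul_le_of_le_one_left (norm_nonneg _) ?_
        rw [abs_le]
        constructor <;> linarith [t.2.1, t.2.2])

@[simp] theorem rayCurve_apply (p : X × C(Icc (0 : ℝ) 1, W)) (t : Icc (0 : ℝ) 1) :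
    rayCurve X W p t = ((1 - (t : ℝ)) • p.1, p.2 t) := rfl

/-- The integral equation for the solution of `dw = F(x, w) dx` along the ray from `x` to `0`. -/
noncomputable def rayEquation {F : X × W → X →L[ℝ] W} (hF : ContDiff ℝ ∞ F)
    (p : (X × W) × C(Icc (0 : ℝ) 1, W)) : C(Icc (0 : ℝ) 1, W) :=
  -- The ray `(1 - s) • x` has velocity `-x`, hence the plus sign before the primitive. The curve
  -- starts at `p.1.2` over `x` and ends over `0`.
  p.2 - constCurve W p.1.2 + primitive (pointwiseApply
    ((ContinuousMap.mk F hF.continuous).comp (rayCurve X W (p.1.1, p.2))) (constCurve X p.1.1))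

theorem contDiff_rayEquation {F : X × W → X →L[ℝ] W} (hF : ContDiff ℝ ∞ F) :
    ContDiff ℝ ∞ (rayEquation hF) := by
  have h1 : ContDiff ℝ ∞ fun p : (X × W) × C(Icc (0 : ℝ) 1, W) =>
      rayCurve X W (p.1.1, p.2) := by fun_prop
  have h2 := (contDiff_comp_continuousMap (K := Icc (0 : ℝ) 1) hF).comp h1
  have h3 : ContDiff ℝ ∞ fun p : (X × W) × C(Icc (0 : ℝ) 1, W) => constCurve X p.1.1 := by
    fun_prop
  have h4 := (pointwiseApply.contDiff.comp h2).clm_apply h3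
  have h5 : ContDiff ℝ ∞ fun p : (X × W) × C(Icc (0 : ℝ) 1, W) =>
      p.2 - constCurve W p.1.2 := by fun_prop
  exact h5.add ((primitive (W := W)).contDiff.comp h4)

/-- This is the linearised equation for a variation `δ` of the curve when the initial point moves by
`(v, e)`. It serves to identify derivatives of the solution by exhibiting explicit variations. -/
theorem fderiv_rayEquation {F : X × W → X →L[ℝ] W} (hF : ContDiff ℝ ∞ F)
    (x : X) (y : W) (g : C(Icc (0 : ℝ) 1, W)) (v : X) (e : W) (δ : C(Icc (0 : ℝ) 1, W)) :
    fderiv ℝ (rayEquation hF) ((x, y), g) ((v, e), δ) =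
      δ - constCurve W e + primitive
        (pointwiseApply (pointwiseApply ((ContinuousMap.mk (fderiv ℝ F)
            (hF.continuous_fderiv (by simp))).comp (rayCurve X W (x, g))) (rayCurve X W (v, δ)))
          (constCurve X x) +
        pointwiseApply ((ContinuousMap.mk F hF.continuous).comp (rayCurve X W (x, g)))
          (constCurve X v)) := by
  have hd : ∀ x, HasFDerivAt F (fderiv ℝ F x) x := fun x =>
    (hF.differentiable (by simp) x).hasFDerivAt
  let ℓ : (X × W) × C(Icc (0 : ℝ) 1, W) →L[ℝ] X × C(Icc (0 : ℝ) 1, W) :=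
    ((ContinuousLinearMap.fst ℝ X W).comp (ContinuousLinearMap.fst ℝ _ _)).prod
      (ContinuousLinearMap.snd ℝ _ _)
  have h1 : HasFDerivAt (fun p : (X × W) × C(Icc (0 : ℝ) 1, W) => rayCurve X W (p.1.1, p.2))
      ((rayCurve X W).comp ℓ) ((x, y), g) := ((rayCurve X W).comp ℓ).hasFDerivAt
  have h2 := (hasFDerivAt_comp_continuousMap hF.continuous (hF.continuous_fderiv (by simp)) hd
    (rayCurve X W (x, g))).comp ((x, y), g) h1
  let c : (X × W) × C(Icc (0 : ℝ) 1, W) →L[ℝ] C(Icc (0 : ℝ) 1, X) :=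
    (constCurve X).comp ((ContinuousLinearMap.fst ℝ X W).comp (ContinuousLinearMap.fst ℝ _ _))
  have h3 : HasFDerivAt (fun p : (X × W) × C(Icc (0 : ℝ) 1, W) => constCurve X p.1.1)
      c ((x, y), g) := c.hasFDerivAt
  have h4 := (pointwiseApply (K := Icc (0 : ℝ) 1) (E := X) (F := W)).hasFDerivAt_of_bilinear h2 h3
  let k : (X × W) × C(Icc (0 : ℝ) 1, W) →L[ℝ] C(Icc (0 : ℝ) 1, W) :=
    ContinuousLinearMap.snd ℝ _ _ -
      (constCurve W).comp ((ContinuousLinearMap.snd ℝ X W).comp (ContinuousLinearMap.fst ℝ _ _))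
  have h5 : HasFDerivAt (fun p : (X × W) × C(Icc (0 : ℝ) 1, W) => p.2 - constCurve W p.1.2) k
      ((x, y), g) := k.hasFDerivAt
  have h6 := h5.add (primitive.hasFDerivAt.comp _ h4)
  have h7 : HasFDerivAt (rayEquation hF) _ ((x, y), g) := h6
  rw [h7.fderiv]
  simp only [add_apply, ContinuousLinearMap.comp_apply]
  congr 2
  simp only [Function.comp]
  rw [add_comm]
  rfl

/-- At `x = 0` the integrand is multiplied by `x`, so the partial derivative in the curve is the
identity and the implicit function theorem applies. -/
theorem rayEquation_solution [CompleteSpace X] [CompleteSpace W] {F : X × W → X →L[ℝ] W} (hF : ContDiff ℝ ∞ F) (w₀ : W) :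
    ∃ g : X × W → C(Icc (0 : ℝ) 1, W), g (0, w₀) = constCurve W w₀ ∧
      (∀ᶠ q in 𝓝 ((0 : X), w₀), ContDiffAt ℝ ∞ g q) ∧
      ∀ᶠ q in 𝓝 ((0 : X), w₀), rayEquation hF (q, g q) = 0 := by
  have h0 : rayEquation hF (((0 : X), w₀), constCurve W w₀) = 0 := by
    simp [rayEquation]
  have := exists_smooth_implicit (contDiff_rayEquation hF) (((0 : X), w₀), constCurve W w₀) ?_
  · simpa only [h0] using this
  · refine ⟨ContinuousLinearEquiv.refl ℝ _, ?_⟩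
    ext1 δ
    change _ = fderiv ℝ (rayEquation hF) (((0 : X), w₀), constCurve W w₀) ((0, 0), δ)
    rw [fderiv_rayEquation]
    simp

/-- Uniqueness for the linearised equation along short rays. -/
theorem rayEquation_unique {F : X × W → X →L[ℝ] W} (hF : ContDiff ℝ ∞ F)
    {x : X} {y : W} {g : C(Icc (0 : ℝ) 1, W)} {M : ℝ} (hM0 : 0 ≤ M)
    (hM : ∀ t, ‖fderiv ℝ F (rayCurve X W (x, g) t)‖ ≤ M) (hx : M * ‖x‖ < 1)
    {v : X} {e : W} {δ ζ : C(Icc (0 : ℝ) 1, W)}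
    (hδ : fderiv ℝ (rayEquation hF) ((x, y), g) ((v, e), δ) = 0)
    (hζ : fderiv ℝ (rayEquation hF) ((x, y), g) ((v, e), ζ) = 0) : δ = ζ := by
  have h1 : fderiv ℝ (rayEquation hF) ((x, y), g) ((0, 0), δ - ζ) = 0 := by
    have : (((0 : X), (0 : W)), δ - ζ) = ((v, e), δ) - ((v, e), ζ) := by simp
    rw [this, map_sub, hδ, hζ, sub_zero]
  rw [fderiv_rayEquation] at h1
  set η := δ - ζ
  simp only [map_zero, sub_zero, add_zero] at h1
  -- The difference of two solutions is a fixed point of a linear operator of norm at most `M * ‖x‖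
  -- < 1`.
  have h2 : ‖η‖ ≤ M * ‖x‖ * ‖η‖ := by
    refine ((congrArg norm (eq_neg_of_add_eq_zero_left h1)).trans (norm_neg _)).trans_le ?_
    refine (norm_primitive_le _).trans ((ContinuousMap.norm_le _ (by positivity)).2 fun t => ?_)
    simp only [pointwiseApply_apply, constCurve_apply, ContinuousMap.comp_apply,
      ContinuousMap.coe_mk]
    have h3 : ‖rayCurve X W (0, η) t‖ ≤ ‖η‖ := by
      rw [rayCurve_apply]
      simpa [Prod.norm_def] using η.norm_coe_le_norm t
    calc _ ≤ ‖fderiv ℝ F (rayCurve X W (x, g) t) (rayCurve X W (0, η) t)‖ * ‖x‖ :=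
          ContinuousLinearMap.le_opNorm _ _
      _ ≤ (M * ‖η‖) * ‖x‖ := by
          gcongr
          exact (ContinuousLinearMap.le_opNorm _ _).trans
            (mul_le_mul (hM t) h3 (norm_nonneg _) hM0)
      _ = _ := by ring
  have h4 : ‖η‖ = 0 := by
    by_contra h
    have : 0 < ‖η‖ := lt_of_le_of_ne (norm_nonneg _) (Ne.symm h)
    nlinarith
  exact sub_eq_zero.1 (norm_eq_zero.1 h4)

/-- **Frobenius' theorem** for the total differential equation `dw = F(x, w) dx`: first integrals
near the initial point `(0, w₀)`. -/
theorem exists_first_integrals [CompleteSpace X] [CompleteSpace W] {F : X × W → X →L[ℝ] W} (hF : ContDiff ℝ ∞ F) (w₀ : W)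
    (hcurv : ∀ᶠ p in 𝓝 ((0 : X), w₀), ∀ v v' : X,
      fderiv ℝ F p (v, F p v) v' = fderiv ℝ F p (v', F p v') v) :
    ∃ G : X × W → W, (∀ᶠ q in 𝓝 ((0 : X), w₀), ContDiffAt ℝ ∞ G q) ∧
      (∀ᶠ y in 𝓝 w₀, G (0, y) = y) ∧
      (∀ᶠ q in 𝓝 ((0 : X), w₀), ∀ v : X, fderiv ℝ G q (v, F q v) = 0) ∧
      ∀ e : W, (∀ᶠ p in 𝓝 ((0 : X), w₀), fderiv ℝ F p (0, e) = 0) →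
        ∀ᶠ q in 𝓝 ((0 : X), w₀), fderiv ℝ G q (0, e) = e := by
  obtain ⟨g, hg0, hgs, hge⟩ := rayEquation_solution hF w₀
  let ev : C(Icc (0 : ℝ) 1, W) →L[ℝ] W := ContinuousMap.evalCLM (M := W) ℝ (⟨1, by simp⟩ : Icc (0 : ℝ) 1)
  -- the linearised equation
  have hlin : ∀ᶠ q in 𝓝 ((0 : X), w₀), ∀ v e,
      fderiv ℝ (rayEquation hF) (q, g q) ((v, e), fderiv ℝ g q (v, e)) = 0 := by
    filter_upwards [hgs, hge.eventually_nhds] with q hq1 hq2 v e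
    have h1 : HasFDerivAt g (fderiv ℝ g q) q := (hq1.differentiableAt (by simp)).hasFDerivAt
    have h2 : HasFDerivAt (rayEquation hF) (fderiv ℝ (rayEquation hF) (q, g q)) (q, g q) :=
      ((contDiff_rayEquation hF).differentiable (by simp) _).hasFDerivAt
    have h3 := h2.comp q ((hasFDerivAt_id q).prodMk h1)
    have h4 : HasFDerivAt (fun q => rayEquation hF (q, g q)) 0 q :=
      (hasFDerivAt_const (𝕜 := ℝ) (0 : C(Icc (0 : ℝ) 1, W)) q).congr_of_eventuallyEq hq2
    have h5 := h3.unique h4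
    exact DFunLike.congr_fun h5 (v, e)
  -- a bound for the derivative of `F`, and closeness of the curves
  set M := ‖fderiv ℝ F (0, w₀)‖ + 1 with hMdef
  have hMev : ∀ᶠ p in 𝓝 ((0 : X), w₀), ‖fderiv ℝ F p‖ ≤ M := by
    have h1 := (hF.continuous_fderiv (by simp)).norm.continuousAt (x := ((0 : X), w₀))
    exact (h1.eventually (gt_mem_nhds (lt_add_one _))).mono fun p hp => hp.le
  have hgc : ContinuousAt g (0, w₀) := hgs.self_of_nhds.continuousAt
  have hclose : ∀ P : X × W → Prop, (∀ᶠ p in 𝓝 ((0 : X), w₀), P p) →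
      ∀ᶠ q in 𝓝 ((0 : X), w₀), ∀ t, P (rayCurve X W (q.1, g q) t) := by
    intro P hP
    obtain ⟨r, hr, hball⟩ := Metric.eventually_nhds_iff_ball.1 hP
    have h1 : ContinuousAt (fun q : X × W => rayCurve X W (q.1, g q)) (0, w₀) :=
      (rayCurve X W).continuous.continuousAt.comp (continuousAt_fst.prodMk hgc)
    have h2 : rayCurve X W (0, g (0, w₀)) = constCurve (X × W) (0, w₀) := by
      rw [hg0]
      ext t <;> simp
    have h3 := Metric.continuousAt_iff'.1 h1 r hr
    filter_upwards [h3] with q hq t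
    refine hball _ ?_
    rw [Metric.mem_ball]
    refine lt_of_le_of_lt ?_ hq
    have := ContinuousMap.dist_apply_le_dist (f := rayCurve X W (q.1, g q))
      (g := rayCurve X W (0, g (0, w₀))) t
    rw [h2] at this ⊢
    exact this
  have hsmall : ∀ᶠ q in 𝓝 ((0 : X), w₀), M * ‖q.1‖ < 1 := by
    have h1 : ContinuousAt (fun q : X × W => M * ‖q.1‖) (0, w₀) := by fun_prop
    refine h1.eventually (gt_mem_nhds ?_)
    simp
  have hM0 : 0 ≤ M := by positivity
  have hG : ∀ᶠ q in 𝓝 ((0 : X), w₀), ∀ v, fderiv ℝ (fun q => ev (g q)) q v =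
      ev (fderiv ℝ g q v) := by
    filter_upwards [hgs] with q hq v
    have h1 : HasFDerivAt (fun q => ev (g q)) (ev.comp (fderiv ℝ g q)) q :=
      ev.hasFDerivAt.comp q (hq.differentiableAt (by simp)).hasFDerivAt
    rw [h1.fderiv]
    rfl
  -- The first integral sends `(x, y)` to the value over `0` of the solution through `(x, y)`.
  refine ⟨fun q => ev (g q), ?_, ?_, ?_, ?_⟩
  · filter_upwards [hgs] with q hq
    exact ev.contDiff.contDiffAt.comp q hq
  · have h1 : ContinuousAt (fun y : W => ((0 : X), y)) w₀ := by fun_prop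
    filter_upwards [h1.eventually hge] with y hy
    simp only [rayEquation, map_zero, add_zero] at hy
    rw [sub_eq_zero.1 hy]
    rfl
  · filter_upwards [hlin, hclose _ hMev, hclose _ hcurv, hsmall, hge, hG] with
      q h1 h2 h3 h4 h5 hG v
    obtain ⟨x, y⟩ := q
    set γ := g (x, y)
    let k : C(Icc (0 : ℝ) 1, W) := pointwiseApply
      ((ContinuousMap.mk F hF.continuous).comp (rayCurve X W (x, γ))) (constCurve X x)
    let γ' : ℝ → W := fun s => y - ∫ u in (0 : ℝ)..s, IccExtend zero_le_one k u
    have hγ : ∀ t : Icc (0 : ℝ) 1, γ t = γ' t := by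
      intro t
      have := DFunLike.congr_fun h5 t
      change γ t - y + primitive k t = 0 at this
      rw [primitive_apply] at this
      simp only [γ']
      rw [← sub_eq_zero, ← this]
      abel
    have hγ'c : Continuous γ' := continuous_const.sub
      (intervalIntegral.continuous_primitive
        (fun a b => (k.continuous.Icc_extend' (h := zero_le_one)).intervalIntegrable a b) 0)
    let P : ℝ → X × W := fun s => ((1 - s) • x, γ' s)
    have hPc : Continuous P := by fun_prop
    have hP : ∀ t : Icc (0 : ℝ) 1, rayCurve X W (x, γ) t = P t := fun t => by
      simp [P, hγ]
    -- When the initial point moves along the leaf, by `(v, F (x, y) v)`, the solution should move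
    -- along its own leaf over the shrinking displacement `(1 - s) • v`. The curvature condition
    -- makes this a solution of the linearised equation, and it vanishes at `s = 1`, so the
    -- derivative of the first integral is zero.
    let ζ' : ℝ → W := fun s => (1 - s) • F (P s) v
    have hFc := hF.continuous
    have hζ'c : Continuous ζ' := by fun_prop
    let ζ : C(Icc (0 : ℝ) 1, W) := ⟨fun t => ζ' t, hζ'c.comp continuous_subtype_val⟩
    have hγ0 : γ' 0 = y := by simp [γ']
    have hP0 : P 0 = (x, y) := by simp [P, hγ0]
    have hζ : fderiv ℝ (rayEquation hF) ((x, y), γ) ((v, F (x, y) v), ζ) = 0 := by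
      rw [fderiv_rayEquation]
      ext t
      simp only [ContinuousMap.add_apply, ContinuousMap.sub_apply, constCurve_apply]
      rw [primitive_eq_of_hasDerivAt (f := fun s => -ζ' s)
        (f' := fun s => fderiv ℝ F (P s) ((1 - s) • v, ζ' s) x + F (P s) v)]
      · have e1 : ζ t = ζ' t := rfl
        have e2 : ζ' 0 = F (x, y) v := by simp [ζ', hP0]
        rw [e1, e2]
        simp
      · exact hζ'c.neg.continuousOn
      · intro s hs
        have hs' := Ioo_subset_Icc_self hs
        have hk : k ⟨s, hs'⟩ = F (P s) x := by
          simp only [k, pointwiseApply_apply, constCurve_apply, ContinuousMap.comp_apply,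
            ContinuousMap.coe_mk, hP]
        have d1 : HasDerivAt γ' (-F (P s) x) s := by
          have := (hasDerivAt_primitive k s hs).const_sub y
          rwa [hk] at this
        have d2 : HasDerivAt (fun s : ℝ => 1 - s) (-1) s := by
          simpa using (hasDerivAt_id s).const_sub 1
        have d3 : HasDerivAt P (-x, -F (P s) x) s := by
          have := (d2.smul_const x).prodMk d1
          simpa using this
        have d4 : HasDerivAt (fun s => F (P s)) (fderiv ℝ F (P s) (-x, -F (P s) x)) s :=
          (hF.differentiable (by simp) _).hasFDerivAt.comp_hasDerivAt s d3
        have d5 := (d2.smul (d4.clm_apply (hasDerivAt_const s v))).neg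
        refine d5.congr_deriv ?_
        have e3 := h3 ⟨s, hs'⟩ x v
        rw [hP] at e3
        have e4 : ((-x, -F (P s) x) : X × W) = -(x, F (P s) x) := rfl
        have e5 : (((1 - s) • v, ζ' s) : X × W) = (1 - s) • (v, F (P s) v) := rfl
        simp only [e4, e5, map_neg, map_smul, neg_apply,
          smul_apply, map_zero, add_zero, e3]
        simp only [smul_neg, neg_smul, one_smul, neg_add, neg_neg]
      · intro s
        simp only [ContinuousMap.add_apply, pointwiseApply_apply, constCurve_apply,
          ContinuousMap.comp_apply, ContinuousMap.coe_mk, hP, rayCurve_apply]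
        rfl
    have h6 := rayEquation_unique hF hM0 h2 h4 (h1 v (F (x, y) v)) hζ
    rw [hG, h6]
    change ζ' 1 = 0
    simp [ζ']
  · intro e he
    filter_upwards [hlin, hclose _ hMev, hclose _ he, hsmall, hG] with q h1 h2 h3 h4 hG
    obtain ⟨x, y⟩ := q
    -- If `F` is infinitesimally invariant in the direction `e`, the constant variation `e` solves
    -- the linearised equation.
    have hζ : fderiv ℝ (rayEquation hF) ((x, y), g (x, y)) ((0, e), constCurve W e) = 0 := by
      rw [fderiv_rayEquation]
      have : pointwiseApply ((ContinuousMap.mk (fderiv ℝ F)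
            (hF.continuous_fderiv (by simp))).comp (rayCurve X W (x, g (x, y))))
              (rayCurve X W (0, constCurve W e)) = 0 := by
        ext1 t
        have e1 : rayCurve X W (0, constCurve W e) t = (0, e) := by simp
        simp only [pointwiseApply_apply, ContinuousMap.comp_apply, ContinuousMap.coe_mk, e1,
          ContinuousMap.zero_apply]
        exact h3 t
      rw [this]
      simp
    have h6 := rayEquation_unique hF hM0 h2 h4 (h1 0 e) hζ
    rw [hG, h6]
    rfl

end TotalDifferential
end NilpotentTensor

namespace NilpotentTensor
open Filter Topology

/-! ### Primitives along an involutive distribution -/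

section Primitive

variable {V Y : Type} [NormedAddCommGroup V] [NormedSpace ℝ V] [FiniteDimensional ℝ V]
  [NormedAddCommGroup Y] [NormedSpace ℝ Y] [FiniteDimensional ℝ Y]

/-- A function which is smooth on an open set agrees near any of its points with a globally smooth
function. -/
theorem exists_contDiff_eventuallyEq {E : Type*} [NormedAddCommGroup E] [NormedSpace ℝ E]
    {f : V → E} {O : Set V} (hO : IsOpen O) (hf : ContDiffOn ℝ ∞ f O) {x₀ : V} (hx₀ : x₀ ∈ O) :
    ∃ g : V → E, ContDiff ℝ ∞ g ∧ g =ᶠ[𝓝 x₀] f := by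
  obtain ⟨r, hr, hball⟩ := Metric.nhds_basis_closedBall.mem_iff.1 (hO.mem_nhds hx₀)
  let χ : ContDiffBump x₀ := ⟨r / 2, r, by positivity, by linarith⟩
  refine ⟨fun x => χ x • f x, ?_, ?_⟩
  · rw [contDiff_iff_contDiffAt]
    intro x
    by_cases hx : x ∈ O
    · exact χ.contDiff.contDiffAt.smul (hf.contDiffAt (hO.mem_nhds hx))
    · have h1 : x ∉ tsupport χ := by
        rw [χ.tsupport_eq]
        exact fun h => hx (hball h)
      have h2 : (fun x => χ x • f x) =ᶠ[𝓝 x] fun _ => 0 := by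
        filter_upwards [notMem_tsupport_iff_eventuallyEq.1 h1] with z hz
        simp [hz]
      exact contDiffAt_const.congr_of_eventuallyEq h2
  · filter_upwards [χ.eventuallyEq_one] with x hx
    simp [hx]

/-- Existence of a function with prescribed derivatives along the image of `A`, for a family `A`
normalised by `P ∘ A = 1`. -/
theorem exists_primitive_of_normalised {A : V → Y →L[ℝ] V} {b : V → Y →L[ℝ] ℝ} {P : V →L[ℝ] Y}
    {O : Set V} (hO : IsOpen O) {x₀ : V} (hx₀ : x₀ ∈ O)
    (hA : ContDiffOn ℝ ∞ A O) (hb : ContDiffOn ℝ ∞ b O) (hP : ∀ x ∈ O, ∀ a, P (A x a) = a)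
    (hcA : ∀ x ∈ O, ∀ a a', fderiv ℝ A x (A x a) a' = fderiv ℝ A x (A x a') a)
    (hcb : ∀ x ∈ O, ∀ a a', fderiv ℝ b x (A x a) a' = fderiv ℝ b x (A x a') a)
    (l : V →L[ℝ] ℝ) (hl : ∀ a, l (A x₀ a) = b x₀ a) :
    ∃ f : V → ℝ, ∃ O' ⊆ O, IsOpen O' ∧ x₀ ∈ O' ∧ ContDiffOn ℝ ∞ f O' ∧
      (∀ x ∈ O', ∀ a, fderiv ℝ f x (A x a) = b x a) ∧ fderiv ℝ f x₀ = l := by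
  obtain ⟨A', hA', hAA'⟩ := exists_contDiff_eventuallyEq hO hA hx₀
  obtain ⟨b', hb', hbb'⟩ := exists_contDiff_eventuallyEq hO hb hx₀
  -- The pair `(A, b)` is integrated as one system, dz = A(z) dt and du = b(z) dt, with `t` in `Y`.
  -- The extra coordinate `u` accumulates the prescribed derivative; nothing depends on `u` or `t`.
  let N : V → Y →L[ℝ] V × ℝ := fun z => .inl ℝ V ℝ ∘L A' z + .inr ℝ V ℝ ∘L b' z
  have hN : ContDiff ℝ ∞ N := (contDiff_const.clm_comp hA').add (contDiff_const.clm_comp hb')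
  have hNa : ∀ z a, N z a = (A' z a, b' z a) := fun z a => by simp [N]
  have hN' : ∀ z ξ a, fderiv ℝ N z ξ a = (fderiv ℝ A' z ξ a, fderiv ℝ b' z ξ a) := by
    intro z ξ a
    have h1 := ((hA'.differentiable (by simp) z).hasFDerivAt)
    have h2 := ((hb'.differentiable (by simp) z).hasFDerivAt)
    have h3 : HasFDerivAt (fun z => N z a)
        (((fderiv ℝ A' z).flip a).prod ((fderiv ℝ b' z).flip a)) z := by
      have e1 := h1.clm_apply (hasFDerivAt_const a z)
      have e2 := h2.clm_apply (hasFDerivAt_const a z)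
      simp only [hNa]
      refine (e1.prodMk e2).congr_fderiv ?_
      ext <;> simp
    have h4 := ((hN.differentiable (by simp) z).hasFDerivAt).clm_apply (hasFDerivAt_const a z)
    have h5 := DFunLike.congr_fun (h4.unique h3) ξ
    simpa using h5
  let F : Y × (V × ℝ) → Y →L[ℝ] V × ℝ := fun p => N p.2.1
  have hF : ContDiff ℝ ∞ F := hN.comp (contDiff_fst.comp contDiff_snd)
  have hF' : ∀ p ξ, fderiv ℝ F p ξ = fderiv ℝ N p.2.1 ξ.2.1 := by
    intro p ξ
    let ℓ : Y × (V × ℝ) →L[ℝ] V :=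
      (ContinuousLinearMap.fst ℝ V ℝ).comp (ContinuousLinearMap.snd ℝ Y (V × ℝ))
    have h1 : HasFDerivAt F ((fderiv ℝ N p.2.1).comp ℓ) p :=
      ((hN.differentiable (by simp) p.2.1).hasFDerivAt).comp p (ℓ.hasFDerivAt (x := p))
    rw [h1.fderiv]
    rfl
  let ι : V → Y × (V × ℝ) := fun z => (P (z - x₀), (z, 0))
  have hι : ContDiff ℝ ∞ ι := by fun_prop
  have hι0 : ι x₀ = (0, (x₀, 0)) := by simp [ι]
  have hι' : ∀ z, HasFDerivAt ι (P.prod ((ContinuousLinearMap.id ℝ V).prod 0)) z := by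
    intro z
    have h1 : HasFDerivAt (fun z => P (z - x₀)) P z :=
      P.hasFDerivAt.comp z ((hasFDerivAt_id z).sub_const x₀)
    exact h1.prodMk ((hasFDerivAt_id z).prodMk (hasFDerivAt_const 0 z))
  have hproj : ContinuousAt (fun p : Y × (V × ℝ) => p.2.1) (0, (x₀, 0)) := by fun_prop
  have hgood : ∀ᶠ z in 𝓝 x₀, z ∈ O ∧ A' =ᶠ[𝓝 z] A ∧ b' =ᶠ[𝓝 z] b :=
    (hO.eventually_mem hx₀).and (hAA'.eventuallyEq_nhds.and hbb'.eventuallyEq_nhds)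
  obtain ⟨G, hG1, hG2, hG3, hG4⟩ := exists_first_integrals hF ((x₀, 0) : V × ℝ) (by
    filter_upwards [hproj.eventually hgood] with p hp v v'
    obtain ⟨h1, h2, h3⟩ := hp
    rw [hF', hF', hN', hN']
    have e1 : ∀ a, (F p a).1 = A p.2.1 a := fun a => by
      change (N p.2.1 a).1 = _
      rw [hNa, h2.self_of_nhds]
    simp only [e1, h2.fderiv_eq, h3.fderiv_eq, hcA _ h1 v v', hcb _ h1 v v'])
  have hG4' := hG4 (0, 1) (Eventually.of_forall fun p => by rw [hF']; simp)
  have hcι : Tendsto ι (𝓝 x₀) (𝓝 (0, (x₀, 0))) := by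
    rw [← hι0]
    exact hι.continuous.continuousAt
  -- Moving `z` by `A z a` moves `ι z` by `(a, F (ι z) a)` minus `b z a` times the unit vector in
  -- the `u` direction. The first part is killed by the derivative of `G`, the second is fixed by
  -- it, and the minus sign in `f` turns the result into `b z a`.
  let f : V → ℝ := fun z => l (G (ι z)).1 - (G (ι z)).2
  let ℓ : V × ℝ →L[ℝ] ℝ := l.comp (ContinuousLinearMap.fst ℝ V ℝ) - ContinuousLinearMap.snd ℝ V ℝ
  have hall : ∀ᶠ z in 𝓝 x₀, (z ∈ O ∧ A' =ᶠ[𝓝 z] A ∧ b' =ᶠ[𝓝 z] b) ∧ ContDiffAt ℝ ∞ G (ι z) ∧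
      (∀ v : Y, fderiv ℝ G (ι z) (v, F (ι z) v) = 0) ∧
      fderiv ℝ G (ι z) (0, (0, 1)) = (0, 1) :=
    hgood.and ((hcι.eventually hG1).and ((hcι.eventually hG3).and (hcι.eventually hG4')))
  obtain ⟨O', hO'1, hO'2, hO'3⟩ := eventually_nhds_iff.1 hall
  have hf' : ∀ z ∈ O', ∀ ξ, fderiv ℝ f z ξ = ℓ (fderiv ℝ G (ι z) (P ξ, (ξ, 0))) := by
    intro z hz ξ
    have h1 := ((hO'1 z hz).2.1.differentiableAt (by simp)).hasFDerivAt
    have h2 : HasFDerivAt f _ z := ℓ.hasFDerivAt.comp z (h1.comp z (hι' z))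
    rw [h2.fderiv]
    rfl
  have hfA : ∀ z ∈ O', ∀ a, fderiv ℝ f z (A z a) = b z a := by
    intro z hz a
    obtain ⟨⟨h1, h2, h3⟩, -, h5, h6⟩ := hO'1 z hz
    rw [hf' z hz, hP z h1]
    have e1 : F (ι z) a = (A z a, b z a) := by
      change N z a = _
      rw [hNa, h2.self_of_nhds, h3.self_of_nhds]
    have e2 : ((a, (A z a, 0)) : Y × (V × ℝ)) = (a, F (ι z) a) - b z a • (0, (0, 1)) := by
      rw [e1]
      ext <;> simp
    rw [e2, map_sub, map_smul, h5, h6]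
    simp [ℓ]
  refine ⟨f, O', fun z hz => (hO'1 z hz).1.1, hO'2, hO'3, ?_, hfA, ?_⟩
  · intro z hz
    have h1 : ContDiffAt ℝ ∞ f z :=
      ℓ.contDiff.contDiffAt.comp z ((hO'1 z hz).2.1.comp z hι.contDiffAt)
    exact h1.contDiffWithinAt
  · ext ξ
    have h1 : ∀ u, P u = 0 → fderiv ℝ f x₀ u = l u := by
      intro u hu
      rw [hf' x₀ hO'3, hu, hι0]
      have h1 : HasFDerivAt G (fderiv ℝ G (0, (x₀, 0))) (0, (x₀, 0)) :=
        (hG1.self_of_nhds.differentiableAt (by simp)).hasFDerivAt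
      have h2 : HasFDerivAt (fun y : V × ℝ => ((0 : Y), y)) (ContinuousLinearMap.inr ℝ Y (V × ℝ))
          (x₀, 0) := (ContinuousLinearMap.inr ℝ Y (V × ℝ)).hasFDerivAt
      have h3 : HasFDerivAt (fun y : V × ℝ => y) _ (x₀, 0) :=
        (HasFDerivAt.comp (x₀, (0 : ℝ)) h1 h2).congr_of_eventuallyEq (hG2.mono fun y hy => hy.symm)
      have h4 := DFunLike.congr_fun (h3.unique (hasFDerivAt_id _)) (u, 0)
      have h5 : fderiv ℝ G (0, (x₀, 0)) (0, (u, 0)) = (u, 0) := h4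
      rw [h5]
      simp [ℓ]
    have h2 : ξ = A x₀ (P ξ) + (ξ - A x₀ (P ξ)) := by abel
    rw [h2, map_add, map_add, hfA x₀ hO'3, hl, h1 _ (by rw [map_sub, hP x₀ hx₀, sub_self])]

/-- Existence of a function with prescribed derivatives along an involutive distribution, the image
of the injective family `A`; the prescribed derivatives `b` have to be closed along the
distribution. -/
theorem exists_primitive {A : V → Y →L[ℝ] V} {b : V → Y →L[ℝ] ℝ}
    {O : Set V} (hO : IsOpen O) {x₀ : V} (hx₀ : x₀ ∈ O)
    (hA : ContDiffOn ℝ ∞ A O) (hb : ContDiffOn ℝ ∞ b O) (hinj : Function.Injective (A x₀))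
    (hinv : ∀ x ∈ O, ∀ a a', ∃ c,
      fderiv ℝ A x (A x a) a' - fderiv ℝ A x (A x a') a = A x c ∧
      fderiv ℝ b x (A x a) a' - fderiv ℝ b x (A x a') a = b x c)
    (l : V →L[ℝ] ℝ) (hl : ∀ a, l (A x₀ a) = b x₀ a) :
    ∃ f : V → ℝ, ∃ O' ⊆ O, IsOpen O' ∧ x₀ ∈ O' ∧ ContDiffOn ℝ ∞ f O' ∧
      (∀ x ∈ O', ∀ a, fderiv ℝ f x (A x a) = b x a) ∧ fderiv ℝ f x₀ = l := by
  obtain ⟨P', hP'⟩ := (A x₀ : Y →ₗ[ℝ] V).exists_leftInverse_of_injective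
    (LinearMap.ker_eq_bot.2 hinj)
  -- Replacing `A` by `A ∘ (P ∘ A)⁻¹` near `x₀` leaves its image unchanged and reduces to the
  -- normalised case.
  let P : V →L[ℝ] Y := P'.toContinuousLinearMap
  have hP : P ∘L A x₀ = ContinuousLinearMap.id ℝ Y := by
    ext y
    exact LinearMap.congr_fun hP' y
  let B : V → Y →L[ℝ] Y := fun x => P ∘L A x
  have hB : ContDiffOn ℝ ∞ B O := contDiffOn_const.clm_comp hA
  have hBx₀ : B x₀ = (ContinuousLinearEquiv.refl ℝ Y : Y →L[ℝ] Y) := hP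
  let O₁ : Set V := O ∩ B ⁻¹' (range ((↑) : (Y ≃L[ℝ] Y) → Y →L[ℝ] Y))
  have hO₁ : IsOpen O₁ := hB.continuousOn.isOpen_inter_preimage hO ContinuousLinearEquiv.isOpen
  have hx₀₁ : x₀ ∈ O₁ := ⟨hx₀, _, hBx₀.symm⟩
  let S : V → Y →L[ℝ] Y := fun x => (B x).inverse
  have hS : ContDiffOn ℝ ∞ S O₁ := by
    rintro x ⟨hx, e, he⟩
    have h1 : ContDiffAt ℝ ∞ B x := hB.contDiffAt (hO.mem_nhds hx)
    have h2 : ContDiffAt ℝ ∞ ContinuousLinearMap.inverse (B x) := by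
      rw [← he]
      exact contDiffAt_map_inverse e
    exact (h2.comp x h1).contDiffWithinAt
  have hBS : ∀ x ∈ O₁, ∀ a, B x (S x a) = a := by
    rintro x ⟨hx, e, he⟩ a
    simp only [S, ← he, ContinuousLinearMap.inverse_equiv]
    exact e.apply_symm_apply a
  have hSB : ∀ x ∈ O₁, ∀ a, S x (B x a) = a := by
    rintro x ⟨hx, e, he⟩ a
    simp only [S, ← he, ContinuousLinearMap.inverse_equiv]
    exact e.symm_apply_apply a
  have hSx₀ : ∀ a, S x₀ a = a := fun a => by
    have := hSB x₀ hx₀₁ a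
    rwa [hBx₀] at this
  have hA₁ := hA.mono (inter_subset_left : O₁ ⊆ O)
  have hb₁ := hb.mono (inter_subset_left : O₁ ⊆ O)
  have dA : ∀ x ∈ O₁, HasFDerivAt A (fderiv ℝ A x) x := fun x hx =>
    ((hA₁.contDiffAt (hO₁.mem_nhds hx)).differentiableAt (by simp)).hasFDerivAt
  have db : ∀ x ∈ O₁, HasFDerivAt b (fderiv ℝ b x) x := fun x hx =>
    ((hb₁.contDiffAt (hO₁.mem_nhds hx)).differentiableAt (by simp)).hasFDerivAt
  have dS : ∀ x ∈ O₁, HasFDerivAt S (fderiv ℝ S x) x := fun x hx =>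
    ((hS.contDiffAt (hO₁.mem_nhds hx)).differentiableAt (by simp)).hasFDerivAt
  have dAS : ∀ x ∈ O₁, ∀ ξ a, fderiv ℝ (fun x => A x ∘L S x) x ξ a =
      fderiv ℝ A x ξ (S x a) + A x (fderiv ℝ S x ξ a) := by
    intro x hx ξ a
    rw [((dA x hx).clm_comp (dS x hx)).fderiv]
    simp [add_comm]
  have dbS : ∀ x ∈ O₁, ∀ ξ a, fderiv ℝ (fun x => b x ∘L S x) x ξ a =
      fderiv ℝ b x ξ (S x a) + b x (fderiv ℝ S x ξ a) := by
    intro x hx ξ a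
    rw [((db x hx).clm_comp (dS x hx)).fderiv]
    simp [add_comm]
  have dPAS : ∀ x ∈ O₁, ∀ ξ a, P (fderiv ℝ (fun x => A x ∘L S x) x ξ a) = 0 := by
    intro x hx ξ a
    have h0 := ((dA x hx).clm_comp (dS x hx)).clm_apply (hasFDerivAt_const a x)
    have h1 := (P.hasFDerivAt (x := A x (S x a))).comp x h0
    have h2 : HasFDerivAt (fun x => P (A x (S x a))) (0 : V →L[ℝ] Y) x := by
      refine (hasFDerivAt_const a x).congr_of_eventuallyEq ?_
      filter_upwards [hO₁.mem_nhds hx] with z hz using hBS z hz a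
    have h3 := DFunLike.congr_fun (h1.unique h2) ξ
    rw [((dA x hx).clm_comp (dS x hx)).fderiv]
    simpa using h3
  have hcurv : ∀ x ∈ O₁, ∀ a a',
      (fderiv ℝ (fun x => A x ∘L S x) x (A x (S x a)) a' =
        fderiv ℝ (fun x => A x ∘L S x) x (A x (S x a')) a) ∧
      (fderiv ℝ (fun x => b x ∘L S x) x (A x (S x a)) a' =
        fderiv ℝ (fun x => b x ∘L S x) x (A x (S x a')) a) := by
    intro x hx a a'
    obtain ⟨c, hc1, hc2⟩ := hinv x hx.1 (S x a) (S x a')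
    set d := fderiv ℝ S x (A x (S x a)) a' - fderiv ℝ S x (A x (S x a')) a with hd
    have e1 : fderiv ℝ (fun x => A x ∘L S x) x (A x (S x a)) a' -
        fderiv ℝ (fun x => A x ∘L S x) x (A x (S x a')) a = A x (c + d) := by
      rw [dAS x hx, dAS x hx, map_add, ← hc1, hd, map_sub]
      abel
    have e2 : fderiv ℝ (fun x => b x ∘L S x) x (A x (S x a)) a' -
        fderiv ℝ (fun x => b x ∘L S x) x (A x (S x a')) a = b x (c + d) := by
      rw [dbS x hx, dbS x hx, map_add, ← hc2, hd, map_sub]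
      abel
    -- `P` composed with the normalised family is constant, so `P` kills the bracket. The bracket
    -- also lies in the image of `A x`, where `P` is injective, so it vanishes.
    have e3 : B x (c + d) = 0 := by
      change P (A x (c + d)) = 0
      rw [← e1, map_sub, dPAS x hx, dPAS x hx, sub_zero]
    have e4 : c + d = 0 := by
      have := hSB x hx (c + d)
      rwa [e3, map_zero, eq_comm] at this
    rw [e4, map_zero] at e1 e2
    exact ⟨sub_eq_zero.1 e1, sub_eq_zero.1 e2⟩
  obtain ⟨f, O', hO'O, hO', hxO', hf, hfA, hfl⟩ := exists_primitive_of_normalised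
    (A := fun x => A x ∘L S x) (b := fun x => b x ∘L S x) (P := P) hO₁ hx₀₁
    (hA₁.clm_comp hS) (hb₁.clm_comp hS) hBS (fun x hx a a' => (hcurv x hx a a').1)
    (fun x hx a a' => (hcurv x hx a a').2) l (fun a => hl (S x₀ a))
  refine ⟨f, O', hO'O.trans inter_subset_left, hO', hxO', hf, fun x hx a => ?_, hfl⟩
  have := hfA x hx (B x a)
  simpa only [ContinuousLinearMap.comp_apply, hSB x (hO'O hx)] using this

end Primitive
end NilpotentTensor

namespace NilpotentTensor
open Filter Topology

/-! ### Jordan bases -/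

section JordanBasis

variable {V : Type*} [NormedAddCommGroup V] [NormedSpace ℝ V] {m : ℕ} {d : Fin m → ℕ}

/-- `e` is a Jordan basis of the nilpotent endomorphism `T`, with blocks of lengths `d`. -/
def IsJordanBasis (d : Fin m → ℕ) (T : V →L[ℝ] V)
    (e : Module.Basis (Σ i : Fin m, Fin (d i)) ℝ V) : Prop :=
  (∀ (i : Fin m) (k : Fin (d i)), (k : ℕ) = 0 → T (e ⟨i, k⟩) = 0) ∧
  (∀ (i : Fin m) (k l : Fin (d i)), (l : ℕ) = k + 1 → T (e ⟨i, l⟩) = e ⟨i, k⟩)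

namespace IsJordanBasis

variable {T : V →L[ℝ] V} {e : Module.Basis (Σ i : Fin m, Fin (d i)) ℝ V}

theorem repr_apply_of_lt (h : IsJordanBasis d T e) (v : V) (i : Fin m) (k l : Fin (d i))
    (hl : (l : ℕ) = k + 1) : e.repr (T v) ⟨i, k⟩ = e.repr v ⟨i, l⟩ := by
  classical
  have : (e.coord ⟨i, k⟩).comp (T : V →ₗ[ℝ] V) = e.coord ⟨i, l⟩ := by
    refine e.ext fun ⟨i', k'⟩ => ?_
    simp only [LinearMap.comp_apply, ContinuousLinearMap.coe_coe, Module.Basis.coord_apply]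
    rcases Nat.eq_zero_or_pos k' with h0 | hpos
    · rw [h.1 i' k' h0, map_zero, e.repr_self, Finsupp.single_apply, if_neg]
      · rfl
      · intro heq
        obtain ⟨rfl, heq⟩ := Sigma.mk.inj_iff.1 heq
        rw [eq_of_heq heq] at h0
        omega
    · have hk : (k' : ℕ) - 1 < d i' := by omega
      rw [h.2 i' ⟨k' - 1, hk⟩ k' (by simp; omega), e.repr_self, e.repr_self,
        Finsupp.single_apply, Finsupp.single_apply]
      congr 1
      simp only [eq_iff_iff, Sigma.mk.inj_iff]
      refine and_congr_right fun hi => ?_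
      subst hi
      simp only [heq_eq_eq, Fin.ext_iff]
      omega
  exact LinearMap.congr_fun this v

theorem repr_apply_of_top (h : IsJordanBasis d T e) (v : V) (i : Fin m) (k : Fin (d i))
    (hk : (k : ℕ) + 1 = d i) : e.repr (T v) ⟨i, k⟩ = 0 := by
  classical
  have : (e.coord ⟨i, k⟩).comp (T : V →ₗ[ℝ] V) = 0 := by
    refine e.ext fun ⟨i', k'⟩ => ?_
    simp only [LinearMap.comp_apply, ContinuousLinearMap.coe_coe, Module.Basis.coord_apply,
      LinearMap.zero_apply]
    rcases Nat.eq_zero_or_pos k' with h0 | hpos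
    · rw [h.1 i' k' h0, map_zero]
      rfl
    · have hk' : (k' : ℕ) - 1 < d i' := by omega
      rw [h.2 i' ⟨k' - 1, hk'⟩ k' (by simp; omega), e.repr_self, Finsupp.single_apply, if_neg]
      intro heq
      obtain ⟨rfl, heq⟩ := Sigma.mk.inj_iff.1 heq
      have := congrArg Fin.val (eq_of_heq heq)
      simp only at this
      omega
  exact LinearMap.congr_fun this v

theorem repr_pow_apply (h : IsJordanBasis d T e) (j : ℕ) (v : V) (i : Fin m) (k l : Fin (d i))
    (hl : (l : ℕ) = k + j) : e.repr ((T ^ j) v) ⟨i, k⟩ = e.repr v ⟨i, l⟩ := by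
  induction j generalizing v l with
  | zero =>
    have : l = k := Fin.ext (by omega)
    simp [this]
  | succ j ih =>
    rw [pow_succ, mul_apply_eq_comp]
    have hk : (k : ℕ) + j < d i := by omega
    rw [ih (T v) ⟨k + j, hk⟩ rfl, h.repr_apply_of_lt v i ⟨k + j, hk⟩ l (by simp; omega)]

/-- The kernel of a power of `T` is spanned by the lower parts of the blocks. -/
theorem repr_eq_zero_of_pow_eq_zero (h : IsJordanBasis d T e) {j : ℕ} {v : V}
    (hv : (T ^ j) v = 0) (s : Σ i : Fin m, Fin (d i)) (hs : j ≤ s.2) : e.repr v s = 0 := by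
  obtain ⟨i, k⟩ := s
  have hk : (k : ℕ) - j < d i := by omega
  rw [← h.repr_pow_apply j v i ⟨k - j, hk⟩ k (by simp at hs ⊢; omega), hv]
  simp

theorem pow_apply_eq (h : IsJordanBasis d T e) (j : ℕ) (i : Fin m) (k l : Fin (d i))
    (hl : (l : ℕ) = k + j) : (T ^ j) (e ⟨i, l⟩) = e ⟨i, k⟩ := by
  induction j generalizing l with
  | zero =>
    have : l = k := Fin.ext (by omega)
    simp [this]
  | succ j ih =>
    have hk : (k : ℕ) + j < d i := by omega
    rw [pow_succ, mul_apply_eq_comp, h.2 i ⟨k + j, hk⟩ l (by simp; omega)]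
    exact ih _ rfl

theorem pow_apply_eq_zero (h : IsJordanBasis d T e) (j : ℕ) (s : Σ i : Fin m, Fin (d i))
    (hj : (s.2 : ℕ) < j) : (T ^ j) (e s) = 0 := by
  obtain ⟨i, k⟩ := s
  simp only at hj
  have h0 : 0 < d i := by omega
  obtain ⟨p, rfl⟩ : ∃ p, j = p + 1 + k := ⟨j - 1 - k, by omega⟩
  rw [pow_add, pow_succ, mul_apply_eq_comp, mul_apply_eq_comp,
    h.pow_apply_eq k i ⟨0, h0⟩ k (by simp), h.1 i _ rfl, map_zero]

theorem pow_eq_zero (h : IsJordanBasis d T e) {a : ℕ} (ha : ∀ i, d i ≤ a) : T ^ a = 0 := by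
  have : ((T ^ a : V →L[ℝ] V) : V →ₗ[ℝ] V) = 0 :=
    e.ext fun s => h.pow_apply_eq_zero a s (s.2.2.trans_le (ha _))
  ext v
  exact LinearMap.congr_fun this v

end IsJordanBasis

end JordanBasis

/-! ### Smooth sections of kernels and smooth Jordan frames -/

section Frames

variable {V : Type} [NormedAddCommGroup V] [NormedSpace ℝ V]

/-- The map sending coefficients to the corresponding combination of some vectors. -/
noncomputable def combination {ι : Type} [Fintype ι] : (ι → V) →L[ℝ] (ι → ℝ) →L[ℝ] V :=
  ∑ s, (ContinuousLinearMap.smulRightL ℝ (ι → ℝ) V (ContinuousLinearMap.proj s)) ∘L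
    ContinuousLinearMap.proj s

@[simp] theorem combination_apply {ι : Type} [Fintype ι] (E : ι → V) (c : ι → ℝ) :
    combination E c = ∑ s, c s • E s := by
  simp [combination]

theorem combination_single {ι : Type} [Fintype ι] [DecidableEq ι] (E : ι → V) (s : ι) :
    combination E (Pi.single s 1) = E s := by
  simp [Pi.single_apply]

variable [FiniteDimensional ℝ V]

/-- A reflexive generalised inverse. -/
theorem exists_generalised_inverse (B : V →L[ℝ] V) :
    ∃ Q : V →L[ℝ] V, B ∘L Q ∘L B = B ∧ Q ∘L B ∘L Q = Q := by
  obtain ⟨s, hs⟩ := (B : V →ₗ[ℝ] V).rangeRestrict.exists_rightInverse_of_surjective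
    (LinearMap.range_rangeRestrict _)
  obtain ⟨p, hp⟩ := (LinearMap.range (B : V →ₗ[ℝ] V)).subtype.exists_leftInverse_of_injective
    (Submodule.ker_subtype _)
  have hs' : ∀ y, B (s y) = y := fun y => congrArg Subtype.val (LinearMap.congr_fun hs y)
  have hp' : ∀ y : LinearMap.range (B : V →ₗ[ℝ] V), p y = y := fun y => LinearMap.congr_fun hp y
  refine ⟨(s.comp p).toContinuousLinearMap, ?_, ?_⟩
  · ext v
    change B (s (p (B v))) = B v
    rw [hs']
    exact congrArg Subtype.val (hp' ⟨B v, v, rfl⟩)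
  · ext v
    change s (p (B (s (p v)))) = s (p v)
    rw [hs', hp']

/-- A vector in the kernel of a family of constant rank extends to a smooth section of the
kernel. -/
theorem exists_kernel_section {A : V → V →L[ℝ] V} {O : Set V} (hO : IsOpen O)
    (hA : ContDiffOn ℝ ∞ A O) {x₀ : V} (hx₀ : x₀ ∈ O)
    (hrank : ∀ x ∈ O, Module.finrank ℝ (LinearMap.ker (A x : V →ₗ[ℝ] V)) =
      Module.finrank ℝ (LinearMap.ker (A x₀ : V →ₗ[ℝ] V))) {v : V} (hv : A x₀ v = 0) :
    ∃ σ : V → V, ∃ O' ⊆ O, IsOpen O' ∧ x₀ ∈ O' ∧ ContDiffOn ℝ ∞ σ O' ∧ σ x₀ = v ∧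
      ∀ x ∈ O', A x (σ x) = 0 := by
  obtain ⟨Q, hQ1, hQ2⟩ := exists_generalised_inverse (A x₀)
  have hQ1' : ∀ u, A x₀ (Q (A x₀ u)) = A x₀ u := fun u => DFunLike.congr_fun hQ1 u
  have hQ2' : ∀ u, Q (A x₀ (Q u)) = Q u := fun u => DFunLike.congr_fun hQ2 u
  -- `R x` is near the identity and satisfies `Q ∘ A x₀ ∘ R x = Q ∘ A x`, so it carries the kernel
  -- of `Q ∘ A x` onto that of `A x₀`. The section is `R x` inverse applied to `v`.
  let R : V → V →L[ℝ] V := fun x => ContinuousLinearMap.id ℝ V - Q ∘L A x₀ + Q ∘L A x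
  have hR : ContDiffOn ℝ ∞ R O := contDiffOn_const.add (contDiffOn_const.clm_comp hA)
  have hRx₀ : R x₀ = (ContinuousLinearEquiv.refl ℝ V : V →L[ℝ] V) := by
    ext u
    simp [R]
  let O' : Set V := O ∩ R ⁻¹' (range ((↑) : (V ≃L[ℝ] V) → V →L[ℝ] V))
  have hO' : IsOpen O' := hR.continuousOn.isOpen_inter_preimage hO ContinuousLinearEquiv.isOpen
  refine ⟨fun x => (R x).inverse v, O', inter_subset_left, hO', ⟨hx₀, _, hRx₀.symm⟩, ?_, ?_, ?_⟩
  · rintro x ⟨hx, e, he⟩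
    have h1 : ContDiffAt ℝ ∞ R x := hR.contDiffAt (hO.mem_nhds hx)
    have h2 : ContDiffAt ℝ ∞ ContinuousLinearMap.inverse (R x) := by
      rw [← he]
      exact contDiffAt_map_inverse e
    exact ((h2.comp x h1).clm_apply contDiffAt_const).contDiffWithinAt
  · simp only [hRx₀, ContinuousLinearMap.inverse_equiv]
    rfl
  · rintro x ⟨hx, e, he⟩
    simp only [← he, ContinuousLinearMap.inverse_equiv, ContinuousLinearEquiv.coe_coe]
    set σ := e.symm v
    have hσ : R x σ = v := by
      rw [← he]
      exact e.apply_symm_apply v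
    have hfac : ∀ u, Q (A x₀ (R x u)) = Q (A x u) := fun u => by
      simp [R, hQ2']
    have h1 : Q (A x σ) = 0 := by rw [← hfac, hσ, hv, map_zero]
    have h2 : LinearMap.ker ((Q ∘L A x : V →L[ℝ] V) : V →ₗ[ℝ] V) =
        (LinearMap.ker (A x₀ : V →ₗ[ℝ] V)).map (e.symm.toLinearEquiv : V →ₗ[ℝ] V) := by
      ext y
      simp only [LinearMap.mem_ker, Submodule.mem_map]
      constructor
      · intro hy
        refine ⟨R x y, ?_, ?_⟩
        · have : Q (A x₀ (R x y)) = 0 := (hfac y).trans hy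
          change A x₀ (R x y) = 0
          rw [← hQ1', this, map_zero]
        · rw [← he]
          exact e.symm_apply_apply y
      · rintro ⟨u, hu, rfl⟩
        change Q (A x (e.symm u)) = 0
        have hu' : A x₀ u = 0 := hu
        rw [← hfac, ← he, ContinuousLinearEquiv.coe_coe, e.apply_symm_apply, hu', map_zero]
    -- Here constancy of the rank enters: one inclusion is clear and the dimensions agree.
    have h3 : LinearMap.ker (A x : V →ₗ[ℝ] V) =
        LinearMap.ker ((Q ∘L A x : V →L[ℝ] V) : V →ₗ[ℝ] V) := by
      refine Submodule.eq_of_le_of_finrank_eq (fun y hy => ?_) ?_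
      · have hy' : A x y = 0 := hy
        change Q (A x y) = 0
        rw [hy', map_zero]
      · rw [hrank x hx, h2]
        exact (LinearEquiv.finrank_map_eq e.symm.toLinearEquiv _).symm
    have h4 : σ ∈ LinearMap.ker (A x : V →ₗ[ℝ] V) := by
      rw [h3]
      exact h1
    exact h4

/-- A smooth family of endomorphisms which are all conjugate to each other has smooth Jordan
bases. -/
theorem exists_smooth_jordanBasis {m : ℕ} {d : Fin m → ℕ} {Θ : V → V →L[ℝ] V} {O : Set V}
    (hO : IsOpen O) (hΘ : ContDiffOn ℝ ∞ Θ O) {x₀ : V} (hx₀ : x₀ ∈ O)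
    (hconj : ∀ x ∈ O, ∃ F : V ≃ₗ[ℝ] V, ∀ v, F (Θ x v) = Θ x₀ (F v))
    {e : Module.Basis (Σ i : Fin m, Fin (d i)) ℝ V} (he : IsJordanBasis d (Θ x₀) e) :
    ∃ E : (Σ i : Fin m, Fin (d i)) → V → V, ∃ O' ⊆ O, IsOpen O' ∧ x₀ ∈ O' ∧
      (∀ s, ContDiffOn ℝ ∞ (E s) O') ∧ (∀ s, E s x₀ = e s) ∧
      ∀ x ∈ O', ∃ e' : Module.Basis (Σ i : Fin m, Fin (d i)) ℝ V, (∀ s, e' s = E s x) ∧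
        IsJordanBasis d (Θ x) e' := by
  classical
  have hrank : ∀ p, ∀ x ∈ O, Module.finrank ℝ (LinearMap.ker ((Θ x ^ p : V →L[ℝ] V) : V →ₗ[ℝ] V)) =
      Module.finrank ℝ (LinearMap.ker ((Θ x₀ ^ p : V →L[ℝ] V) : V →ₗ[ℝ] V)) := by
    intro p x hx
    obtain ⟨F, hF⟩ := hconj x hx
    have hFp : ∀ v, F ((Θ x ^ p) v) = (Θ x₀ ^ p) (F v) := by
      induction p with
      | zero => simp
      | succ p ih =>
        intro v
        rw [pow_succ, pow_succ, mul_apply_eq_comp, mul_apply_eq_comp, ih, hF]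
    have : LinearMap.ker ((Θ x₀ ^ p : V →L[ℝ] V) : V →ₗ[ℝ] V) =
        (LinearMap.ker ((Θ x ^ p : V →L[ℝ] V) : V →ₗ[ℝ] V)).map (F : V →ₗ[ℝ] V) := by
      ext y
      simp only [LinearMap.mem_ker, Submodule.mem_map, ContinuousLinearMap.coe_coe,
        LinearEquiv.coe_coe]
      constructor
      · intro hy
        refine ⟨F.symm y, F.injective ?_, by simp⟩
        rw [hFp, F.apply_symm_apply, hy, map_zero]
      · rintro ⟨u, hu, rfl⟩
        rw [← hFp, hu, map_zero]
    rw [this]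
    exact (LinearEquiv.finrank_map_eq F _).symm
  have hpow : ∀ p, ContDiffOn ℝ ∞ (fun x => Θ x ^ p) O := fun p => by
    induction p with
    | zero => simpa using contDiffOn_const
    | succ p ih =>
      simp only [pow_succ]
      exact ih.clm_comp hΘ
  -- Only the top vector of each block is extended, inside the kernel of `Θ ^ d i`; the rest of the
  -- block consists of its images under powers of `Θ`. Blocks of length 0 are not excluded here and
  -- get the zero section.
  have hsec : ∀ i, ∃ σ : V → V, ∃ O' ⊆ O, IsOpen O' ∧ x₀ ∈ O' ∧ ContDiffOn ℝ ∞ σ O' ∧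
      (∀ k : Fin (d i), (k : ℕ) + 1 = d i → σ x₀ = e ⟨i, k⟩) ∧
      ∀ x ∈ O', (Θ x ^ d i) (σ x) = 0 := by
    intro i
    by_cases hi : 0 < d i
    · obtain ⟨σ, O', h1, h2, h3, h4, h5, h6⟩ := exists_kernel_section hO (hpow (d i)) hx₀
        (hrank (d i)) (v := e ⟨i, ⟨d i - 1, by omega⟩⟩)
        (he.pow_apply_eq_zero _ _ (by simp; omega))
      refine ⟨σ, O', h1, h2, h3, h4, fun k hk => ?_, h6⟩
      rw [h5]
      congr
      omega
    · exact ⟨fun _ => 0, O, subset_rfl, hO, hx₀, contDiffOn_const,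
        fun k => absurd k.2 (by omega), fun x _ => map_zero _⟩
  choose σ Oi hOi1 hOi2 hOi3 hσ1 hσ2 hσ3 using hsec
  let O₁ : Set V := O ∩ ⋂ i, Oi i
  have hO₁ : IsOpen O₁ := hO.inter (isOpen_iInter_of_finite hOi2)
  have hO₁i : ∀ i, O₁ ⊆ Oi i := fun i x hx => mem_iInter.1 hx.2 i
  have hx₀₁ : x₀ ∈ O₁ := ⟨hx₀, mem_iInter.2 hOi3⟩
  let E : (Σ i : Fin m, Fin (d i)) → V → V := fun s x => (Θ x ^ (d s.1 - 1 - s.2)) (σ s.1 x)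
  have hE : ∀ s, ContDiffOn ℝ ∞ (E s) O₁ := fun s =>
    ((hpow _).mono inter_subset_left).clm_apply ((hσ1 s.1).mono (hO₁i s.1))
  have hEx₀ : ∀ s, E s x₀ = e s := by
    rintro ⟨i, k⟩
    have hk := k.2
    have h1 : σ i x₀ = e ⟨i, ⟨d i - 1, by omega⟩⟩ := hσ2 i _ (by simp; omega)
    simp only [E]
    rw [h1]
    exact he.pow_apply_eq _ _ _ _ (by simp; omega)
  let C : V → (((Σ i : Fin m, Fin (d i)) → ℝ) →L[ℝ] V) := fun x => combination fun s => E s x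
  have hC : ContDiffOn ℝ ∞ C O₁ :=
    (combination (V := V) (ι := Σ i : Fin m, Fin (d i))).contDiff.comp_contDiffOn
      (contDiffOn_pi.2 hE)
  have hCx₀ : C x₀ = (e.equivFun.symm.toContinuousLinearEquiv :
      ((Σ i : Fin m, Fin (d i)) → ℝ) →L[ℝ] V) := by
    ext c
    simp [C, hEx₀, Module.Basis.equivFun_symm_apply]
  refine ⟨E, O₁ ∩ C ⁻¹' (range ((↑) : ((((Σ i : Fin m, Fin (d i)) → ℝ) ≃L[ℝ] V)) → _)),
    fun x hx => hx.1.1, hC.continuousOn.isOpen_inter_preimage hO₁ ContinuousLinearEquiv.isOpen,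
    ⟨hx₀₁, _, hCx₀.symm⟩, fun s => (hE s).mono inter_subset_left, hEx₀, ?_⟩
  rintro x ⟨hx, L, hL⟩
  have hb : ∀ s, Module.Basis.ofEquivFun L.toLinearEquiv.symm s = E s x := by
    intro s
    rw [Module.Basis.coe_ofEquivFun]
    change (L : ((Σ i : Fin m, Fin (d i)) → ℝ) →L[ℝ] V) _ = _
    rw [hL]
    exact combination_single _ s
  refine ⟨Module.Basis.ofEquivFun L.toLinearEquiv.symm, hb, ?_, ?_⟩
  · intro i k hk
    have hk' := k.2
    rw [hb]
    simp only [E]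
    rw [← mul_apply_eq_comp, ← pow_succ', ← hσ3 i x (hO₁i i hx)]
    congr 2
    omega
  · intro i k l hl
    have hl' := l.2
    rw [hb, hb]
    simp only [E]
    rw [← mul_apply_eq_comp, ← pow_succ']
    congr 2
    omega

end Frames
end NilpotentTensor

namespace NilpotentTensor
open Filter Topology VectorField

/-! ### Brackets and the Nijenhuis condition on open subsets of a vector space -/

section Brackets

variable {V : Type} [NormedAddCommGroup V] [NormedSpace ℝ V]

/-- The Nijenhuis tensor of `Θ` vanishes on the open subset `O` of the vector space `V`. -/
def NijenhuisVanishesOn (Θ : V → V →L[ℝ] V) (O : Set V) : Prop :=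
  ∀ U ⊆ O, IsOpen U → ∀ v w : V → V, ContDiffOn ℝ ∞ v U → ContDiffOn ℝ ∞ w U → ∀ x ∈ U,
    Θ x (lieBracket ℝ (fun y => Θ y (v y)) w x) + Θ x (lieBracket ℝ v (fun y => Θ y (w y)) x)
      - lieBracket ℝ (fun y => Θ y (v y)) (fun y => Θ y (w y)) x
      - Θ x (Θ x (lieBracket ℝ v w x)) = 0

theorem NijenhuisVanishesOn.mono {Θ : V → V →L[ℝ] V} {O O' : Set V}
    (h : NijenhuisVanishesOn Θ O) (hO' : O' ⊆ O) : NijenhuisVanishesOn Θ O' :=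
  fun U hU => h U (hU.trans hO')

theorem lieBracket_congr_on {O : Set V} (hO : IsOpen O) {v v' w w' : V → V}
    (hv : ∀ x ∈ O, v x = v' x) (hw : ∀ x ∈ O, w x = w' x) {x : V} (hx : x ∈ O) :
    lieBracket ℝ v w x = lieBracket ℝ v' w' x :=
  Filter.EventuallyEq.lieBracket_vectorField_eq
    (by filter_upwards [hO.mem_nhds hx] with y hy using hv y hy)
    (by filter_upwards [hO.mem_nhds hx] with y hy using hw y hy)

theorem lieBracket_eq_zero_right {O : Set V} (hO : IsOpen O) {v w : V → V}
    (hw : ∀ x ∈ O, w x = 0) {x : V} (hx : x ∈ O) : lieBracket ℝ v w x = 0 := by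
  rw [lieBracket_congr_on hO (fun _ _ => rfl) hw hx]
  exact congrFun lieBracket_zero_right x

/-- The failure of `Θ ^ i` to be preserved by the bracket with `w`. -/
noncomputable def powDefect (Θ : V → V →L[ℝ] V) (i : ℕ) (v w : V → V) (x : V) : V :=
  lieBracket ℝ (fun y => (Θ y ^ i) (v y)) w x - (Θ x ^ i) (lieBracket ℝ v w x)

variable {Θ : V → V →L[ℝ] V} {O : Set V}

theorem contDiffOn_pow_apply (hΘ : ContDiffOn ℝ ∞ Θ O) {v : V → V} (hv : ContDiffOn ℝ ∞ v O)
    (i : ℕ) : ContDiffOn ℝ ∞ (fun y => (Θ y ^ i) (v y)) O := by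
  induction i with
  | zero => simpa using hv
  | succ i ih =>
    simp only [pow_succ', mul_apply_eq_comp]
    exact hΘ.clm_apply ih

variable (hO : IsOpen O) (hΘ : ContDiffOn ℝ ∞ Θ O) (hN : NijenhuisVanishesOn Θ O)
include hO hΘ hN

/-- N = 0 says precisely that [Θv, ·] - Θ[v, ·] commutes with Θ. The defect of `Θ ^ (i + 1)` at `v`
is the defect of `Θ` at `Θ ^ i v` plus `Θ` applied to the defect of `Θ ^ i`, so induction applies.
-/
theorem powDefect_apply_right (i : ℕ) {v w : V → V} (hv : ContDiffOn ℝ ∞ v O)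
    (hw : ContDiffOn ℝ ∞ w O) {x : V} (hx : x ∈ O) :
    powDefect Θ i v (fun y => Θ y (w y)) x = Θ x (powDefect Θ i v w x) := by
  induction i with
  | zero => simp [powDefect]
  | succ i ih =>
    have h1 := hN O subset_rfl hO _ _ (contDiffOn_pow_apply hΘ hv i) hw x hx
    have h2 : ∀ u : V → V, powDefect Θ (i + 1) v u x =
        lieBracket ℝ (fun y => Θ y ((Θ y ^ i) (v y))) u x
          - Θ x (lieBracket ℝ (fun y => (Θ y ^ i) (v y)) u x) + Θ x (powDefect Θ i v u x) := by
      intro u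
      simp only [powDefect, pow_succ', mul_apply_eq_comp, map_sub]
      abel
    rw [h2, h2, ih, map_add, map_sub]
    congr 1
    rw [← sub_eq_zero, ← neg_eq_zero, ← h1]
    abel

theorem powDefect_pow_apply_right (i l : ℕ) {v w : V → V} (hv : ContDiffOn ℝ ∞ v O)
    (hw : ContDiffOn ℝ ∞ w O) {x : V} (hx : x ∈ O) :
    powDefect Θ i v (fun y => (Θ y ^ l) (w y)) x = (Θ x ^ l) (powDefect Θ i v w x) := by
  induction l with
  | zero => simp
  | succ l ih =>
    simp only [pow_succ', mul_apply_eq_comp]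
    rw [powDefect_apply_right hO hΘ hN i hv (contDiffOn_pow_apply hΘ hw l) hx, ih]

/-- Fields annihilated by a power of `Θ`. -/
theorem pow_powDefect_eq_zero (i l : ℕ) {v w : V → V} (hv : ContDiffOn ℝ ∞ v O)
    (hw : ContDiffOn ℝ ∞ w O) (h : ∀ x ∈ O, (Θ x ^ l) (w x) = 0) {x : V} (hx : x ∈ O) :
    (Θ x ^ l) (powDefect Θ i v w x) = 0 := by
  rw [← powDefect_pow_apply_right hO hΘ hN i l hv hw hx, powDefect,
    lieBracket_eq_zero_right hO h hx, lieBracket_eq_zero_right hO h hx]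
  simp

/-- The bracket of a field in the image of `Θ ^ i` with a field in the kernel of `Θ ^ l`, where
`Θ ^ (i + l) = 0`. -/
theorem pow_lieBracket_eq_zero {i l : ℕ} (hil : ∀ x ∈ O, Θ x ^ (l + i) = 0) {v w : V → V}
    (hv : ContDiffOn ℝ ∞ v O) (hw : ContDiffOn ℝ ∞ w O) (h : ∀ x ∈ O, (Θ x ^ l) (w x) = 0)
    {x : V} (hx : x ∈ O) : (Θ x ^ l) (lieBracket ℝ (fun y => (Θ y ^ i) (v y)) w x) = 0 := by
  have h1 := pow_powDefect_eq_zero hO hΘ hN i l hv hw h hx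
  rwa [powDefect, map_sub, ← mul_apply_eq_comp, ← pow_add, hil x hx, zero_apply, sub_zero] at h1

/-- Brackets inside the string of a single field. -/
theorem pow_lieBracket_string_eq_zero {b p q j : ℕ} (hp : b ≤ p + j) (hq : b ≤ q + j) {v : V → V}
    (hv : ContDiffOn ℝ ∞ v O) (h : ∀ x ∈ O, (Θ x ^ b) (v x) = 0) {x : V} (hx : x ∈ O) :
    (Θ x ^ j) (lieBracket ℝ (fun y => (Θ y ^ p) (v y)) (fun y => (Θ y ^ q) (v y)) x) = 0 := by
  have h1 : ∀ i, (Θ x ^ b) (lieBracket ℝ (fun y => (Θ y ^ i) (v y)) v x) = 0 := by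
    intro i
    have := pow_powDefect_eq_zero hO hΘ hN i b hv hv h hx
    rwa [powDefect, lieBracket_self, Pi.zero_apply, map_zero, sub_zero] at this
  have h1' : ∀ i k, b ≤ k → (Θ x ^ k) (lieBracket ℝ (fun y => (Θ y ^ i) (v y)) v x) = 0 := by
    intro i k hk
    obtain ⟨r, rfl⟩ := Nat.exists_eq_add_of_le' hk
    rw [pow_add, mul_apply_eq_comp, h1, map_zero]
  have h2 := powDefect_pow_apply_right hO hΘ hN p q hv hv hx
  simp only [powDefect, lieBracket_self, Pi.zero_apply, map_zero, sub_zero] at h2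
  -- Since [v, v] = 0, the commutation rule reads [Θ^p v, Θ^q v] = Θ^q [Θ^p v, v] + Θ^p [v, Θ^q v].
  -- After applying Θ^j both exponents are at least `b`.
  rw [sub_eq_iff_eq_add.1 h2, map_add, ← mul_apply_eq_comp, ← mul_apply_eq_comp, ← pow_add,
    ← pow_add, h1' p _ (by omega), zero_add, lieBracket_swap, map_neg, h1' q _ (by omega), neg_zero]

end Brackets
end NilpotentTensor

namespace NilpotentTensor
open Filter Topology VectorField

/-! ### Adapted frames and adapted functions -/

section Adapted

variable {V : Type} [NormedAddCommGroup V] [NormedSpace ℝ V]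

/-- A smooth field of nilpotent endomorphisms with vanishing Nijenhuis tensor on an open set `O`,
together with a smooth frame of Jordan bases such that the kernels of all powers are involutive. -/
structure AdaptedFrame {m : ℕ} (d : Fin m → ℕ) (Θ : V → V →L[ℝ] V) (O : Set V)
    (E : (Σ i : Fin m, Fin (d i)) → V → V) : Prop where
  isOpen : IsOpen O
  smooth : ContDiffOn ℝ ∞ Θ O
  smooth_frame : ∀ s, ContDiffOn ℝ ∞ (E s) O
  nijenhuis : NijenhuisVanishesOn Θ O
  basis : ∀ x ∈ O, ∃ e : Module.Basis (Σ i : Fin m, Fin (d i)) ℝ V, (∀ s, e s = E s x) ∧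
    IsJordanBasis d (Θ x) e
  involutive : ∀ x ∈ O, ∀ (j : ℕ) (s t : Σ i : Fin m, Fin (d i)), (s.2 : ℕ) < j → (t.2 : ℕ) < j →
    (Θ x ^ j) (lieBracket ℝ (E s) (E t) x) = 0

/-- This is the only form in which the block condition is used: of two distinct blocks, at least one
has maximal length. -/
theorem BlockCondition.exists_max {m : ℕ} {d : Fin m → ℕ} (h : BlockCondition d) :
    ∃ a, (∀ i, d i ≤ a) ∧ ∀ i i', d i = a ∨ d i' = a ∨ i = i' := by
  obtain ⟨a, ha⟩ | ⟨a, b, hab, h1, -, i₀, -, h2⟩ := h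
  · exact ⟨a, fun i => (ha i).le, fun i i' => Or.inl (ha i)⟩
  · refine ⟨a, fun i => ?_, fun i i' => ?_⟩
    · rcases h1 i with h | h <;> omega
    · rcases h1 i with h | h
      · exact Or.inl h
      · rcases h1 i' with h' | h'
        · exact Or.inr (Or.inl h')
        · exact Or.inr (Or.inr ((h2 i h).trans (h2 i' h').symm))

/-- Under the block condition, the kernels are automatically involutive. -/
theorem AdaptedFrame.of_blockCondition {m : ℕ} {d : Fin m → ℕ} (hd : BlockCondition d)
    {Θ : V → V →L[ℝ] V} {O : Set V} {E : (Σ i : Fin m, Fin (d i)) → V → V} (hO : IsOpen O)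
    (hΘ : ContDiffOn ℝ ∞ Θ O) (hE : ∀ s, ContDiffOn ℝ ∞ (E s) O) (hN : NijenhuisVanishesOn Θ O)
    (hb : ∀ x ∈ O, ∃ e : Module.Basis (Σ i : Fin m, Fin (d i)) ℝ V, (∀ s, e s = E s x) ∧
      IsJordanBasis d (Θ x) e) : AdaptedFrame d Θ O E := by
  obtain ⟨a, ha, hmax⟩ := hd.exists_max
  have hzero : ∀ x ∈ O, ∀ c, a ≤ c → Θ x ^ c = 0 := by
    intro x hx c hc
    obtain ⟨e, -, he⟩ := hb x hx
    obtain ⟨r, rfl⟩ := Nat.exists_eq_add_of_le' hc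
    rw [pow_add, he.pow_eq_zero ha, mul_zero]
  have hker : ∀ x ∈ O, ∀ (j : ℕ) (s : Σ i : Fin m, Fin (d i)), (s.2 : ℕ) < j →
      (Θ x ^ j) (E s x) = 0 := by
    intro x hx j s hs
    obtain ⟨e, he1, he⟩ := hb x hx
    rw [← he1]
    exact he.pow_apply_eq_zero j s hs
  have hshift : ∀ x ∈ O, ∀ (p : ℕ) (i : Fin m) (k l : Fin (d i)), (l : ℕ) = k + p →
      E ⟨i, k⟩ x = (Θ x ^ p) (E ⟨i, l⟩ x) := by
    intro x hx p i k l hl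
    obtain ⟨e, he1, he⟩ := hb x hx
    rw [← he1, ← he1]
    exact (he.pow_apply_eq p i k l hl).symm
  -- blocks of maximal length
  have hA : ∀ x ∈ O, ∀ (j : ℕ) (s t : Σ i : Fin m, Fin (d i)), (s.2 : ℕ) < j → (t.2 : ℕ) < j →
      d s.1 = a → (Θ x ^ j) (lieBracket ℝ (E s) (E t) x) = 0 := by
    rintro x hx j ⟨i, k⟩ t hs ht hi
    have hk := k.2
    simp only at hs hi
    -- A field at position `k` of a block of length `a` is `Θ ^ (a - 1 - k)` of the top field. As `k
    -- < j`, the exponent `j + (a - 1 - k)` is at least `a`, where powers of `Θ` vanish.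
    rw [lieBracket_congr_on hO (fun y hy => hshift y hy (a - 1 - k) i k ⟨a - 1, by omega⟩
      (by simp; omega)) (fun _ _ => rfl) hx]
    exact pow_lieBracket_eq_zero hO hΘ hN (fun y hy => hzero y hy _ (by omega)) (hE _) (hE _)
      (fun y hy => hker y hy j t ht) hx
  refine ⟨hO, hΘ, hE, hN, hb, fun x hx j s t hs ht => ?_⟩
  rcases hmax s.1 t.1 with h | h | h
  · exact hA x hx j s t hs ht h
  · rw [lieBracket_swap, map_neg, hA x hx j t s ht hs h, neg_zero]
  · obtain ⟨i, k⟩ := s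
    obtain ⟨i', k'⟩ := t
    simp only at h hs ht
    subst h
    have hk := k.2
    have hk' := k'.2
    rw [lieBracket_congr_on hO
      (fun y hy => hshift y hy (d i - 1 - k) i k ⟨d i - 1, by omega⟩ (by simp; omega))
      (fun y hy => hshift y hy (d i - 1 - k') i k' ⟨d i - 1, by omega⟩ (by simp; omega)) hx]
    refine pow_lieBracket_string_eq_zero hO hΘ hN (b := d i) (by omega) (by omega) (hE _)
      (fun y hy => hker y hy _ _ (by simp; omega)) hx

/-- Existence of primitives along the span of finitely many fields. -/
theorem exists_primitive_of_frame [FiniteDimensional ℝ V] {ι : Type} [Fintype ι] {E : ι → V → V}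
    {β : ι → V → ℝ} {O : Set V} (hO : IsOpen O) {x₀ : V} (hx₀ : x₀ ∈ O)
    (hE : ∀ s, ContDiffOn ℝ ∞ (E s) O) (hβ : ∀ s, ContDiffOn ℝ ∞ (β s) O)
    (hind : LinearIndependent ℝ fun s => E s x₀)
    (hinv : ∀ x ∈ O, ∀ s t, (lieBracket ℝ (E s) (E t) x,
      fderiv ℝ (β t) x (E s x) - fderiv ℝ (β s) x (E t x)) ∈
        Submodule.span ℝ (range fun s => (E s x, β s x)))
    (l : V →L[ℝ] ℝ) (hl : ∀ s, l (E s x₀) = β s x₀) :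
    ∃ f : V → ℝ, ∃ O' ⊆ O, IsOpen O' ∧ x₀ ∈ O' ∧ ContDiffOn ℝ ∞ f O' ∧
      (∀ x ∈ O', ∀ s, fderiv ℝ f x (E s x) = β s x) ∧ fderiv ℝ f x₀ = l := by
  classical
  let A : V → (ι → ℝ) →L[ℝ] V := fun x => combination fun s => E s x
  let b : V → (ι → ℝ) →L[ℝ] ℝ := fun x => combination fun s => β s x
  have hA : ContDiffOn ℝ ∞ A O :=
    (combination (V := V) (ι := ι)).contDiff.comp_contDiffOn (contDiffOn_pi.2 hE)
  have hb : ContDiffOn ℝ ∞ b O :=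
    (combination (V := ℝ) (ι := ι)).contDiff.comp_contDiffOn (contDiffOn_pi.2 hβ)
  have dE : ∀ x ∈ O, ∀ s, HasFDerivAt (E s) (fderiv ℝ (E s) x) x := fun x hx s =>
    (((hE s).contDiffAt (hO.mem_nhds hx)).differentiableAt (by simp)).hasFDerivAt
  have dβ : ∀ x ∈ O, ∀ s, HasFDerivAt (β s) (fderiv ℝ (β s) x) x := fun x hx s =>
    (((hβ s).contDiffAt (hO.mem_nhds hx)).differentiableAt (by simp)).hasFDerivAt
  have dA : ∀ x ∈ O, ∀ ξ a, fderiv ℝ A x ξ a = ∑ s, a s • fderiv ℝ (E s) x ξ := by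
    intro x hx ξ a
    have h1 : HasFDerivAt A _ x := (combination (V := V) (ι := ι)).hasFDerivAt.comp x
      (hasFDerivAt_pi.2 (dE x hx))
    rw [h1.fderiv]
    simp
  have db : ∀ x ∈ O, ∀ ξ a, fderiv ℝ b x ξ a = ∑ s, a s • fderiv ℝ (β s) x ξ := by
    intro x hx ξ a
    have h1 : HasFDerivAt b _ x := (combination (V := ℝ) (ι := ι)).hasFDerivAt.comp x
      (hasFDerivAt_pi.2 (dβ x hx))
    rw [h1.fderiv]
    simp
  have hprim := exists_primitive hO hx₀ hA hb ?_ ?_ l ?_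
  · obtain ⟨f, O', h1, h2, h3, h4, h5, h6⟩ := hprim
    refine ⟨f, O', h1, h2, h3, h4, fun x hx s => ?_, h6⟩
    have := h5 x hx (Pi.single s 1)
    rwa [combination_single, combination_single] at this
  · refine (injective_iff_map_eq_zero (A x₀)).2 fun c hc => ?_
    have hc' : ∑ s, c s • E s x₀ = 0 := by
      rw [← combination_apply]
      exact hc
    funext s
    exact Fintype.linearIndependent_iff.1 hind c hc' s
  · intro x hx a a'
    have hR : ∀ p ∈ Submodule.span ℝ (range fun s => (E s x, β s x)), ∃ c, p.1 = A x c ∧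
        p.2 = b x c := by
      intro p hp
      obtain ⟨c, rfl⟩ := (Submodule.mem_span_range_iff_exists_fun ℝ).1 hp
      exact ⟨c, by simp [A, Prod.fst_sum], by simp [b, Prod.snd_sum]⟩
    refine hR (_, _) ?_
    -- For constant coefficients `a`, `a'` the bracket and the closedness defect are bilinear, so it
    -- suffices to test frame fields.
    have key : ((fderiv ℝ A x (A x a) a' - fderiv ℝ A x (A x a') a,
        fderiv ℝ b x (A x a) a' - fderiv ℝ b x (A x a') a) : V × ℝ) =
        ∑ s, ∑ t, (a s * a' t) • (lieBracket ℝ (E s) (E t) x,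
          fderiv ℝ (β t) x (E s x) - fderiv ℝ (β s) x (E t x)) := by
      ext
      · rw [dA x hx, dA x hx]
        simp only [A, combination_apply, map_sum, map_smul, Finset.smul_sum, Prod.fst_sum,
          Prod.smul_fst, lieBracket, smul_sub, Finset.sum_sub_distrib, smul_smul]
        congr 1
        rw [Finset.sum_comm]
        simp only [mul_comm]
      · rw [db x hx, db x hx]
        simp only [A, combination_apply, map_sum, map_smul, Finset.smul_sum, Prod.snd_sum,
          Prod.smul_snd, smul_sub, Finset.sum_sub_distrib, smul_smul]
        congr 1
        rw [Finset.sum_comm]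
        simp only [mul_comm]
    rw [key]
    exact Submodule.sum_mem _ fun s _ => Submodule.sum_mem _ fun t _ =>
      Submodule.smul_mem _ _ (hinv x hx s t)
  · intro a
    simp [A, b, hl]

end Adapted
end NilpotentTensor

namespace NilpotentTensor
open Filter Topology VectorField

/-! ### Construction of flat coordinates from an adapted frame -/

section Step

theorem minSmoothness_two_le : minSmoothness ℝ 2 ≤ (∞ : WithTop ℕ∞) := by
  rw [minSmoothness_of_isRCLikeNormedField]
  exact ENat.LEInfty.out

variable {V : Type} [NormedAddCommGroup V] [NormedSpace ℝ V]
  {m : ℕ} {d : Fin m → ℕ} {Θ : V → V →L[ℝ] V} {O : Set V}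
  {E : (Σ i : Fin m, Fin (d i)) → V → V}

namespace AdaptedFrame

theorem mono (h : AdaptedFrame d Θ O E) {O' : Set V} (hO' : O' ⊆ O) (hO'o : IsOpen O') :
    AdaptedFrame d Θ O' E where
  isOpen := hO'o
  smooth := h.smooth.mono hO'
  smooth_frame s := (h.smooth_frame s).mono hO'
  nijenhuis := h.nijenhuis.mono hO'
  basis x hx := h.basis x (hO' hx)
  involutive x hx := h.involutive x (hO' hx)

theorem pow_apply_eq_zero (h : AdaptedFrame d Θ O E) {x : V} (hx : x ∈ O) {j : ℕ}
    {s : Σ i : Fin m, Fin (d i)} (hs : (s.2 : ℕ) < j) : (Θ x ^ j) (E s x) = 0 := by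
  obtain ⟨e, he1, he⟩ := h.basis x hx
  rw [← he1]
  exact he.pow_apply_eq_zero j s hs

theorem apply_eq (h : AdaptedFrame d Θ O E) {x : V} (hx : x ∈ O) (i : Fin m) (k l : Fin (d i))
    (hl : (l : ℕ) = k + 1) : Θ x (E ⟨i, l⟩ x) = E ⟨i, k⟩ x := by
  obtain ⟨e, he1, he⟩ := h.basis x hx
  rw [← he1, ← he1]
  exact he.2 i k l hl

/-- The values of `g'` along `Θ`-images: if `dg ∘ Θ = dg'` is exact, then `dg` is compatible with
brackets of fields in the image of `Θ`. -/
theorem fderiv_bracket_image (h : AdaptedFrame d Θ O E) {g g' : V → ℝ} (hg : ContDiffOn ℝ ∞ g O)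
    (hg' : ContDiffOn ℝ ∞ g' O) (hgg' : ∀ x ∈ O, ∀ v, fderiv ℝ g x (Θ x v) = fderiv ℝ g' x v)
    {a b : V → V} (ha : ContDiffOn ℝ ∞ a O) (hb : ContDiffOn ℝ ∞ b O) {x : V} (hx : x ∈ O) :
    fderiv ℝ (fun y => fderiv ℝ g y (b y)) x (Θ x (a x)) -
      fderiv ℝ (fun y => fderiv ℝ g y (a y)) x (Θ x (b x)) =
    fderiv ℝ g x (lieBracket ℝ (fun y => Θ y (a y)) b x + lieBracket ℝ a (fun y => Θ y (b y)) x
      - Θ x (lieBracket ℝ a b x)) := by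
  have hn := h.isOpen.mem_nhds hx
  have dif : ∀ {v : V → V}, ContDiffOn ℝ ∞ v O → DifferentiableAt ℝ v x := fun hv =>
    (hv.contDiffAt hn).differentiableAt (by simp)
  have hΘa := h.smooth.clm_apply ha
  have hΘb := h.smooth.clm_apply hb
  have hmin : minSmoothness ℝ 2 ≤ (∞ : WithTop ℕ∞) := minSmoothness_two_le
  have c1 : ∀ {v w : V → V}, ContDiffOn ℝ ∞ v O → ContDiffOn ℝ ∞ w O →
      fderiv ℝ g x (lieBracket ℝ v w x) =
        fderiv ℝ (fun y => fderiv ℝ g y (w y)) x (v x) -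
          fderiv ℝ (fun y => fderiv ℝ g y (v y)) x (w x) := fun hv hw =>
    fderiv_apply_lieBracket (hg.contDiffAt hn) hmin (dif hw) (dif hv)
  have c2 := fderiv_apply_lieBracket (hg'.contDiffAt hn) hmin (dif hb) (dif ha)
  have e1 : ∀ v : V → V, fderiv ℝ (fun y => fderiv ℝ g y (Θ y (v y))) x =
      fderiv ℝ (fun y => fderiv ℝ g' y (v y)) x := by
    intro v
    refine Filter.EventuallyEq.fderiv_eq ?_
    filter_upwards [hn] with y hy using hgg' y hy _
  -- The two mixed brackets contribute derivatives of `g'` along `a` and `b` that add up to dg'[a,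
  -- b] = dg(Θ[a, b]), which the last term cancels.
  rw [map_sub, map_add, c1 hΘa hb, c1 ha hΘb, hgg' x hx, c2, e1, e1]
  ring

/-- One step in the construction of adapted coordinates: solving `df ∘ Θ = dg`. -/
theorem exists_step [FiniteDimensional ℝ V] (h : AdaptedFrame d Θ O E) {x₀ : V} (hx₀ : x₀ ∈ O)
    (j : ℕ) {g g' : V → ℝ} (hg : ContDiffOn ℝ ∞ g O) (hg' : ContDiffOn ℝ ∞ g' O)
    (hgg' : ∀ x ∈ O, ∀ v, fderiv ℝ g x (Θ x v) = fderiv ℝ g' x v)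
    (hker : ∀ x ∈ O, ∀ v, (Θ x ^ (j + 1)) v = 0 → fderiv ℝ g x v = 0)
    (l : V →L[ℝ] ℝ) (hl : ∀ v, l (Θ x₀ v) = fderiv ℝ g x₀ v)
    (hlker : ∀ v, (Θ x₀ ^ j) v = 0 → l v = 0) :
    ∃ f : V → ℝ, ∃ O' ⊆ O, IsOpen O' ∧ x₀ ∈ O' ∧ ContDiffOn ℝ ∞ f O' ∧
      (∀ x ∈ O', ∀ v, fderiv ℝ f x (Θ x v) = fderiv ℝ g x v) ∧
      (∀ x ∈ O', ∀ v, (Θ x ^ j) v = 0 → fderiv ℝ f x v = 0) ∧ fderiv ℝ f x₀ = l := by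
  classical
  have hO := h.isOpen
  -- The selected frame fields span Im Θ + Ker Θ^j: an index is kept if it is not at the top of its
  -- block or if it lies below level `j`.
  let ι : Type := {s : Σ i : Fin m, Fin (d i) // (s.2 : ℕ) + 1 < d s.1 ∨ (s.2 : ℕ) < j}
  let next : (s : Σ i : Fin m, Fin (d i)) → (s.2 : ℕ) + 1 < d s.1 → Σ i : Fin m, Fin (d i) :=
    fun s hs => ⟨s.1, ⟨s.2 + 1, hs⟩⟩
  -- The forced values: df(Θu) = dg(u) on the image and 0 on Ker Θ^j. They agree on the overlap,
  -- since Θu in Ker Θ^j puts `u` in Ker Θ^(j+1), where dg vanishes.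
  let β : (Σ i : Fin m, Fin (d i)) → V → ℝ := fun s x =>
    if hs : (s.2 : ℕ) + 1 < d s.1 then fderiv ℝ g x (E (next s hs) x) else 0
  have hΘnext : ∀ x ∈ O, ∀ s hs, Θ x (E (next s hs) x) = E s x := fun x hx s hs =>
    h.apply_eq hx s.1 s.2 ⟨s.2 + 1, hs⟩ rfl
  have hβlow : ∀ x ∈ O, ∀ s : Σ i : Fin m, Fin (d i), (s.2 : ℕ) < j → β s x = 0 := by
    intro x hx s hs
    by_cases hs' : (s.2 : ℕ) + 1 < d s.1
    · simp only [β, dif_pos hs']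
      exact hker x hx _ (h.pow_apply_eq_zero hx (Nat.succ_lt_succ hs))
    · simp only [β, dif_neg hs']
  -- `R x` is the graph of the prescribed functional on Im Θ + Ker Θ^j. Integrability becomes
  -- membership in this graph.
  let R : V → Submodule ℝ (V × ℝ) := fun x =>
    Submodule.span ℝ (range fun s : ι => (E s.1 x, β s.1 x))
  have hR0 : ∀ x (s : ι), (E s.1 x, β s.1 x) ∈ R x := fun x s => Submodule.subset_span ⟨s, rfl⟩
  have hR1 : ∀ x ∈ O, ∀ q, (Θ x q, fderiv ℝ g x q) ∈ R x := by
    intro x hx q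
    obtain ⟨e, he1, he⟩ := h.basis x hx
    let L : V →ₗ[ℝ] V × ℝ := (Θ x : V →ₗ[ℝ] V).prod (fderiv ℝ g x : V →ₗ[ℝ] ℝ)
    have : ∀ q, q ∈ (R x).comap L := by
      have h1 : Submodule.span ℝ (range e) ≤ (R x).comap L := by
        rw [Submodule.span_le]
        rintro _ ⟨⟨i, k⟩, rfl⟩
        change (Θ x (e ⟨i, k⟩), fderiv ℝ g x (e ⟨i, k⟩)) ∈ R x
        rcases Nat.eq_zero_or_pos k with hk | hk
        · rw [he.1 i k hk, hker x hx _ (he.pow_apply_eq_zero _ _ (by simp; omega))]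
          exact Submodule.zero_mem _
        · have hk2 := k.2
          have hk' : (k : ℕ) - 1 < d i := by omega
          have hs : (((⟨i, ⟨k - 1, hk'⟩⟩ : Σ i : Fin m, Fin (d i)).2 : ℕ)) + 1 < d i := by
            simp only
            omega
          have hnext : next ⟨i, ⟨k - 1, hk'⟩⟩ hs = ⟨i, k⟩ := by
            simp only [next, Sigma.mk.inj_iff, heq_eq_eq, true_and, Fin.ext_iff]
            omega
          have := hR0 x ⟨⟨i, ⟨k - 1, hk'⟩⟩, Or.inl hs⟩
          simp only [β, dif_pos hs] at this
          rw [hnext, ← he1, ← he1] at this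
          rwa [he.2 i ⟨k - 1, hk'⟩ k (by simp only; omega)]
      rw [e.span_eq] at h1
      exact fun q => h1 trivial
    exact this q
  have hR2 : ∀ x ∈ O, ∀ r, (Θ x ^ j) r = 0 → (r, (0 : ℝ)) ∈ R x := by
    intro x hx r hr
    obtain ⟨e, he1, he⟩ := h.basis x hx
    have h1 : ((r, 0) : V × ℝ) = ∑ s, e.repr r s • (e s, (0 : ℝ)) := by
      ext
      · simp [Prod.fst_sum, e.sum_repr]
      · simp [Prod.snd_sum]
    rw [h1]
    refine Submodule.sum_mem _ fun s _ => ?_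
    by_cases hs : (s.2 : ℕ) < j
    · have := hR0 x ⟨s, Or.inr hs⟩
      simp only [hβlow x hx s hs] at this
      rw [he1]
      exact Submodule.smul_mem _ _ this
    · rw [he.repr_eq_zero_of_pow_eq_zero hr s (not_lt.1 hs), zero_smul]
      exact Submodule.zero_mem _
  have hvanish : ∀ x (L : V →L[ℝ] ℝ), (∀ s : ι, L (E s.1 x) = β s.1 x) →
      ∀ p ∈ R x, L p.1 = p.2 := by
    intro x L hL p hp
    have h1 : R x ≤ LinearMap.ker ((L : V →ₗ[ℝ] ℝ).comp (LinearMap.fst ℝ V ℝ) -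
        LinearMap.snd ℝ V ℝ) := by
      simp only [R]
      rw [Submodule.span_le]
      rintro _ ⟨s, rfl⟩
      simp [hL]
    have h2 := h1 hp
    simpa [sub_eq_zero] using h2
  have hβsmooth : ∀ s, ContDiffOn ℝ ∞ (β s) O := by
    intro s
    by_cases hs : (s.2 : ℕ) + 1 < d s.1
    · simp only [β, dif_pos hs]
      exact (hg.fderiv_of_isOpen hO (by simp)).clm_apply (h.smooth_frame _)
    · simp only [β, dif_neg hs]
      exact contDiffOn_const
  have hmin : minSmoothness ℝ 2 ≤ (∞ : WithTop ℕ∞) := minSmoothness_two_le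
  -- brackets of a field in the image with a field in the kernel
  have hmixed : ∀ x ∈ O, ∀ s t : Σ i : Fin m, Fin (d i), (s.2 : ℕ) + 1 < d s.1 → (t.2 : ℕ) < j →
      (lieBracket ℝ (E s) (E t) x, fderiv ℝ (β t) x (E s x) - fderiv ℝ (β s) x (E t x)) ∈ R x := by
    intro x hx s t hs ht
    have hn := hO.mem_nhds hx
    have hβt : fderiv ℝ (β t) x = 0 := by
      have : β t =ᶠ[𝓝 x] fun _ => 0 := by
        filter_upwards [hn] with y hy using hβlow y hy t ht
      rw [this.fderiv_eq]
      simp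
    have hβs : β s = fun y => fderiv ℝ g y (E (next s hs) y) := by
      funext y
      simp only [β, dif_pos hs]
    have h1 := fderiv_apply_lieBracket (hg.contDiffAt hn) hmin
      (((h.smooth_frame t).contDiffAt hn).differentiableAt (by simp))
      (((h.smooth_frame (next s hs)).contDiffAt hn).differentiableAt (by simp))
    have h2 : fderiv ℝ (fun y => fderiv ℝ g y (E t y)) x = 0 := by
      have : (fun y => fderiv ℝ g y (E t y)) =ᶠ[𝓝 x] fun _ => 0 := by
        filter_upwards [hn] with y hy using
          hker y hy _ (h.pow_apply_eq_zero hy (ht.trans (Nat.lt_succ_self j)))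
      rw [this.fderiv_eq]
      simp
    rw [h2] at h1
    have h3 := pow_powDefect_eq_zero hO h.smooth h.nijenhuis 1 j (h.smooth_frame (next s hs))
      (h.smooth_frame t) (fun y hy => h.pow_apply_eq_zero hy ht) hx
    -- With u = [E (next s), E t], the bracket splits into Θu, with prescribed value dg(u), and a
    -- defect in Ker Θ^j, with prescribed value 0.
    have h4 : lieBracket ℝ (E s) (E t) x = Θ x (lieBracket ℝ (E (next s hs)) (E t) x) +
        powDefect Θ 1 (E (next s hs)) (E t) x := by
      rw [lieBracket_congr_on hO (fun y hy => (hΘnext y hy s hs).symm) (fun _ _ => rfl) hx]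
      simp [powDefect]
    have h5 := Submodule.add_mem _ (hR1 x hx (lieBracket ℝ (E (next s hs)) (E t) x)) (hR2 x hx _ h3)
    rw [hβt, hβs, h4]
    rw [h1] at h5
    simpa using h5
  have hswap : ∀ x (s t : Σ i : Fin m, Fin (d i)),
      (lieBracket ℝ (E s) (E t) x, fderiv ℝ (β t) x (E s x) - fderiv ℝ (β s) x (E t x)) =
        -(lieBracket ℝ (E t) (E s) x, fderiv ℝ (β s) x (E t x) - fderiv ℝ (β t) x (E s x)) := by
    intro x s t
    rw [lieBracket_swap]
    ext <;> simp
  have hinv : ∀ x ∈ O, ∀ s t : ι, (lieBracket ℝ (E s.1) (E t.1) x,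
      fderiv ℝ (β t.1) x (E s.1 x) - fderiv ℝ (β s.1) x (E t.1 x)) ∈ R x := by
    rintro x hx ⟨s, hs⟩ ⟨t, ht⟩
    have hn := hO.mem_nhds hx
    simp only
    rcases hs with hs | hs
    · rcases ht with ht | ht
      -- For two image fields Θa, Θb the pair to be tested is (Θq, dg(q)) with q = [Θa, b] + [a, Θb]
      -- - Θ[a, b]; the first component is N = 0, the second uses that dg ∘ Θ = dg' is exact.
      · have h1 := h.fderiv_bracket_image hg hg' hgg' (h.smooth_frame (next s hs))
          (h.smooth_frame (next t ht)) hx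
        have hβs : β s = fun y => fderiv ℝ g y (E (next s hs) y) := by
          funext y
          simp only [β, dif_pos hs]
        have hβt : β t = fun y => fderiv ℝ g y (E (next t ht) y) := by
          funext y
          simp only [β, dif_pos ht]
        rw [hΘnext x hx, hΘnext x hx] at h1
        rw [hβs, hβt, h1, lieBracket_congr_on hO (fun y hy => (hΘnext y hy s hs).symm)
          (fun y hy => (hΘnext y hy t ht).symm) hx]
        have h2 := h.nijenhuis O subset_rfl hO _ _ (h.smooth_frame (next s hs))
          (h.smooth_frame (next t ht)) x hx
        have h3 := hR1 x hx (lieBracket ℝ (fun y => Θ y (E (next s hs) y)) (E (next t ht)) x +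
          lieBracket ℝ (E (next s hs)) (fun y => Θ y (E (next t ht) y)) x -
            Θ x (lieBracket ℝ (E (next s hs)) (E (next t ht)) x))
        convert! h3 using 2
        rw [map_sub, map_add, ← sub_eq_zero, ← neg_eq_zero, ← h2]
        abel
      · exact hmixed x hx s t hs ht
    · rcases ht with ht | ht
      · rw [hswap]
        exact Submodule.neg_mem _ (hmixed x hx t s ht hs)
      · have hz : ∀ u : Σ i : Fin m, Fin (d i), (u.2 : ℕ) < j → fderiv ℝ (β u) x = 0 := by
          intro u hu
          have : β u =ᶠ[𝓝 x] fun _ => 0 := by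
            filter_upwards [hn] with y hy using hβlow y hy u hu
          rw [this.fderiv_eq]
          simp
        rw [hz s hs, hz t ht]
        simpa using hR2 x hx _ (h.involutive x hx j s t hs ht)
  obtain ⟨e, he1, he⟩ := h.basis x₀ hx₀
  have hind : LinearIndependent ℝ fun s : ι => E s.1 x₀ := by
    have h1 := e.linearIndependent.comp (Subtype.val : ι → _) Subtype.val_injective
    have h2 : (fun s : ι => E s.1 x₀) = e ∘ Subtype.val := by
      funext s
      exact (he1 s.1).symm
    rwa [h2]
  have hlE : ∀ s : ι, l (E s.1 x₀) = β s.1 x₀ := by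
    rintro ⟨s, hs⟩
    by_cases hs' : (s.2 : ℕ) + 1 < d s.1
    · simp only [β, dif_pos hs']
      rw [← hl, hΘnext x₀ hx₀]
    · have hs2 := hs.resolve_left hs'
      simp only [hβlow x₀ hx₀ s hs2]
      exact hlker _ (h.pow_apply_eq_zero hx₀ hs2)
  obtain ⟨f, O', h1, h2, h3, h4, h5, h6⟩ := exists_primitive_of_frame (ι := ι)
    (E := fun s => E s.1) (β := fun s => β s.1) hO hx₀ (fun s => h.smooth_frame _)
    (fun s => hβsmooth _) hind hinv l hlE
  refine ⟨f, O', h1, h2, h3, h4, fun x hx v => ?_, fun x hx v hv => ?_, h6⟩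
  · exact hvanish x _ (h5 x hx) _ (hR1 x (h1 hx) v)
  · exact hvanish x _ (h5 x hx) _ (hR2 x (h1 hx) v hv)

/-- A chain of functions adapted to one Jordan block. -/
theorem exists_chain [FiniteDimensional ℝ V] (h : AdaptedFrame d Θ O E) {x₀ : V} (hx₀ : x₀ ∈ O)
    {D : ℕ} (l : ℕ → V →L[ℝ] ℝ) (hl0 : ∀ k, D ≤ k → l k = 0)
    (hl : ∀ k v, l k (Θ x₀ v) = l (k + 1) v) (hlker : ∀ k v, (Θ x₀ ^ k) v = 0 → l k v = 0) :
    ∃ f : ℕ → V → ℝ, ∃ O' ⊆ O, IsOpen O' ∧ x₀ ∈ O' ∧ (∀ k, ContDiffOn ℝ ∞ (f k) O') ∧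
      (∀ k, ∀ x ∈ O', ∀ v, fderiv ℝ (f k) x (Θ x v) = fderiv ℝ (f (k + 1)) x v) ∧
      (∀ k, D ≤ k → ∀ x ∈ O', fderiv ℝ (f k) x = 0) ∧ ∀ k, fderiv ℝ (f k) x₀ = l k := by
  -- `p` counts the functions built so far from the top of the block downwards; those of index at
  -- least `D` have zero differential. Vanishing on kernels is carried along because the next step
  -- needs it.
  have key : ∀ p, ∃ f : ℕ → V → ℝ, ∃ O' ⊆ O, IsOpen O' ∧ x₀ ∈ O' ∧
      (∀ k, D ≤ k + p → ContDiffOn ℝ ∞ (f k) O') ∧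
      (∀ k, D ≤ k + p → ∀ x ∈ O', ∀ v, fderiv ℝ (f k) x (Θ x v) = fderiv ℝ (f (k + 1)) x v) ∧
      (∀ k, D ≤ k + p → ∀ x ∈ O', ∀ v, (Θ x ^ k) v = 0 → fderiv ℝ (f k) x v = 0) ∧
      (∀ k, D ≤ k → ∀ x ∈ O', fderiv ℝ (f k) x = 0) ∧
      ∀ k, D ≤ k + p → fderiv ℝ (f k) x₀ = l k := by
    intro p
    induction p with
    | zero =>
      refine ⟨fun _ _ => 0, O, subset_rfl, h.isOpen, hx₀, fun _ _ => contDiffOn_const, ?_, ?_, ?_, ?_⟩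
      · intros
        simp
      · intros
        simp
      · intros
        simp
      · intro k hk
        rw [hl0 k hk]
        simp
    | succ p ih =>
      obtain ⟨f, O', h1, h2, h3, h4, h5, h6, h8, h7⟩ := ih
      by_cases hp : D ≤ p
      · exact ⟨f, O', h1, h2, h3, fun k _ => h4 k (by omega), fun k _ => h5 k (by omega),
          fun k _ => h6 k (by omega), h8, fun k _ => h7 k (by omega)⟩
      · set j := D - (p + 1) with hj
        have hj1 : D ≤ j + 1 + p := by omega
        obtain ⟨f', O'', g1, g2, g3, g4, g5, g6, g7⟩ := (h.mono h1 h2).exists_step h3 j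
          (h4 (j + 1) hj1) (h4 (j + 2) (by omega)) (h5 (j + 1) hj1) (h6 (j + 1) hj1) (l j)
          (fun v => by rw [hl, h7 _ hj1]) (hlker j)
        have hcase : ∀ k, D ≤ k + (p + 1) → k = j ∨ (k ≠ j ∧ D ≤ k + p) := fun k hk => by omega
        have hjj : j + 1 ≠ j := by omega
        refine ⟨Function.update f j f', O'', g1.trans h1, g2, g3, ?_, ?_, ?_, ?_, ?_⟩
        · intro k hk
          rcases hcase k hk with rfl | ⟨hne, hk'⟩
          · rwa [Function.update_self]
          · rw [Function.update_of_ne hne]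
            exact (h4 k hk').mono g1
        · intro k hk
          rcases hcase k hk with rfl | ⟨hne, hk'⟩
          · rw [Function.update_self, Function.update_of_ne hjj]
            exact g5
          · rw [Function.update_of_ne hne, Function.update_of_ne (by omega)]
            exact fun x hx => h5 k hk' x (g1 hx)
        · intro k hk
          rcases hcase k hk with rfl | ⟨hne, hk'⟩
          · rwa [Function.update_self]
          · rw [Function.update_of_ne hne]
            exact fun x hx => h6 k hk' x (g1 hx)
        · intro k hk x hx
          rw [Function.update_of_ne (by omega)]
          exact h8 k hk x (g1 hx)
        · intro k hk
          rcases hcase k hk with rfl | ⟨hne, hk'⟩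
          · rwa [Function.update_self]
          · rw [Function.update_of_ne hne]
            exact h7 k hk'
  obtain ⟨f, O', h1, h2, h3, h4, h5, -, h8, h7⟩ := key D
  exact ⟨f, O', h1, h2, h3, fun k => h4 k (by omega), fun k => h5 k (by omega), h8,
    fun k => h7 k (by omega)⟩

/-- Local coordinates in which a tensor with an adapted frame is constant. -/
theorem exists_coordinates [FiniteDimensional ℝ V] (h : AdaptedFrame d Θ O E) {x₀ : V}
    (hx₀ : x₀ ∈ O) :
    ∃ φ : OpenPartialHomeomorph V V, x₀ ∈ φ.source ∧ φ.source ⊆ O ∧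
      ContDiffOn ℝ ∞ φ φ.source ∧ ContDiffOn ℝ ∞ φ.symm φ.target ∧
      ∀ x ∈ φ.source, ∀ v, fderiv ℝ φ x (Θ x v) = Θ x₀ (fderiv ℝ φ x v) := by
  classical
  obtain ⟨e, he1, he⟩ := h.basis x₀ hx₀
  -- The coordinate functionals of block `i` at `x₀`, continued by 0 past the top so that the
  -- relation `l k ∘ Θ = l (k + 1)` holds for every `k`.
  let l : Fin m → ℕ → V →L[ℝ] ℝ := fun i k =>
    if hk : k < d i then LinearMap.toContinuousLinearMap (e.coord ⟨i, ⟨k, hk⟩⟩) else 0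
  have hlt : ∀ i k (hk : k < d i) v, l i k v = e.repr v ⟨i, ⟨k, hk⟩⟩ := fun i k hk v => by
    simp only [l, dif_pos hk]
    rfl
  have hge : ∀ i k, d i ≤ k → l i k = 0 := fun i k hk => by
    simp only [l, dif_neg (not_lt.2 hk)]
  have hchain := fun i => h.exists_chain hx₀ (D := d i) (l i) (hge i)
    (fun k v => by
      rcases lt_trichotomy (k + 1) (d i) with hk | hk | hk
      · rw [hlt i k (by omega), hlt i (k + 1) hk]
        exact he.repr_apply_of_lt v i _ _ rfl
      · rw [hlt i k (by omega), hge i (k + 1) hk.ge]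
        exact he.repr_apply_of_top v i _ hk
      · rw [hge i k (by omega), hge i (k + 1) hk.le]
        simp)
    (fun k v hv => by
      by_cases hk : k < d i
      · rw [hlt i k hk]
        exact he.repr_eq_zero_of_pow_eq_zero hv _ le_rfl
      · rw [hge i k (not_lt.1 hk)]
        rfl)
  choose f Oi hOi hOi2 hOi3 hf hfΘ hf0 hfx₀ using hchain
  let O₁ : Set V := O ∩ ⋂ i, Oi i
  have hO₁ : IsOpen O₁ := h.isOpen.inter (isOpen_iInter_of_finite hOi2)
  have hO₁i : ∀ i, O₁ ⊆ Oi i := fun i x hx => mem_iInter.1 hx.2 i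
  have hx₀₁ : x₀ ∈ O₁ := ⟨hx₀, mem_iInter.2 hOi3⟩
  let φ : V → V := fun x => ∑ s : Σ i : Fin m, Fin (d i), f s.1 s.2 x • e s
  have hφ : ContDiffOn ℝ ∞ φ O₁ := ContDiffOn.sum fun s _ =>
    ((hf s.1 s.2).mono (hO₁i s.1)).smul contDiffOn_const
  have dφ : ∀ x ∈ O₁, ∀ v, fderiv ℝ φ x v =
      ∑ s : Σ i : Fin m, Fin (d i), fderiv ℝ (f s.1 s.2) x v • e s := by
    intro x hx v
    have h1 : HasFDerivAt φ (∑ s : Σ i : Fin m, Fin (d i),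
        (fderiv ℝ (f s.1 s.2) x).smulRight (e s)) x := by
      refine HasFDerivAt.fun_sum fun s _ => ?_
      have h2 := (((hf s.1 s.2).mono (hO₁i s.1)).contDiffAt (hO₁.mem_nhds hx)).differentiableAt
        (by simp)
      exact h2.hasFDerivAt.smul_const (e s)
    rw [h1.fderiv]
    simp
  have hrepr : ∀ x ∈ O₁, ∀ v i (k : Fin (d i)),
      e.repr (fderiv ℝ φ x v) ⟨i, k⟩ = fderiv ℝ (f i k) x v := by
    intro x hx v i k
    rw [dφ x hx, e.repr_sum_self fun s : Σ i : Fin m, Fin (d i) => fderiv ℝ (f s.1 s.2) x v]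
  have hφΘ : ∀ x ∈ O₁, ∀ v, fderiv ℝ φ x (Θ x v) = Θ x₀ (fderiv ℝ φ x v) := by
    intro x hx v
    refine e.repr.injective (Finsupp.ext fun ⟨i, k⟩ => ?_)
    rw [hrepr x hx, hfΘ i _ x (hO₁i i hx)]
    rcases lt_or_eq_of_le (Nat.succ_le_of_lt k.2) with hk | hk
    · rw [he.repr_apply_of_lt _ i k ⟨k + 1, hk⟩ rfl, hrepr x hx]
    · rw [he.repr_apply_of_top _ i k hk, hf0 i _ hk.ge x (hO₁i i hx)]
      rfl
  have hφx₀ : fderiv ℝ φ x₀ = (ContinuousLinearEquiv.refl ℝ V : V →L[ℝ] V) := by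
    ext v
    refine e.repr.injective (Finsupp.ext fun ⟨i, k⟩ => ?_)
    rw [hrepr x₀ hx₀₁, hfx₀, hlt i k k.2]
    rfl
  have hdφ : ∀ x ∈ O₁, HasFDerivAt φ (fderiv ℝ φ x) x := fun x hx =>
    ((hφ.contDiffAt (hO₁.mem_nhds hx)).differentiableAt (by simp)).hasFDerivAt
  have hne : (∞ : WithTop ℕ∞) ≠ 0 := by simp
  have hd₀ := hdφ x₀ hx₀₁
  rw [hφx₀] at hd₀
  have hcd := hφ.contDiffAt (hO₁.mem_nhds hx₀₁)
  let ψ := hcd.toOpenPartialHomeomorph φ hd₀ hne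
  have hψ : (ψ : V → V) = φ := rfl
  -- Restricting to points where the derivative of `φ` is invertible makes the inverse smooth on the
  -- whole target.
  let O₂ : Set V := O₁ ∩ fderiv ℝ φ ⁻¹' (range ((↑) : (V ≃L[ℝ] V) → V →L[ℝ] V))
  have hO₂ : IsOpen O₂ := (hφ.continuousOn_fderiv_of_isOpen hO₁ (by simp)).isOpen_inter_preimage
    hO₁ ContinuousLinearEquiv.isOpen
  have hsrc : (ψ.restrOpen O₂ hO₂).source ⊆ O₂ := fun x hx => hx.2
  refine ⟨ψ.restrOpen O₂ hO₂, ⟨hcd.mem_toOpenPartialHomeomorph_source hd₀ hne, hx₀₁, _,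
    hφx₀.symm⟩, fun x hx => (hsrc hx).1.1, hφ.mono fun x hx => (hsrc hx).1, ?_,
    fun x hx v => hφΘ x (hsrc hx).1 v⟩
  intro y hy
  have hx := hsrc ((ψ.restrOpen O₂ hO₂).map_target hy)
  obtain ⟨L, hL⟩ := hx.2
  refine ((ψ.restrOpen O₂ hO₂).contDiffAt_symm (f₀' := L) hy ?_
    (hφ.contDiffAt (hO₁.mem_nhds hx.1))).contDiffWithinAt
  rw [hL]
  exact hdφ _ hx.1

end AdaptedFrame

end Step
end NilpotentTensor

namespace NilpotentTensor
open Filter Topology VectorField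

/-! ### From manifolds to charts -/

theorem exists_flat_coordinates {V : Type} [NormedAddCommGroup V] [NormedSpace ℝ V]
    [FiniteDimensional ℝ V] {m : ℕ} {d : Fin m → ℕ} (hd : BlockCondition d)
    {Θ : V → V →L[ℝ] V} {O : Set V} {x₀ : V} (hO : IsOpen O) (hΘ : ContDiffOn ℝ ∞ Θ O)
    (hN : NijenhuisVanishesOn Θ O) (hx₀ : x₀ ∈ O)
    (hconj : ∀ x ∈ O, ∃ F : V ≃ₗ[ℝ] V, ∀ v, F (Θ x v) = Θ x₀ (F v))
    {e : Module.Basis (Σ i : Fin m, Fin (d i)) ℝ V} (he : IsJordanBasis d (Θ x₀) e) :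
    ∃ φ : OpenPartialHomeomorph V V, x₀ ∈ φ.source ∧ φ.source ⊆ O ∧
      ContDiffOn ℝ ∞ φ φ.source ∧ ContDiffOn ℝ ∞ φ.symm φ.target ∧
      ∀ x ∈ φ.source, ∀ v, fderiv ℝ φ x (Θ x v) = Θ x₀ (fderiv ℝ φ x v) := by
  obtain ⟨E, O', hO'O, hO', hx₀', hE, -, hb⟩ := exists_smooth_jordanBasis hO hΘ hx₀ hconj he
  have hA := AdaptedFrame.of_blockCondition hd hO' (hΘ.mono hO'O) hE (hN.mono hO'O) hb
  obtain ⟨φ, h1, h2, h3⟩ := hA.exists_coordinates hx₀'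
  exact ⟨φ, h1, h2.trans hO'O, h3⟩

theorem mlieBracket_eq_lieBracket {E : Type*} [NormedAddCommGroup E] [NormedSpace ℝ E]
    (v w : ∀ x : E, TangentSpace 𝓘(ℝ, E) x) :
    mlieBracket 𝓘(ℝ, E) v w = lieBracket ℝ v w := by
  rw [← mlieBracketWithin_univ, mlieBracketWithin_eq_lieBracketWithin]
  exact lieBracketWithin_univ

section Chart

variable {n : ℕ} {M : Type u} [TopologicalSpace M] [ChartedSpace (EuclideanSpace ℝ (Fin n)) M]

local notation "𝔼" => EuclideanSpace ℝ (Fin n)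

/-- The components of `Θ` in the coordinates `c`. -/
noncomputable def chartTensor (c : OpenPartialHomeomorph M (EuclideanSpace ℝ (Fin n)))
    (Θ : ∀ x : M, TangentSpace (𝓡 n) x →L[ℝ] TangentSpace (𝓡 n) x)
    (y : EuclideanSpace ℝ (Fin n)) : EuclideanSpace ℝ (Fin n) →L[ℝ] EuclideanSpace ℝ (Fin n) :=
  (mfderiv (𝓡 n) (𝓡 n) c (c.symm y)).comp
    ((Θ (c.symm y)).comp (mfderiv (𝓡 n) (𝓡 n) c (c.symm y)).inverse)

variable {c : OpenPartialHomeomorph M (EuclideanSpace ℝ (Fin n))}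
  {Θ : ∀ x : M, TangentSpace (𝓡 n) x →L[ℝ] TangentSpace (𝓡 n) x}

section

variable (hc : c.MDifferentiable (𝓡 n) (𝓡 n))
include hc

theorem isInvertible_mfderiv {x : M} (hx : x ∈ c.source) :
    (mfderiv (𝓡 n) (𝓡 n) c x).IsInvertible :=
  ⟨hc.mfderiv hx, rfl⟩

theorem inverse_mfderiv_apply {x : M} (hx : x ∈ c.source) (v : TangentSpace (𝓡 n) x) :
    (mfderiv (𝓡 n) (𝓡 n) c x).inverse (mfderiv (𝓡 n) (𝓡 n) c x v) = v := by
  obtain ⟨L, hL⟩ := isInvertible_mfderiv hc hx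
  rw [← hL, ContinuousLinearMap.inverse_equiv]
  exact L.symm_apply_apply v

theorem mfderiv_inverse_apply {x : M} (hx : x ∈ c.source)
    (v : TangentSpace (𝓡 n) (c x)) :
    mfderiv (𝓡 n) (𝓡 n) c x ((mfderiv (𝓡 n) (𝓡 n) c x).inverse v) = v := by
  obtain ⟨L, hL⟩ := isInvertible_mfderiv hc hx
  rw [← hL, ContinuousLinearMap.inverse_equiv]
  exact L.apply_symm_apply v

theorem chartTensor_mfderiv {x : M} (hx : x ∈ c.source) (v : TangentSpace (𝓡 n) x) :
    chartTensor c Θ (c x) (mfderiv (𝓡 n) (𝓡 n) c x v) = mfderiv (𝓡 n) (𝓡 n) c x (Θ x v) := by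
  -- The tensor is evaluated at `c.symm (c x)`, which is only propositionally equal to `x`; the base
  -- point is generalised before substituting.
  have key : ∀ y, y = x → (mfderiv (𝓡 n) (𝓡 n) c y : 𝔼 →L[ℝ] 𝔼) ((Θ y : 𝔼 →L[ℝ] 𝔼)
      (ContinuousLinearMap.inverse (mfderiv (𝓡 n) (𝓡 n) c y : 𝔼 →L[ℝ] 𝔼)
        (mfderiv (𝓡 n) (𝓡 n) c x v))) = mfderiv (𝓡 n) (𝓡 n) c x (Θ x v) := by
    rintro y rfl
    exact congrArg (fun u => mfderiv (𝓡 n) (𝓡 n) c y (Θ y u)) (inverse_mfderiv_apply hc hx v)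
  exact key _ (c.left_inv hx)

/-- The vector field on `M` whose components in the coordinates `c` are `v`. -/
noncomputable def chartField (c : OpenPartialHomeomorph M (EuclideanSpace ℝ (Fin n)))
    (v : EuclideanSpace ℝ (Fin n) → EuclideanSpace ℝ (Fin n)) (x : M) : TangentSpace (𝓡 n) x :=
  mpullback (𝓡 n) (𝓡 n) c v x

theorem apply_chartField {x : M} (hx : x ∈ c.source) (v : 𝔼 → 𝔼) :
    Θ x (chartField c v x) = chartField c (fun y => chartTensor c Θ y (v y)) x := by
  have h1 := chartTensor_mfderiv (Θ := Θ) hc hx ((mfderiv (𝓡 n) (𝓡 n) c x).inverse (v (c x)))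
  have h2 := inverse_mfderiv_apply hc hx (Θ x ((mfderiv (𝓡 n) (𝓡 n) c x).inverse (v (c x))))
  have h3 := mfderiv_inverse_apply hc hx (v (c x))
  refine h2.symm.trans ?_
  refine congrArg (fun u => (mfderiv (𝓡 n) (𝓡 n) c x).inverse u) (h1.symm.trans ?_)
  exact congrArg (fun u => chartTensor c Θ (c x) u) h3

end

theorem mdifferentiable_of_mem_maximalAtlas [IsManifold (𝓡 n) ∞ M]
    (hc : c ∈ IsManifold.maximalAtlas (𝓡 n) ∞ M) : c.MDifferentiable (𝓡 n) (𝓡 n) :=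
  ⟨(contMDiffOn_of_mem_maximalAtlas hc).mdifferentiableOn (by simp),
    (contMDiffOn_symm_of_mem_maximalAtlas hc).mdifferentiableOn (by simp)⟩

theorem isSmoothFieldOn_chartField [IsManifold (𝓡 n) ∞ M]
    (hc : c ∈ IsManifold.maximalAtlas (𝓡 n) ∞ M)
    {v : 𝔼 → 𝔼} {U : Set 𝔼} (hU : IsOpen U) (hv : ContDiffOn ℝ ∞ v U) :
    IsSmoothFieldOn (chartField c v) (c.source ∩ c ⁻¹' U) := by
  rintro x ⟨hx, hxU⟩
  have h1 : ContMDiffAt (𝓡 n) (𝓡 n).tangent ∞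
      (fun y : 𝔼 => (⟨y, v y⟩ : TangentBundle (𝓡 n) 𝔼)) (c x) :=
    contMDiffAt_vectorSpace_iff_contDiffAt.2 (hv.contDiffAt (hU.mem_nhds hxU))
  exact (h1.mpullback_vectorField_preimage (contMDiffAt_of_mem_maximalAtlas hc hx)
    (isInvertible_mfderiv (mdifferentiable_of_mem_maximalAtlas hc) hx)
    (by simp)).contMDiffWithinAt

theorem mlieBracket_chartField [IsManifold (𝓡 n) ∞ M]
    (hc : c ∈ IsManifold.maximalAtlas (𝓡 n) ∞ M) {v w : 𝔼 → 𝔼} {x : M} (hx : x ∈ c.source)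
    (hv : ContDiffAt ℝ ∞ v (c x)) (hw : ContDiffAt ℝ ∞ w (c x)) :
    mlieBracket (𝓡 n) (chartField c v) (chartField c w) x = chartField c (lieBracket ℝ v w) x := by
  have : IsManifold (𝓡 n) (minSmoothness ℝ 2) M := IsManifold.of_le minSmoothness_two_le
  have hmd : ∀ {v : 𝔼 → 𝔼}, ContDiffAt ℝ ∞ v (c x) → MDifferentiableAt (𝓡 n) (𝓡 n).tangent
      (fun y : 𝔼 => (⟨y, v y⟩ : TangentBundle (𝓡 n) 𝔼)) (c x) := fun h =>
    (contMDiffAt_vectorSpace_iff_contDiffAt.2 h).mdifferentiableAt (by simp)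
  have h := mpullback_mlieBracket (hmd hv) (hmd hw) (contMDiffAt_of_mem_maximalAtlas hc hx)
    minSmoothness_two_le
  exact h.symm.trans (congrArg (fun u : 𝔼 → 𝔼 => chartField c u x)
    (mlieBracket_eq_lieBracket (E := 𝔼) v w))

/-- Lie brackets are natural under pullback and `Θ` acts on pulled back fields through its
components, so the Nijenhuis expression is computed in coordinates. -/
theorem nijenhuis_chartField [IsManifold (𝓡 n) ∞ M] (hc : c ∈ IsManifold.maximalAtlas (𝓡 n) ∞ M)
    (hΘ : ContDiffOn ℝ ∞ (chartTensor c Θ) c.target)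
    {v w : 𝔼 → 𝔼} {x : M} (hx : x ∈ c.source) (hv : ContDiffAt ℝ ∞ v (c x))
    (hw : ContDiffAt ℝ ∞ w (c x)) :
    nijenhuis Θ (chartField c v) (chartField c w) x =
      chartField c (fun y => chartTensor c Θ y (lieBracket ℝ (fun y => chartTensor c Θ y (v y)) w y)
        + chartTensor c Θ y (lieBracket ℝ v (fun y => chartTensor c Θ y (w y)) y)
        - lieBracket ℝ (fun y => chartTensor c Θ y (v y)) (fun y => chartTensor c Θ y (w y)) y
        - chartTensor c Θ y (chartTensor c Θ y (lieBracket ℝ v w y))) x := by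
  have hcm := mdifferentiable_of_mem_maximalAtlas hc
  have happ : ∀ {v : 𝔼 → 𝔼}, ContDiffAt ℝ ∞ v (c x) →
      ContDiffAt ℝ ∞ (fun y => chartTensor c Θ y (v y)) (c x) := fun h =>
    (hΘ.contDiffAt (c.open_target.mem_nhds (c.map_source hx))).clm_apply h
  have hev : ∀ v : 𝔼 → 𝔼, (fun y => Θ y (chartField c v y)) =ᶠ[𝓝 x]
      chartField c (fun y => chartTensor c Θ y (v y)) := fun v => by
    filter_upwards [c.open_source.mem_nhds hx] with y hy using apply_chartField hcm hy v
  have hadd : ∀ a b : 𝔼 → 𝔼, chartField c a x + chartField c b x =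
      chartField c (fun y => a y + b y) x := fun a b => (map_add _ _ _).symm
  have hsub : ∀ a b : 𝔼 → 𝔼, chartField c a x - chartField c b x =
      chartField c (fun y => a y - b y) x := fun a b => (map_sub _ _ _).symm
  have e1 := ((hev v).mlieBracket_vectorField_eq .rfl).trans
    (mlieBracket_chartField hc hx (happ hv) hw)
  have e2 := (Filter.EventuallyEq.rfl.mlieBracket_vectorField_eq (hev w)).trans
    (mlieBracket_chartField hc hx hv (happ hw))
  have e3 := ((hev v).mlieBracket_vectorField_eq (hev w)).trans
    (mlieBracket_chartField hc hx (happ hv) (happ hw))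
  have e4 := mlieBracket_chartField hc hx hv hw
  have key : ∀ a b g l : TangentSpace (𝓡 n) x, ∀ a' b' g' l' : 𝔼 → 𝔼, a = chartField c a' x →
      b = chartField c b' x → g = chartField c g' x → l = chartField c l' x →
      Θ x a + Θ x b - g - Θ x (Θ x l) = chartField c (fun y => chartTensor c Θ y (a' y) +
        chartTensor c Θ y (b' y) - g' y - chartTensor c Θ y (chartTensor c Θ y (l' y))) x := by
    rintro _ _ _ _ a' b' g' l' rfl rfl rfl rfl
    simp only [apply_chartField hcm hx, hadd, hsub]
  exact key _ _ _ _ _ _ _ _ e1 e2 e3 e4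

theorem chartField_eq_zero_iff (hc : c.MDifferentiable (𝓡 n) (𝓡 n)) {x : M} (hx : x ∈ c.source)
    {v : 𝔼 → 𝔼} : chartField c v x = 0 ↔ v (c x) = 0 := by
  constructor
  · intro h
    have h1 := mfderiv_inverse_apply hc hx (v (c x))
    rw [← h1]
    exact (congrArg (fun u => mfderiv (𝓡 n) (𝓡 n) c x u) h).trans (map_zero _)
  · intro h
    exact (congrArg (fun u => (mfderiv (𝓡 n) (𝓡 n) c x).inverse u) h).trans (map_zero _)

theorem nijenhuisVanishesOn_chartTensor [IsManifold (𝓡 n) ∞ M]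
    (hc : c ∈ IsManifold.maximalAtlas (𝓡 n) ∞ M)
    (hΘ : ContDiffOn ℝ ∞ (chartTensor c Θ) c.target) (hN : NijenhuisVanishes Θ) :
    NijenhuisVanishesOn (chartTensor c Θ) c.target := by
  intro U hUc hU v w hv hw y hy
  have hcm := mdifferentiable_of_mem_maximalAtlas hc
  have hx := c.map_target (hUc hy)
  have hcx := c.right_inv (hUc hy)
  have h := hN _ (c.isOpen_inter_preimage hU) _ _ (isSmoothFieldOn_chartField hc hU hv)
    (isSmoothFieldOn_chartField hc hU hw) (c.symm y) ⟨hx, by rwa [mem_preimage, hcx]⟩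
  have hat : ∀ {v : 𝔼 → 𝔼}, ContDiffOn ℝ ∞ v U → ContDiffAt ℝ ∞ v (c (c.symm y)) := fun h => by
    rw [hcx]; exact h.contDiffAt (hU.mem_nhds hy)
  rw [nijenhuis_chartField hc hΘ hx (hat hv) (hat hw), chartField_eq_zero_iff hcm hx, hcx] at h
  exact h

/-- The components in the coordinates `c` of a vector field on `M`. -/
noncomputable def fieldComponents (c : OpenPartialHomeomorph M (EuclideanSpace ℝ (Fin n)))
    (v : ∀ x : M, TangentSpace (𝓡 n) x) (y : EuclideanSpace ℝ (Fin n)) :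
    EuclideanSpace ℝ (Fin n) :=
  mpullback (𝓡 n) (𝓡 n) c.symm v y

theorem contDiffOn_fieldComponents [IsManifold (𝓡 n) ∞ M]
    (hc : c ∈ IsManifold.maximalAtlas (𝓡 n) ∞ M) {v : ∀ x : M, TangentSpace (𝓡 n) x} {U : Set M}
    (hU : IsOpen U) (hv : IsSmoothFieldOn v U) :
    ContDiffOn ℝ ∞ (fieldComponents c v) (c.target ∩ c.symm ⁻¹' U) := by
  rintro y ⟨hy, hyU⟩
  have h1 := (hv.contMDiffAt (hU.mem_nhds hyU)).mpullback_vectorField_preimage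
    (contMDiffAt_symm_of_mem_maximalAtlas hc hy)
    ⟨(mdifferentiable_of_mem_maximalAtlas hc).symm.mfderiv hy, rfl⟩ (by simp)
  exact (contMDiffAt_vectorSpace_iff_contDiffAt.1 h1).contDiffWithinAt

theorem chartField_fieldComponents (hc : c.MDifferentiable (𝓡 n) (𝓡 n)) {x : M}
    (hx : x ∈ c.source) (v : ∀ x : M, TangentSpace (𝓡 n) x) :
    chartField c (fieldComponents c v) x = v x := by
  have key : ∀ y, y = x → (mfderiv (𝓡 n) (𝓡 n) c x).inverse
      (ContinuousLinearMap.inverse (mfderiv (𝓡 n) (𝓡 n) c.symm (c x) : 𝔼 →L[ℝ] 𝔼) (v y)) = v x := by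
    rintro y rfl
    have h2 : ContinuousLinearMap.inverse (mfderiv (𝓡 n) (𝓡 n) c.symm (c y) : 𝔼 →L[ℝ] 𝔼) =
        mfderiv (𝓡 n) (𝓡 n) c y :=
      ContinuousLinearMap.inverse_equiv (hc.mfderiv hx).symm
    rw [h2]
    exact inverse_mfderiv_apply hc hx (v y)
  exact key _ (c.left_inv hx)

/-- Every field is, near a point, the pullback of its own components, so it suffices to check N = 0
in charts. -/
theorem nijenhuisVanishes_of_chart [IsManifold (𝓡 n) ∞ M]
    (h : ∀ x : M, ∃ c ∈ IsManifold.maximalAtlas (𝓡 n) ∞ M, x ∈ c.source ∧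
      ContDiffOn ℝ ∞ (chartTensor c Θ) c.target ∧ NijenhuisVanishesOn (chartTensor c Θ) c.target) :
    NijenhuisVanishes Θ := by
  intro U hU v w hv hw x hxU
  obtain ⟨c, hc, hx, hΘ, hN⟩ := h x
  have hcm := mdifferentiable_of_mem_maximalAtlas hc
  have hev : ∀ v : ∀ x : M, TangentSpace (𝓡 n) x,
      v =ᶠ[𝓝 x] chartField c (fieldComponents c v) := fun v => by
    filter_upwards [c.open_source.mem_nhds hx] with y hy
    exact (chartField_fieldComponents hcm hy v).symm
  have hev' : ∀ v : ∀ x : M, TangentSpace (𝓡 n) x, (fun y => Θ y (v y)) =ᶠ[𝓝 x]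
      fun y => Θ y (chartField c (fieldComponents c v) y) := fun v =>
    (hev v).mono fun y hy => congrArg _ hy
  have hU' := c.symm.isOpen_inter_preimage hU
  have hcx : c x ∈ c.target ∩ c.symm ⁻¹' U :=
    ⟨c.map_source hx, by rwa [mem_preimage, c.left_inv hx]⟩
  have hv' := contDiffOn_fieldComponents hc hU hv
  have hw' := contDiffOn_fieldComponents hc hU hw
  have h1 : nijenhuis Θ v w x =
      nijenhuis Θ (chartField c (fieldComponents c v)) (chartField c (fieldComponents c w)) x := by
    unfold nijenhuis
    rw [(hev v).mlieBracket_vectorField_eq (hev w), (hev' v).mlieBracket_vectorField_eq (hev w),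
      (hev v).mlieBracket_vectorField_eq (hev' w), (hev' v).mlieBracket_vectorField_eq (hev' w)]
  rw [h1, nijenhuis_chartField hc hΘ hx (hv'.contDiffAt (hU'.mem_nhds hcx))
    (hw'.contDiffAt (hU'.mem_nhds hcx)), chartField_eq_zero_iff hcm hx]
  exact hN _ inter_subset_left hU' _ _ hv' hw' _ hcx

/-- The trivialisation of the Hom bundle at `x₀` is conjugation by the derivative of the chart, so
reading a section in it yields `chartTensor`. -/
theorem contMDiffOn_iff_contDiffOn_chartTensor [IsManifold (𝓡 n) ∞ M] (x₀ : M) :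
    ContMDiffOn (𝓡 n) ((𝓡 n).prod 𝓘(ℝ, EuclideanSpace ℝ (Fin n) →L[ℝ] EuclideanSpace ℝ (Fin n))) ∞
      (fun x : M => (⟨x, Θ x⟩ : Bundle.TotalSpace
        (EuclideanSpace ℝ (Fin n) →L[ℝ] EuclideanSpace ℝ (Fin n))
        (fun x : M => TangentSpace (𝓡 n) x →L[ℝ] TangentSpace (𝓡 n) x)))
      (chartAt (EuclideanSpace ℝ (Fin n)) x₀).source ↔
    ContDiffOn ℝ ∞ (chartTensor (chartAt (EuclideanSpace ℝ (Fin n)) x₀) Θ)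
      (chartAt (EuclideanSpace ℝ (Fin n)) x₀).target := by
  set c := chartAt (EuclideanSpace ℝ (Fin n)) x₀ with hcdef
  have hc : c ∈ IsManifold.maximalAtlas (𝓡 n) ∞ M := IsManifold.chart_mem_maximalAtlas x₀
  have hcm := mdifferentiable_of_mem_maximalAtlas hc
  have h1 := (trivializationAt (EuclideanSpace ℝ (Fin n) →L[ℝ] EuclideanSpace ℝ (Fin n))
    (fun x : M => TangentSpace (𝓡 n) x →L[ℝ] TangentSpace (𝓡 n) x) x₀).contMDiffOn_section_iff
    (IB := 𝓡 n) (n := ∞) (s := Θ) c.open_source (by simp [hcdef])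
  refine h1.trans ?_
  have h2 : ∀ x ∈ c.source, (trivializationAt (𝔼 →L[ℝ] 𝔼)
    (fun x : M => TangentSpace (𝓡 n) x →L[ℝ] TangentSpace (𝓡 n) x) x₀ ⟨x, Θ x⟩).2 =
      chartTensor c Θ (c x) := by
    intro x hx
    ext1 v
    obtain ⟨u, rfl⟩ : ∃ u : TangentSpace (𝓡 n) x, mfderiv (𝓡 n) (𝓡 n) c x u = v :=
      ⟨_, mfderiv_inverse_apply hcm hx v⟩
    refine Eq.trans ?_ (chartTensor_mfderiv hcm hx u).symm
    have h3 : (trivializationAt 𝔼 (TangentSpace (𝓡 n)) x₀).continuousLinearMapAt ℝ x =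
      mfderiv (𝓡 n) (𝓡 n) c x := TangentBundle.continuousLinearMapAt_trivializationAt hx
    have h4 : (trivializationAt 𝔼 (TangentSpace (𝓡 n)) x₀).symmL ℝ x
        ((trivializationAt 𝔼 (TangentSpace (𝓡 n)) x₀).continuousLinearMapAt ℝ x u) = u :=
      Bundle.Trivialization.symmL_continuousLinearMapAt _ hx u
    rw [h3] at h4
    exact (congrArg (fun u => (trivializationAt 𝔼 (TangentSpace (𝓡 n)) x₀).continuousLinearMapAt
      ℝ x (Θ x u)) h4).trans (congrArg (fun L : TangentSpace (𝓡 n) x →L[ℝ] 𝔼 => L (Θ x u)) h3)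
  have h3 : ContMDiffOn (𝓡 n) 𝓘(ℝ, 𝔼 →L[ℝ] 𝔼) ∞ (fun x => chartTensor c Θ (c x)) c.source ↔
      ContDiffOn ℝ ∞ (chartTensor c Θ) c.target := by
    rw [← contMDiffOn_iff_contDiffOn]
    constructor
    · intro h
      refine (h.comp (contMDiffOn_symm_of_mem_maximalAtlas hc) fun y hy => c.map_target hy).congr ?_
      intro y hy
      simp [c.right_inv hy]
    · intro h
      exact h.comp (contMDiffOn_of_mem_maximalAtlas hc) fun y hy => c.map_source hy
  rw [← h3]
  exact contMDiffOn_congr h2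

theorem isLocallyConstantTensor_of_blockCondition [IsManifold (𝓡 n) ∞ M] {m : ℕ} {d : Fin m → ℕ}
    (hd : BlockCondition d) (hΘ : IsSmoothTensor Θ) (hT : HasAlgebraicType d Θ)
    (hN : NijenhuisVanishes Θ) : IsLocallyConstantTensor Θ := by
  intro x₀
  set c := chartAt (EuclideanSpace ℝ (Fin n)) x₀ with hcdef
  have hc : c ∈ IsManifold.maximalAtlas (𝓡 n) ∞ M := IsManifold.chart_mem_maximalAtlas x₀
  have hcm := mdifferentiable_of_mem_maximalAtlas hc
  have hx₀ : x₀ ∈ c.source := mem_chart_source _ x₀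
  have hs : ContDiffOn ℝ ∞ (chartTensor c Θ) c.target :=
    (contMDiffOn_iff_contDiffOn_chartTensor x₀).1 hΘ.contMDiffOn
  have hD : ∀ x (hx : x ∈ c.source), ∃ L : TangentSpace (𝓡 n) x ≃ₗ[ℝ] 𝔼,
      ∀ v, L (Θ x v) = chartTensor c Θ (c x) (L v) := fun x hx =>
    ⟨(hcm.mfderiv hx).toLinearEquiv, fun v => (chartTensor_mfderiv hcm hx v).symm⟩
  obtain ⟨L₀, hL₀⟩ := hD x₀ hx₀
  obtain ⟨e, he1, he2⟩ := hT.2 x₀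
  have he : IsJordanBasis d (chartTensor c Θ (c x₀)) (e.map L₀) := by
    refine ⟨fun i k hk => ?_, fun i k l hl => ?_⟩
    · rw [Module.Basis.map_apply, ← hL₀]
      exact (congrArg L₀ (he1 i k hk)).trans (map_zero _)
    · rw [Module.Basis.map_apply, Module.Basis.map_apply, ← hL₀]
      exact congrArg L₀ (he2 i k l hl)
  have hconj : ∀ y ∈ c.target, ∃ F : 𝔼 ≃ₗ[ℝ] 𝔼,
      ∀ v, F (chartTensor c Θ y v) = chartTensor c Θ (c x₀) (F v) := by
    intro y hy
    obtain ⟨L, hL⟩ := hD _ (c.map_target hy)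
    rw [c.right_inv hy] at hL
    obtain ⟨F, hF⟩ := hT.1 (c.symm y) x₀
    refine ⟨(L.symm.trans F).trans L₀, fun v => ?_⟩
    obtain ⟨v, rfl⟩ := L.surjective v
    simp only [LinearEquiv.trans_apply, LinearEquiv.symm_apply_apply, ← hL, ← hL₀, hF]
  obtain ⟨φ, hφ₀, hφs, hφ, hφ', hφΘ⟩ := exists_flat_coordinates hd c.open_target hs
    (nijenhuisVanishesOn_chartTensor hc hs hN) (c.map_source hx₀) hconj he
  refine ⟨c.trans φ, ?_, ?_, chartTensor c Θ (c x₀), ?_⟩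
  · refine OpenPartialHomeomorph.mem_maximalAtlas_of_contMDiffOn _ ?_ ?_
    · refine (contMDiffOn_iff_contDiffOn.2 hφ).comp
        ((contMDiffOn_of_mem_maximalAtlas hc).mono ?_) ?_
      · exact fun x hx => hx.1
      · exact fun x hx => hx.2
    · refine (contMDiffOn_symm_of_mem_maximalAtlas hc).comp
        ((contMDiffOn_iff_contDiffOn.2 hφ').mono ?_) ?_
      · exact fun x hx => hx.1
      · exact fun x hx => hx.2
  · exact ⟨hx₀, hφ₀⟩
  · rintro x ⟨hx, hxφ⟩ v
    have h1 : MDifferentiableAt (𝓡 n) (𝓡 n) φ (c x) :=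
      ((hφ.contDiffAt (φ.open_source.mem_nhds hxφ)).differentiableAt (by simp)).mdifferentiableAt
    have h2 : ∀ v : TangentSpace (𝓡 n) x, mfderiv (𝓡 n) (𝓡 n) (c.trans φ) x v =
        fderiv ℝ φ (c x) (mfderiv (𝓡 n) (𝓡 n) c x v) := by
      intro v
      rw [← mfderiv_eq_fderiv]
      exact mfderiv_comp_apply x h1 (hcm.mdifferentiableAt hx) v
    rw [h2]
    refine Eq.trans ?_ (((hφΘ _ hxφ _).trans (congrArg _ (h2 v).symm)))
    exact congrArg (fun u => fderiv ℝ φ (c x) u) (chartTensor_mfderiv hcm hx v).symm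

end Chart

theorem BlockCondition.controlledByNijenhuis {n m : ℕ} {d : Fin m → ℕ} (hd : BlockCondition d) :
    ControlledByNijenhuis.{u} n d := by
  intro M _ _ _ _ _ _ Θ hΘ hT hN
  exact isLocallyConstantTensor_of_blockCondition hd hΘ hT hN

end NilpotentTensor

namespace NilpotentTensor
open Filter Topology VectorField

/-! ### Integrable distributions are involutive -/

section Involutive

variable {n : ℕ} {M : Type u} [TopologicalSpace M] [ChartedSpace (EuclideanSpace ℝ (Fin n)) M]
  [IsManifold (𝓡 n) ∞ M]

local notation "𝔼" => EuclideanSpace ℝ (Fin n)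

/-- The orthogonal projection of `f` to `Wᗮ` is locally zero, hence so is its derivative. -/
theorem fderiv_mem_of_eventually_mem {f : 𝔼 → 𝔼} {x : 𝔼} (hf : DifferentiableAt ℝ f x)
    {W : Submodule ℝ 𝔼} (hW : ∀ᶠ y in 𝓝 x, f y ∈ W) (u : 𝔼) : fderiv ℝ f x u ∈ W := by
  rw [← W.orthogonal_orthogonal, ← Submodule.starProjection_apply_eq_zero_iff]
  have h1 := (Wᗮ.starProjection.hasFDerivAt.comp x hf.hasFDerivAt).fderiv
  have h2 : (Wᗮ.starProjection ∘ f) =ᶠ[𝓝 x] fun _ => 0 := by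
    filter_upwards [hW] with y hy
    rw [Function.comp_apply, Submodule.starProjection_apply_eq_zero_iff, W.orthogonal_orthogonal]
    exact hy
  rw [h2.fderiv_eq, fderiv_fun_const] at h1
  exact (DFunLike.congr_fun h1 u).symm

/-- For flat coordinates F, dF[v, w] is the derivative of dF(w) along v minus that of dF(v) along w.
Both functions take values in the fixed subspace `W`, so their derivatives do too. -/
theorem IsIntegrableDistribution.lieBracket_mem {D : ∀ x : M, Submodule ℝ (TangentSpace (𝓡 n) x)}
    (hD : IsIntegrableDistribution D) {c : OpenPartialHomeomorph M 𝔼}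
    (hc : c ∈ IsManifold.maximalAtlas (𝓡 n) ∞ M) {x : M} (hx : x ∈ c.source) {v w : 𝔼 → 𝔼}
    (hv : DifferentiableAt ℝ v (c x)) (hw : DifferentiableAt ℝ w (c x))
    (hvD : ∀ᶠ y in 𝓝 x, chartField c v y ∈ D y) (hwD : ∀ᶠ y in 𝓝 x, chartField c w y ∈ D y) :
    chartField c (lieBracket ℝ v w) x ∈ D x := by
  obtain ⟨φ, hφ, hxφ, W, hW⟩ := hD x
  have hcm := mdifferentiable_of_mem_maximalAtlas hc
  have hφm := mdifferentiable_of_mem_maximalAtlas hφ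
  let F : 𝔼 → 𝔼 := fun y => φ (c.symm y)
  let O : Set 𝔼 := c.target ∩ c.symm ⁻¹' φ.source
  have hO : IsOpen O := c.symm.isOpen_inter_preimage φ.open_source
  have hF : ContDiffOn ℝ ∞ F O := contMDiffOn_iff_contDiffOn.1
    ((contMDiffOn_of_mem_maximalAtlas hφ).comp
      ((contMDiffOn_symm_of_mem_maximalAtlas hc).mono inter_subset_left) fun y hy => hy.2)
  have hcx : c x ∈ O := ⟨c.map_source hx, by rwa [mem_preimage, c.left_inv hx]⟩
  have hdF : ∀ y ∈ c.source, y ∈ φ.source → ∀ u : 𝔼 → 𝔼,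
      fderiv ℝ F (c y) (u (c y)) = mfderiv (𝓡 n) (𝓡 n) φ y (chartField c u y) := by
    intro y hy hyφ u
    have h1 : φ =ᶠ[𝓝 y] F ∘ c := by
      filter_upwards [c.open_source.mem_nhds hy] with z hz
      exact (congrArg φ (c.left_inv hz)).symm
    have hcy : c y ∈ O := ⟨c.map_source hy, by rwa [mem_preimage, c.left_inv hy]⟩
    have h2 : MDifferentiableAt (𝓡 n) (𝓡 n) F (c y) :=
      ((hF.contDiffAt (hO.mem_nhds hcy)).differentiableAt (by simp)).mdifferentiableAt
    have h3 : mfderiv (𝓡 n) (𝓡 n) φ y = mfderiv (𝓡 n) (𝓡 n) (F ∘ c) y := h1.mfderiv_eq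
    have h4 := mfderiv_comp_apply y h2 (hcm.mdifferentiableAt hy) (chartField c u y)
    have h5 := mfderiv_inverse_apply hcm hy (u (c y))
    have h6 : mfderiv (𝓡 n) (𝓡 n) F (c y) = fderiv ℝ F (c y) := mfderiv_eq_fderiv
    rw [h6] at h4
    refine Eq.trans ?_ (h4.symm.trans (DFunLike.congr_fun h3 (chartField c u y)).symm)
    exact (congrArg (fderiv ℝ F (c y)) h5).symm
  have hmem : ∀ {u : 𝔼 → 𝔼}, (∀ᶠ y in 𝓝 x, chartField c u y ∈ D y) →
      ∀ᶠ y in 𝓝 (c x), fderiv ℝ F y (u y) ∈ W := by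
    intro u hu
    have h1 : Tendsto c.symm (𝓝 (c x)) (𝓝 x) := by
      have := (c.symm.continuousAt (c.map_source hx)).tendsto
      rwa [c.left_inv hx] at this
    filter_upwards [h1.eventually hu, hO.mem_nhds hcx] with y hy hyO
    have h2 := hdF (c.symm y) (c.map_target hyO.1) hyO.2 u
    rw [c.right_inv hyO.1] at h2
    rw [h2]
    exact (hW _ hyO.2 _).1 hy
  have hFx := hF.contDiffAt (hO.mem_nhds hcx)
  have hdd : ∀ {u : 𝔼 → 𝔼}, DifferentiableAt ℝ u (c x) →
      DifferentiableAt ℝ (fun y => fderiv ℝ F y (u y)) (c x) := fun hu =>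
    ((hFx.fderiv_right (m := ∞) (by simp)).differentiableAt (by simp)).clm_apply hu
  refine (hW x hxφ _).2 ?_
  have h := fderiv_apply_lieBracket hFx minSmoothness_two_le hw hv
  rw [hdF x hx hxφ] at h
  rw [h]
  exact W.sub_mem (fderiv_mem_of_eventually_mem (hdd hw) (hmem hwD) _)
    (fderiv_mem_of_eventually_mem (hdd hv) (hmem hvD) _)

/-- Coordinates that make `Θ` a constant `A` turn Ker Θ^p into the constant subspace Ker A^p. -/
theorem IsLocallyConstantTensor.isIntegrableDistribution_kerPow
    {Θ : ∀ x : M, TangentSpace (𝓡 n) x →L[ℝ] TangentSpace (𝓡 n) x}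
    (h : IsLocallyConstantTensor Θ) (p : ℕ) : IsIntegrableDistribution (kerPow Θ p) := by
  intro x
  obtain ⟨φ, hφ, hx, A, hA⟩ := h x
  refine ⟨φ, hφ, hx, LinearMap.ker ((A : 𝔼 →ₗ[ℝ] 𝔼) ^ p), fun y hy v => ?_⟩
  have hφm := mdifferentiable_of_mem_maximalAtlas hφ
  have key : ∀ (j : ℕ) (v : TangentSpace (𝓡 n) y), mfderiv (𝓡 n) (𝓡 n) φ y
      (((Θ y : TangentSpace (𝓡 n) y →ₗ[ℝ] TangentSpace (𝓡 n) y) ^ j) v) =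
      ((A : 𝔼 →ₗ[ℝ] 𝔼) ^ j) (mfderiv (𝓡 n) (𝓡 n) φ y v) := by
    intro j
    induction j with
    | zero => exact fun v => rfl
    | succ j ih =>
      intro v
      rw [pow_succ, pow_succ]
      exact (ih (Θ y v)).trans (congrArg ((A : 𝔼 →ₗ[ℝ] 𝔼) ^ j) (hA y hy v))
  constructor
  · intro h
    exact (key p v).symm.trans ((congrArg (mfderiv (𝓡 n) (𝓡 n) φ y) h).trans (map_zero _))
  · intro h
    exact (hφm.mfderiv hy).injective
      (((key p v).trans h).trans (map_zero (mfderiv (𝓡 n) (𝓡 n) φ y)).symm)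

end Involutive
end NilpotentTensor

namespace NilpotentTensor
open Filter Topology VectorField

/-! ### Left-invariant tensors on two-step nilpotent groups -/

/-- A nilpotent operator `T` together with a rank one two-step nilpotent group law
`x * y = x + y + γ y • ψ x`, compatible in such a way that the left-invariant tensor extending `T`
has vanishing Nijenhuis tensor. -/
structure TwoStepData (n : ℕ) where
  T : EuclideanSpace ℝ (Fin n) →L[ℝ] EuclideanSpace ℝ (Fin n)
  ψ : EuclideanSpace ℝ (Fin n) →L[ℝ] EuclideanSpace ℝ (Fin n)
  γ : EuclideanSpace ℝ (Fin n) →L[ℝ] ℝ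
  ψ_ψ : ∀ v, ψ (ψ v) = 0
  γ_ψ : ∀ v, γ (ψ v) = 0
  γ_T : ∀ v, γ (T v) = 0
  T_ψ_T : ∀ v, T (ψ (T v)) = T (T (ψ v))
  ψ_T_ψ : ∀ v, ψ (T (ψ v)) = 0

/-- The group with underlying manifold `ℝⁿ` and product `x * y = x + y + γ y • ψ x`. -/
structure TwoStepGroup {n : ℕ} (D : TwoStepData n) : Type u where
  up ::
  /-- The coordinates of a group element. -/
  down : EuclideanSpace ℝ (Fin n)

namespace TwoStepGroup

variable {n : ℕ} {D : TwoStepData n}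

local notation "𝔼" => EuclideanSpace ℝ (Fin n)

theorem down_injective : Function.Injective (down : TwoStepGroup.{u} D → 𝔼) := by
  rintro ⟨x⟩ ⟨y⟩ h
  exact congrArg up h

noncomputable instance : Group (TwoStepGroup.{u} D) where
  mul x y := ⟨x.down + y.down + D.γ y.down • D.ψ x.down⟩
  one := ⟨0⟩
  inv x := ⟨-x.down + D.γ x.down • D.ψ x.down⟩
  mul_assoc x y z := by
    refine down_injective ?_
    change x.down + y.down + D.γ y.down • D.ψ x.down + z.down +
      D.γ z.down • D.ψ (x.down + y.down + D.γ y.down • D.ψ x.down) =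
      x.down + (y.down + z.down + D.γ z.down • D.ψ y.down) +
      D.γ (y.down + z.down + D.γ z.down • D.ψ y.down) • D.ψ x.down
    simp only [map_add, map_smul, D.ψ_ψ, D.γ_ψ, smul_zero, add_zero, smul_add, add_smul]
    abel
  one_mul x := by
    refine down_injective ?_
    change 0 + x.down + D.γ x.down • D.ψ 0 = x.down
    simp
  mul_one x := by
    refine down_injective ?_
    change x.down + 0 + D.γ 0 • D.ψ x.down = x.down
    simp
  inv_mul_cancel x := by
    refine down_injective ?_
    change -x.down + D.γ x.down • D.ψ x.down + x.down +
      D.γ x.down • D.ψ (-x.down + D.γ x.down • D.ψ x.down) = 0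
    simp [D.ψ_ψ]

theorem down_mul (x y : TwoStepGroup.{u} D) :
    (x * y).down = x.down + y.down + D.γ y.down • D.ψ x.down := rfl

theorem down_inv (x : TwoStepGroup.{u} D) :
    (x⁻¹).down = -x.down + D.γ x.down • D.ψ x.down := rfl

theorem down_commutator (x y : TwoStepGroup.{u} D) :
    (x * y * x⁻¹ * y⁻¹).down = D.γ y.down • D.ψ x.down - D.γ x.down • D.ψ y.down := by
  simp only [down_mul, down_inv, map_add, map_smul, map_neg, D.ψ_ψ, D.γ_ψ,
    smul_zero, add_zero, smul_add, smul_neg, neg_smul, smul_eq_mul, mul_zero]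
  abel

/-- Commutators lie in the image of ψ, where both γ and ψ vanish, so they are central. -/
theorem upperCentralSeries_two : Subgroup.upperCentralSeries (TwoStepGroup.{u} D) 2 = ⊤ := by
  rw [eq_top_iff]
  intro x _
  rw [Subgroup.mem_upperCentralSeries_succ_iff]
  intro y
  change x * y * x⁻¹ * y⁻¹ ∈ _
  rw [Subgroup.upperCentralSeries_one, Subgroup.mem_center_iff]
  intro z
  refine down_injective ?_
  rw [down_mul z, down_mul _ z, down_commutator]
  simp [D.ψ_ψ, D.γ_ψ, add_comm]

instance : Group.IsNilpotent (TwoStepGroup.{u} D) := ⟨2, upperCentralSeries_two⟩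

theorem nilpotencyClass_eq_two {x y : 𝔼} (h : D.γ y • D.ψ x ≠ D.γ x • D.ψ y) :
    Group.nilpotencyClass (TwoStepGroup.{u} D) = 2 := by
  refine le_antisymm
    (Subgroup.upperCentralSeries_eq_top_iff_nilpotencyClass_le.1 upperCentralSeries_two) ?_
  by_contra! hlt
  have h1 := Subgroup.upperCentralSeries_eq_top_iff_nilpotencyClass_le.2 (Nat.le_of_lt_succ hlt)
  have h2 : (⟨y⟩ : TwoStepGroup.{u} D) ∈ Subgroup.center (TwoStepGroup.{u} D) := by
    rw [← Subgroup.upperCentralSeries_one, h1]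
    exact Subgroup.mem_top _
  have h3 := congrArg down (Subgroup.mem_center_iff.1 h2 ⟨x⟩)
  rw [down_mul, down_mul] at h3
  simp only [add_comm y x] at h3
  exact h (add_left_cancel h3)

instance : TopologicalSpace (TwoStepGroup.{u} D) := .induced down inferInstance

/-- The global chart. -/
noncomputable def coord : TwoStepGroup.{u} D ≃ₜ EuclideanSpace ℝ (Fin n) where
  toFun := down
  invFun := up
  left_inv _ := rfl
  right_inv _ := rfl
  continuous_toFun := continuous_induced_dom
  continuous_invFun := continuous_induced_rng.2 continuous_id

instance : T2Space (TwoStepGroup.{u} D) := coord.symm.t2Space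

instance : SecondCountableTopology (TwoStepGroup.{u} D) := coord.secondCountableTopology

instance : ConnectedSpace (TwoStepGroup.{u} D) :=
  coord.symm.surjective.connectedSpace coord.symm.continuous

/-- The global chart as an open partial homeomorphism. -/
noncomputable def chart : OpenPartialHomeomorph (TwoStepGroup.{u} D) (EuclideanSpace ℝ (Fin n)) :=
  coord.toOpenPartialHomeomorph

noncomputable instance : ChartedSpace (EuclideanSpace ℝ (Fin n)) (TwoStepGroup.{u} D) :=
  chart.singletonChartedSpace rfl

instance : IsManifold (𝓡 n) ∞ (TwoStepGroup.{u} D) where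
  __ := chart.singleton_hasGroupoid rfl (contDiffGroupoid ∞ (𝓡 n))

theorem chart_mem_maximalAtlas :
    chart ∈ IsManifold.maximalAtlas (𝓡 n) ∞ (TwoStepGroup.{u} D) :=
  IsManifold.chart_mem_maximalAtlas (1 : TwoStepGroup.{u} D)

theorem contMDiff_down : ContMDiff (𝓡 n) (𝓡 n) ∞ (down : TwoStepGroup.{u} D → 𝔼) :=
  contMDiffOn_univ.1 (contMDiffOn_of_mem_maximalAtlas chart_mem_maximalAtlas)

theorem contMDiff_up : ContMDiff (𝓡 n) (𝓡 n) ∞ (up : 𝔼 → TwoStepGroup.{u} D) :=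
  contMDiffOn_univ.1 (contMDiffOn_symm_of_mem_maximalAtlas chart_mem_maximalAtlas)

instance : LieGroup (𝓡 n) ∞ (TwoStepGroup.{u} D) where
  contMDiff_mul := by
    have h : ContDiff ℝ ∞ fun p : 𝔼 × 𝔼 => p.1 + p.2 + D.γ p.2 • D.ψ p.1 := by fun_prop
    refine contMDiff_up.comp ?_
    exact h.contMDiff.comp ((contMDiff_down.comp contMDiff_fst).prodMk_space
      (contMDiff_down.comp contMDiff_snd))
  contMDiff_inv := by
    have h : ContDiff ℝ ∞ fun p : 𝔼 => -p + D.γ p • D.ψ p := by fun_prop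
    exact contMDiff_up.comp (h.contMDiff.comp contMDiff_down)

end TwoStepGroup

/-! ### The invariant frame and tensor in global coordinates -/

namespace TwoStepData

variable {n : ℕ} (D : TwoStepData n)

local notation "𝔼" => EuclideanSpace ℝ (Fin n)

/-- The left-invariant tensor with value `T` at the unit element, in coordinates. -/
noncomputable def tensorAt (y : EuclideanSpace ℝ (Fin n)) :
    EuclideanSpace ℝ (Fin n) →L[ℝ] EuclideanSpace ℝ (Fin n) :=
  D.T - D.γ.smulRight (D.T (D.ψ y))

theorem tensorAt_apply (y v : 𝔼) : D.tensorAt y v = D.T v - D.γ v • D.T (D.ψ y) := rfl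

theorem contDiff_tensorAt : ContDiff ℝ ∞ D.tensorAt := by
  have h : ContDiff ℝ ∞ fun y => ContinuousLinearMap.smulRightL ℝ 𝔼 𝔼 D.γ (D.T (D.ψ y)) := by
    fun_prop
  exact contDiff_const.sub h

/-- The left-invariant frame: the derivative at the unit element of a left translation. -/
noncomputable def frameAt (y : EuclideanSpace ℝ (Fin n)) :
    EuclideanSpace ℝ (Fin n) ≃ₗ[ℝ] EuclideanSpace ℝ (Fin n) where
  toFun v := v + D.γ v • D.ψ y
  invFun v := v - D.γ v • D.ψ y
  map_add' v w := by simp only [map_add, add_smul]; abel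
  map_smul' a v := by simp only [map_smul, smul_add, smul_eq_mul, mul_smul, RingHom.id_apply]
  left_inv v := by simp [D.γ_ψ]
  right_inv v := by simp [D.γ_ψ]

theorem frameAt_apply (y v : 𝔼) : D.frameAt y v = v + D.γ v • D.ψ y := rfl

theorem tensorAt_frameAt (y v : 𝔼) : D.tensorAt y (D.frameAt y v) = D.frameAt y (D.T v) := by
  simp [frameAt_apply, tensorAt_apply, D.γ_T, D.γ_ψ]

/-- On left-invariant fields a, b the bracket is γ(b)ψa - γ(a)ψb. Since γT = 0, N(a, b) is γ(b)(TψT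
- T²ψ)a - γ(a)(TψT - T²ψ)b, which vanishes. For arbitrary fields the derivative terms cancel. -/
theorem nijenhuisVanishesOn_tensorAt : NijenhuisVanishesOn D.tensorAt univ := by
  intro U _ hU v w hv hw x hx
  have hdv : ∀ {v : 𝔼 → 𝔼}, ContDiffOn ℝ ∞ v U → HasFDerivAt v (fderiv ℝ v x) x := fun h =>
    ((h.contDiffAt (hU.mem_nhds hx)).differentiableAt (by simp)).hasFDerivAt
  have hΘv : ∀ {v : 𝔼 → 𝔼}, ContDiffOn ℝ ∞ v U → ∀ a, fderiv ℝ (fun y => D.tensorAt y (v y)) x a =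
      D.tensorAt x (fderiv ℝ v x a) - D.γ (v x) • D.T (D.ψ a) := by
    intro v hv a
    have h1 : HasFDerivAt (fun y => D.T (v y) - D.γ (v y) • D.T (D.ψ y)) _ x :=
      (D.T.hasFDerivAt.comp x (hdv hv)).sub ((D.γ.hasFDerivAt.comp x (hdv hv)).smul
        ((D.T ∘L D.ψ).hasFDerivAt (x := x)))
    have h2 : (fun y => D.tensorAt y (v y)) = fun y => D.T (v y) - D.γ (v y) • D.T (D.ψ y) := rfl
    rw [h2, h1.fderiv]
    simp [tensorAt_apply]
    abel
  simp only [lieBracket, hΘv hv, hΘv hw]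
  simp only [tensorAt_apply, map_sub, map_smul, D.γ_T, D.T_ψ_T, D.ψ_T_ψ, smul_sub,
    zero_smul, smul_zero, sub_zero]
  abel

theorem frameAt_tensorAt (g y v : 𝔼) :
    D.frameAt g (D.tensorAt y v) = D.tensorAt (g + y + D.γ y • D.ψ g) (D.frameAt g v) := by
  simp only [frameAt_apply, tensorAt_apply, map_add, map_sub, map_smul, D.γ_T, D.γ_ψ, D.ψ_ψ,
    smul_zero, smul_add, add_zero, sub_zero, zero_smul]
  abel

theorem frameAt_zero (v : 𝔼) : D.frameAt 0 v = v := by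
  simp [frameAt_apply]

theorem lieBracket_frameAt (a b x : 𝔼) :
    lieBracket ℝ (fun y => D.frameAt y a) (fun y => D.frameAt y b) x =
      D.γ b • D.ψ a - D.γ a • D.ψ b := by
  have h : ∀ a, HasFDerivAt (fun y => D.frameAt y a) (D.γ a • D.ψ) x := fun a =>
    (D.ψ.hasFDerivAt.const_smul (D.γ a)).const_add a
  rw [lieBracket, (h a).fderiv, (h b).fderiv]
  simp [frameAt_apply, D.ψ_ψ]

end TwoStepData

/-! ### The left-invariant tensor on the group -/

namespace TwoStepGroup

variable {n : ℕ} {D : TwoStepData n}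

local notation "𝔼" => EuclideanSpace ℝ (Fin n)

/-- The left-invariant tensor on `TwoStepGroup D` with value `D.T` at the unit element. -/
noncomputable def tensor (x : TwoStepGroup.{u} D) :
    TangentSpace (𝓡 n) x →L[ℝ] TangentSpace (𝓡 n) x :=
  (mfderiv (𝓡 n) (𝓡 n) (chart : OpenPartialHomeomorph (TwoStepGroup.{u} D) _) x).inverse.comp
    (ContinuousLinearMap.comp (M₂ := TangentSpace (𝓡 n) (chart x)) (D.tensorAt x.down)
      (mfderiv (𝓡 n) (𝓡 n) (chart : OpenPartialHomeomorph (TwoStepGroup.{u} D) _) x))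

theorem mdifferentiable_chart : (chart : OpenPartialHomeomorph (TwoStepGroup.{u} D) 𝔼).MDifferentiable
    (𝓡 n) (𝓡 n) :=
  mdifferentiable_of_mem_maximalAtlas chart_mem_maximalAtlas

theorem mfderiv_tensor (x : TwoStepGroup.{u} D) (v : TangentSpace (𝓡 n) x) :
    mfderiv (𝓡 n) (𝓡 n) chart x (tensor x v) =
      D.tensorAt x.down (mfderiv (𝓡 n) (𝓡 n) chart x v) :=
  mfderiv_inverse_apply mdifferentiable_chart (mem_univ x) _

theorem chartTensor_tensor : chartTensor chart (tensor (D := D)) = D.tensorAt := by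
  funext y
  ext1 v
  obtain ⟨u, rfl⟩ : ∃ u : TangentSpace (𝓡 n) (up y : TwoStepGroup D),
    mfderiv (𝓡 n) (𝓡 n) chart (up y : TwoStepGroup D) u = v :=
      ⟨_, mfderiv_inverse_apply mdifferentiable_chart (mem_univ (up y)) v⟩
  exact (chartTensor_mfderiv mdifferentiable_chart (mem_univ (up y)) u).trans (mfderiv_tensor _ u)

theorem isSmoothTensor_tensor : IsSmoothTensor (tensor (D := D)) := by
  have h := (contMDiffOn_iff_contDiffOn_chartTensor (Θ := tensor (D := D)) 1).2 (by
    refine ContDiff.contDiffOn (?_ : ContDiff ℝ ∞ (chartTensor chart tensor))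
    rw [chartTensor_tensor]
    exact D.contDiff_tensorAt)
  exact contMDiffOn_univ.1 h

theorem nijenhuisVanishes_tensor : NijenhuisVanishes (tensor (D := D)) := by
  refine nijenhuisVanishes_of_chart fun x => ⟨chart, chart_mem_maximalAtlas, mem_univ x, ?_, ?_⟩
  · rw [chartTensor_tensor]
    exact D.contDiff_tensorAt.contDiffOn
  · rw [chartTensor_tensor]
    exact D.nijenhuisVanishesOn_tensorAt

/-- Each tangent space of `TwoStepGroup D`, seen as the tangent space at the unit element. -/
noncomputable def toModel (x : TwoStepGroup.{u} D) :
    TangentSpace (𝓡 n) x ≃ₗ[ℝ] EuclideanSpace ℝ (Fin n) :=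
  (mdifferentiable_chart.mfderiv (mem_univ x)).toLinearEquiv.trans (D.frameAt x.down).symm

theorem toModel_tensor (x : TwoStepGroup.{u} D) (v : TangentSpace (𝓡 n) x) :
    toModel x (tensor x v) = D.T (toModel x v) := by
  refine (LinearEquiv.symm_apply_eq (D.frameAt x.down)).2 ?_
  rw [← D.tensorAt_frameAt]
  refine (mfderiv_tensor x v).trans (congrArg (D.tensorAt x.down) ?_)
  exact ((D.frameAt x.down).apply_symm_apply _).symm

theorem hasAlgebraicType_tensor {m : ℕ} {d : Fin m → ℕ} (h : HasJordanForm d (D.T : 𝔼 →ₗ[ℝ] 𝔼)) :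
    HasAlgebraicType d (tensor (D := D)) := by
  constructor
  · intro x y
    refine ⟨(toModel x).trans (toModel y).symm, fun v => (toModel y).injective ?_⟩
    rw [toModel_tensor]
    simp [toModel_tensor]
  · intro x
    obtain ⟨e, h1, h2⟩ := h
    refine ⟨e.map (toModel x).symm, fun i k hk => (toModel x).injective ?_,
      fun i k l hl => (toModel x).injective ?_⟩
    · refine (toModel_tensor x _).trans ?_
      simpa using h1 i k hk
    · refine (toModel_tensor x _).trans ?_
      simpa using h2 i k l hl

theorem isLeftInvariant_tensor : IsLeftInvariant (tensor (D := D)) := by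
  intro g x v
  have hl : ∀ y, HasFDerivAt (fun y : 𝔼 => g.down + y + D.γ y • D.ψ g.down)
      (ContinuousLinearMap.id ℝ 𝔼 + D.γ.smulRight (D.ψ g.down)) y := fun y =>
    ((hasFDerivAt_id y).const_add g.down).add (D.γ.hasFDerivAt.smul_const (D.ψ g.down))
  have hL : MDifferentiableAt (𝓡 n) (𝓡 n) (fun y : TwoStepGroup D => g * y) x :=
    (contMDiff_mul_left (I := 𝓡 n) (n := ∞) (a := g)).mdifferentiableAt (by simp)
  have key : ∀ u : TangentSpace (𝓡 n) x, mfderiv (𝓡 n) (𝓡 n) chart (g * x)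
      (mfderiv (𝓡 n) (𝓡 n) (fun y : TwoStepGroup D => g * y) x u) =
      D.frameAt g.down (mfderiv (𝓡 n) (𝓡 n) chart x u) := by
    intro u
    have h1 := mfderiv_comp_apply x (mdifferentiable_chart.mdifferentiableAt (mem_univ (g * x))) hL u
    have h2 := mfderiv_comp_apply x (hl (chart x)).differentiableAt.mdifferentiableAt
      (mdifferentiable_chart.mdifferentiableAt (mem_univ x)) u
    rw [mfderiv_eq_fderiv, (hl _).fderiv] at h2
    exact h1.symm.trans h2
  refine (mdifferentiable_chart.mfderiv (mem_univ (g * x))).injective ?_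
  refine (key _).trans (Eq.trans ?_ (mfderiv_tensor (g * x) _).symm)
  rw [key]
  exact (congrArg (D.frameAt g.down) (mfderiv_tensor x v)).trans (D.frameAt_tensorAt _ _ _)

theorem mem_kerPow_tensor {p : ℕ} {x : TwoStepGroup.{u} D} {v : TangentSpace (𝓡 n) x} :
    v ∈ kerPow tensor p x ↔ ((D.T : 𝔼 →ₗ[ℝ] 𝔼) ^ p) (toModel x v) = 0 := by
  have h : ∀ v : TangentSpace (𝓡 n) x,
      toModel x (((tensor x : TangentSpace (𝓡 n) x →ₗ[ℝ] TangentSpace (𝓡 n) x) ^ p) v) =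
      ((D.T : 𝔼 →ₗ[ℝ] 𝔼) ^ p) (toModel x v) := by
    induction p with
    | zero => exact fun v => rfl
    | succ p ih =>
      intro v
      rw [pow_succ, pow_succ]
      exact (ih (tensor x v)).trans
        (congrArg ((D.T : 𝔼 →ₗ[ℝ] 𝔼) ^ p) (toModel_tensor x v))
  rw [← h, LinearEquiv.map_eq_zero_iff]
  rfl

/-- The left-invariant fields through `a` and `b` lie in the distribution everywhere, but their
bracket leaves it at the unit element. -/
theorem not_isIntegrableDistribution_kerPow {p : ℕ} {a b : 𝔼}
    (ha : ((D.T : 𝔼 →ₗ[ℝ] 𝔼) ^ p) a = 0) (hb : ((D.T : 𝔼 →ₗ[ℝ] 𝔼) ^ p) b = 0)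
    (hab : ((D.T : 𝔼 →ₗ[ℝ] 𝔼) ^ p) (D.γ b • D.ψ a - D.γ a • D.ψ b) ≠ 0) :
    ¬ IsIntegrableDistribution (kerPow (tensor (D := D)) p) := by
  intro h
  have hmodel : ∀ (x : TwoStepGroup D) (v : 𝔼 → 𝔼), toModel x (chartField chart v x) =
      (D.frameAt x.down).symm (v x.down) := fun x v =>
    congrArg (D.frameAt x.down).symm (mfderiv_inverse_apply mdifferentiable_chart (mem_univ x) _)
  have hmem : ∀ a, ((D.T : 𝔼 →ₗ[ℝ] 𝔼) ^ p) a = 0 → ∀ x : TwoStepGroup D,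
      chartField chart (fun y => D.frameAt y a) x ∈ kerPow tensor p x := by
    intro a ha x
    rw [mem_kerPow_tensor, hmodel, LinearEquiv.symm_apply_apply, ha]
  have hdiff : ∀ a x, DifferentiableAt ℝ (fun y => D.frameAt y a) x := fun a x =>
    ((D.ψ.hasFDerivAt.const_smul (D.γ a)).const_add a).differentiableAt
  have h1 := h.lieBracket_mem chart_mem_maximalAtlas (mem_univ (1 : TwoStepGroup D)) (hdiff a _)
    (hdiff b _) (.of_forall (hmem a ha)) (.of_forall (hmem b hb))
  have h2 : ∀ z, (D.frameAt (1 : TwoStepGroup D).down).symm z = z := fun z =>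
    (LinearEquiv.symm_apply_eq _).2 (D.frameAt_zero z).symm
  rw [mem_kerPow_tensor, hmodel, D.lieBracket_frameAt, h2] at h1
  exact hab h1

end TwoStepGroup
end NilpotentTensor

namespace NilpotentTensor

/-! ### Block lengths violating the block condition -/

/-- Let `k` be a shortest block. If every other block had maximal length, the block condition would
hold; so some `j ≠ k` is shorter than a longest block `i`. -/
theorem exists_indices_of_not_blockCondition {m : ℕ} (hm : 0 < m) {d : Fin m → ℕ}
    (h : ¬ BlockCondition d) :
    ∃ i j k, d j < d i ∧ k ≠ j ∧ IsLeast (range d) (d k) := by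
  have : Nonempty (Fin m) := ⟨⟨0, hm⟩⟩
  obtain ⟨k, hk⟩ := Finite.exists_min d
  obtain ⟨i, hi⟩ := Finite.exists_max d
  by_contra! hne
  have hk' : IsLeast (range d) (d k) := ⟨mem_range_self k, by rintro _ ⟨j, rfl⟩; exact hk j⟩
  have hj : ∀ j, j ≠ k → d j = d i := fun j hj => by
    by_contra hji
    exact hne i j k (lt_of_le_of_ne (hi j) hji) hj.symm hk'
  by_cases hki : d k = d i
  · exact h (.inl ⟨d i, fun j => (em (j = k)).elim (fun h => h ▸ hki) (hj j)⟩)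
  · refine h (.inr ⟨d i, d k, lt_of_le_of_ne (hk i) hki, fun j => ?_, ⟨i, rfl⟩, k, rfl, ?_⟩)
    · exact (em (j = k)).elim (fun h => .inr (h ▸ rfl)) fun h => .inl (hj j h)
    · intro j hjk
      by_contra h
      exact hki (hjk.symm.trans (hj j h))

section Example

variable {n m : ℕ} {d : Fin m → ℕ}

local notation "𝔼" => EuclideanSpace ℝ (Fin n)

variable (e : Module.Basis (Σ i : Fin m, Fin (d i)) ℝ (EuclideanSpace ℝ (Fin n)))

/-- The nilpotent operator with Jordan basis `e`. -/
noncomputable def jordanOperator : EuclideanSpace ℝ (Fin n) →L[ℝ] EuclideanSpace ℝ (Fin n) :=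
  LinearMap.toContinuousLinearMap <| e.constr ℝ fun s =>
    if (s.2 : ℕ) = 0 then 0 else e ⟨s.1, s.2 - 1, (Nat.sub_le _ _).trans_lt s.2.2⟩

theorem jordanOperator_zero {i : Fin m} {k : ℕ} (hk : k < d i) (h0 : k = 0) :
    jordanOperator e (e ⟨i, k, hk⟩) = 0 :=
  (e.constr_basis ℝ _ _).trans (if_pos h0)

theorem jordanOperator_succ {i : Fin m} {k : ℕ} (hk : k + 1 < d i) :
    jordanOperator e (e ⟨i, k + 1, hk⟩) = e ⟨i, k, (Nat.lt_succ_self k).trans hk⟩ :=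
  (e.constr_basis ℝ _ _).trans (if_neg (Nat.succ_ne_zero k))

theorem hasJordanForm_jordanOperator : HasJordanForm d (jordanOperator e : 𝔼 →ₗ[ℝ] 𝔼) := by
  refine ⟨e, fun i k hk => jordanOperator_zero e k.2 hk, ?_⟩
  rintro i ⟨k, hk⟩ ⟨l, hl⟩ (rfl : l = k + 1)
  exact jordanOperator_succ e hl

theorem jordanOperator_pow {i : Fin m} {k : ℕ} (p : ℕ) (hk : k + p < d i) :
    ((jordanOperator e : 𝔼 →ₗ[ℝ] 𝔼) ^ p) (e ⟨i, k + p, hk⟩) =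
      e ⟨i, k, (Nat.le_add_right k p).trans_lt hk⟩ := by
  induction p with
  | zero => rfl
  | succ p ih =>
    rw [pow_succ]
    exact (congrArg ((jordanOperator e : 𝔼 →ₗ[ℝ] 𝔼) ^ p) (jordanOperator_succ e hk)).trans (ih _)

theorem jordanOperator_pow_eq_zero {i : Fin m} {k : ℕ} (hk : k < d i) :
    ((jordanOperator e : 𝔼 →ₗ[ℝ] 𝔼) ^ (k + 1)) (e ⟨i, k, hk⟩) = 0 := by
  have h := jordanOperator_pow e k (k := 0) (i := i) (by rwa [zero_add])
  simp only [zero_add] at h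
  rw [pow_succ', Module.End.mul_apply, h]
  exact jordanOperator_zero e _ rfl

/-- The operator raising the block `j` into the longer block `i`. -/
noncomputable def blockShift {i j : Fin m} (hij : d j < d i) :
    EuclideanSpace ℝ (Fin n) →L[ℝ] EuclideanSpace ℝ (Fin n) :=
  LinearMap.toContinuousLinearMap <| e.constr ℝ fun s =>
    if h : s.1 = j then e ⟨i, s.2 + 1, lt_of_le_of_lt (by rw [← h]; exact s.2.2) hij⟩ else 0

theorem blockShift_apply {i j : Fin m} (hij : d j < d i) {k : ℕ} (hk : k < d j) :
    blockShift e hij (e ⟨j, k, hk⟩) = e ⟨i, k + 1, lt_of_le_of_lt hk hij⟩ :=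
  (e.constr_basis ℝ _ _).trans (dif_pos rfl)

theorem blockShift_apply_of_ne {i j : Fin m} (hij : d j < d i) {l : Fin m} (hl : l ≠ j) {k : ℕ}
    (hk : k < d l) : blockShift e hij (e ⟨l, k, hk⟩) = 0 :=
  (e.constr_basis ℝ _ _).trans (dif_neg hl)

theorem eq_of_forall_basis {W : Type*} [AddCommGroup W] [Module ℝ W] {f g : 𝔼 →ₗ[ℝ] W}
    (h : ∀ i k (hk : k < d i), f (e ⟨i, k, hk⟩) = g (e ⟨i, k, hk⟩)) (v : 𝔼) : f v = g v :=
  DFunLike.congr_fun (e.ext fun s => h s.1 s.2 s.2.2 : f = g) v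

/-- The two-step nilpotent group law associated with two blocks of lengths `d j < d i` and a
third block `k`. -/
noncomputable def blockData {i j k : Fin m} (hij : d j < d i) (hki : k ≠ i) (hd : 0 < d k) :
    TwoStepData n where
  T := jordanOperator e
  ψ := blockShift e hij
  -- The top coordinate of a block vanishes on the image of `T`. As `k ≠ i`, it also vanishes on
  -- block `i`, which contains the image of ψ.
  γ := LinearMap.toContinuousLinearMap (e.coord ⟨k, d k - 1, Nat.sub_lt hd one_pos⟩)
  ψ_ψ := eq_of_forall_basis e (f := (blockShift e hij ∘L blockShift e hij : 𝔼 →ₗ[ℝ] 𝔼)) (g := 0)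
    fun l s hs => by
      change blockShift e hij (blockShift e hij (e ⟨l, s, hs⟩)) = 0
      have hne : i ≠ j := fun h => hij.ne (h ▸ rfl)
      obtain rfl | hl := eq_or_ne l j
      · rw [blockShift_apply e hij hs, blockShift_apply_of_ne e hij hne]
      · rw [blockShift_apply_of_ne e hij hl hs, map_zero]
  γ_ψ := eq_of_forall_basis e (g := 0)
    (f := (e.coord ⟨k, d k - 1, Nat.sub_lt hd one_pos⟩) ∘ₗ (blockShift e hij : 𝔼 →ₗ[ℝ] 𝔼))
    fun l s hs => by
      change e.coord _ (blockShift e hij (e ⟨l, s, hs⟩)) = 0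
      obtain rfl | hl := eq_or_ne l j
      · rw [blockShift_apply e hij hs]
        simp [hki.symm]
      · rw [blockShift_apply_of_ne e hij hl hs, map_zero]
  γ_T := eq_of_forall_basis e (g := 0)
    (f := (e.coord ⟨k, d k - 1, Nat.sub_lt hd one_pos⟩) ∘ₗ (jordanOperator e : 𝔼 →ₗ[ℝ] 𝔼))
    fun l s hs => by
      change e.coord _ (jordanOperator e (e ⟨l, s, hs⟩)) = 0
      obtain _ | s := s
      · rw [jordanOperator_zero e hs rfl, map_zero]
      · rw [jordanOperator_succ e hs]
        obtain rfl | hl := eq_or_ne l k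
        · have : s ≠ d l - 1 := by omega
          simp [this]
        · simp [hl]
  T_ψ_T := eq_of_forall_basis e
    (f := (jordanOperator e ∘L blockShift e hij ∘L jordanOperator e : 𝔼 →ₗ[ℝ] 𝔼))
    (g := (jordanOperator e ∘L jordanOperator e ∘L blockShift e hij : 𝔼 →ₗ[ℝ] 𝔼))
    fun l s hs => by
      change jordanOperator e (blockShift e hij (jordanOperator e (e ⟨l, s, hs⟩))) =
        jordanOperator e (jordanOperator e (blockShift e hij (e ⟨l, s, hs⟩)))
      obtain rfl | hl := eq_or_ne l j
      · rw [blockShift_apply e hij hs, jordanOperator_succ]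
        -- At the bottom of block `j` the left side is 0, and ψ lands at position 1 of block `i`,
        -- which T² kills. This is why ψ raises the position by exactly one although Tψ and ψT
        -- differ there.
        obtain _ | s := s
        · rw [jordanOperator_zero e hs rfl, jordanOperator_zero e _ rfl, map_zero, map_zero]
        · rw [jordanOperator_succ, blockShift_apply]
      · rw [blockShift_apply_of_ne e hij hl hs]
        obtain _ | s := s
        · rw [jordanOperator_zero e hs rfl]
          simp
        · rw [jordanOperator_succ, blockShift_apply_of_ne e hij hl]
          simp
  ψ_T_ψ := eq_of_forall_basis e
    (f := (blockShift e hij ∘L jordanOperator e ∘L blockShift e hij : 𝔼 →ₗ[ℝ] 𝔼)) (g := 0)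
    fun l s hs => by
      change blockShift e hij (jordanOperator e (blockShift e hij (e ⟨l, s, hs⟩))) = 0
      have hne : i ≠ j := fun h => hij.ne (h ▸ rfl)
      obtain rfl | hl := eq_or_ne l j
      · rw [blockShift_apply e hij hs, jordanOperator_succ, blockShift_apply_of_ne e hij hne]
      · rw [blockShift_apply_of_ne e hij hl hs, map_zero, map_zero]

end Example

/-- Write the shortest length as `p + 1`. The vectors at position `p` of blocks `j` and `k` are
killed by `T ^ (p + 1)`. Their bracket is the vector at position `p + 1` of the longer block `i`,
and `T ^ (p + 1)` sends it to the bottom vector of that block. The same bracket shows that the group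
is not abelian. -/
theorem exists_leftInvariant_tensor {n m : ℕ} (hn : 1 ≤ n) {d : Fin m → ℕ}
    (hpos : ∀ i, 1 ≤ d i) (hsum : ∑ i, d i = n) (h : ¬ BlockCondition d) :
    ∃ (D : TwoStepData n), Group.nilpotencyClass (TwoStepGroup.{u} D) = 2 ∧
      HasJordanForm d (D.T : EuclideanSpace ℝ (Fin n) →ₗ[ℝ] EuclideanSpace ℝ (Fin n)) ∧
      ∃ p : ℕ, 1 ≤ p ∧ IsLeast (Set.range d) p ∧
        ¬ IsIntegrableDistribution (kerPow (TwoStepGroup.tensor (D := D)) p) := by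
  have hm : 0 < m := by
    rcases Nat.eq_zero_or_pos m with rfl | h
    · simp at hsum
      omega
    · exact h
  obtain ⟨i, j, k, hij, hkj, hk⟩ := exists_indices_of_not_blockCondition hm h
  have hkd : d k ≤ d j := hk.2 (mem_range_self j)
  have hki : k ≠ i := by
    rintro rfl
    omega
  have hcard : Fintype.card (Fin n) = Fintype.card (Σ i : Fin m, Fin (d i)) := by
    simp [hsum]
  let e : Module.Basis (Σ i : Fin m, Fin (d i)) ℝ (EuclideanSpace ℝ (Fin n)) :=
    (EuclideanSpace.basisFun (Fin n) ℝ).toBasis.reindex (Fintype.equivOfCardEq hcard)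
  obtain ⟨p, hp⟩ : ∃ p, d k = p + 1 := ⟨d k - 1, by have := hpos k; omega⟩
  let D := blockData e hij hki (hpos k)
  have hpj : p < d j := by omega
  have hpk : p < d k := by omega
  have hγj : D.γ (e ⟨j, p, hpj⟩) = 0 := by
    simp [D, blockData, hkj.symm]
  have hγk : D.γ (e ⟨k, p, hpk⟩) = 1 := by
    simp [D, blockData, hp]
  have hψ : D.ψ (e ⟨j, p, hpj⟩) = e ⟨i, p + 1, by omega⟩ := blockShift_apply e hij hpj
  refine ⟨D, TwoStepGroup.nilpotencyClass_eq_two (x := e ⟨j, p, hpj⟩) (y := e ⟨k, p, hpk⟩) ?_,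
    hasJordanForm_jordanOperator e, d k, hpos k, hk, ?_⟩
  · rw [hγj, hγk, hψ, one_smul, zero_smul]
    exact e.ne_zero _
  · rw [hp]
    refine TwoStepGroup.not_isIntegrableDistribution_kerPow (a := e ⟨j, p, hpj⟩)
      (b := e ⟨k, p, hpk⟩) (jordanOperator_pow_eq_zero e hpj) (jordanOperator_pow_eq_zero e hpk) ?_
    rw [hγj, hγk, hψ, one_smul, zero_smul, sub_zero]
    have h1 := jordanOperator_pow e (p + 1) (k := 0) (i := i) (by omega)
    simp only [zero_add] at h1
    change ((jordanOperator e : EuclideanSpace ℝ (Fin n) →ₗ[ℝ] EuclideanSpace ℝ (Fin n)) ^ (p + 1))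
      _ ≠ 0
    rw [h1]
    exact e.ne_zero _

end NilpotentTensor

/-! ### The main theorem -/

theorem theoremB (n m : ℕ) (hn : 1 ≤ n) (d : Fin m → ℕ) (hd : Antitone d)
    (hpos : ∀ i, 1 ≤ d i) (hsum : ∑ i, d i = n) :
    (NilpotentTensor.ControlledByNijenhuis.{u} n d ↔ NilpotentTensor.BlockCondition d) ∧
    (¬ NilpotentTensor.BlockCondition d →
      ∃ (G : Type u) (_ : TopologicalSpace G) (_ : T2Space G) (_ : SecondCountableTopology G)
        (_ : ConnectedSpace G) (_ : ChartedSpace (EuclideanSpace ℝ (Fin n)) G) (_ : Group G)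
        (_ : LieGroup (𝓡 n) ∞ G) (_ : Group.IsNilpotent G)
        (Θ : ∀ x : G, TangentSpace (𝓡 n) x →L[ℝ] TangentSpace (𝓡 n) x),
        Group.nilpotencyClass G = 2 ∧
        NilpotentTensor.IsSmoothTensor Θ ∧
        NilpotentTensor.HasAlgebraicType d Θ ∧
        NilpotentTensor.IsLeftInvariant Θ ∧
        NilpotentTensor.NijenhuisVanishes Θ ∧
        ∃ p : ℕ, 1 ≤ p ∧ IsLeast (Set.range d) p ∧
          ¬ NilpotentTensor.IsIntegrableDistribution (NilpotentTensor.kerPow Θ p)) := by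
  refine ⟨⟨fun h => ?_, fun h => h.controlledByNijenhuis⟩, fun h => ?_⟩
  · by_contra hb
    -- Control is quantified over manifolds in universe `u`, so the counterexample is taken in that
    -- universe.
    obtain ⟨D, -, hT, p, -, -, hp⟩ := NilpotentTensor.exists_leftInvariant_tensor.{u} hn hpos hsum hb
    exact hp ((h (NilpotentTensor.TwoStepGroup.{u} D) NilpotentTensor.TwoStepGroup.tensor
      NilpotentTensor.TwoStepGroup.isSmoothTensor_tensor
      (NilpotentTensor.TwoStepGroup.hasAlgebraicType_tensor hT)
      NilpotentTensor.TwoStepGroup.nijenhuisVanishes_tensor).isIntegrableDistribution_kerPow p)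
  · obtain ⟨D, hc, hT, p, h1, h2, hp⟩ :=
      NilpotentTensor.exists_leftInvariant_tensor.{u} hn hpos hsum h
    exact ⟨NilpotentTensor.TwoStepGroup.{u} D, inferInstance, inferInstance, inferInstance,
      inferInstance, inferInstance, inferInstance, inferInstance, inferInstance,
      NilpotentTensor.TwoStepGroup.tensor, hc, NilpotentTensor.TwoStepGroup.isSmoothTensor_tensor,
      NilpotentTensor.TwoStepGroup.hasAlgebraicType_tensor hT,
      NilpotentTensor.TwoStepGroup.isLeftInvariant_tensor,
      NilpotentTensor.TwoStepGroup.nijenhuisVanishes_tensor, p, h1, h2, hp⟩
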